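/- Let $\Lambda\subset\mathbb{R}^2\cong\mathbb{C}$ be any lattice (of rank 2), $z=x_1+ix_2$, $M=\mathbb{C}/\Lambda$ with the Euclidean metric, and let $\wp$ be the Weierstrass function of $\Lambda$, so that $\wp'(z)^2=4\wp(z)^3-c_2\wp(z)-c_3$ with constants $c_2,c_3$ ($=g_2(\Lambda),g_3(\Lambda)$). On the unit sphere $S^2\subset\mathbb{R}^3$ use the stereographic coordinate $W=(p_1+ip_2)/(1-p_3)$, the usual metric $h$, the complex structure and orientation for which $W$ is holomorphic, and the corresponding Kähler (area) form $\omega$. Put $$U(W)=\frac{4\,|4W^3-c_2W-c_3|}{(1+|W|^2)^2},\qquad U(\infty)=0,$$ and let $\langle U\rangle$ be the average of $U$ over $S^2$. For a field $\phi:M\to S^2$ (an $H^1$ map) and a Riemannian metric $g$ on $M$ let $$E_2=\tfrac12\int_M|d\phi|_g^2\,\mathrm{vol}_g,\quad E_4=\tfrac12\int_M|\phi^*\omega|_g^2\,\mathrm{vol}_g,\quad E_0=\tfrac12\int_M U(\phi)^2\,\mathrm{vol}_g,\quad E=E_0+E_2+E_4,$$ where $g$ is the Euclidean metric unless stated otherwise,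 and let $\deg\phi=\frac1{4\pi}\int_M\phi^*\omega$. Let $\mathbb{E}$ be the space of constant-coefficient symmetric bilinear forms $\sum\varepsilon_{ij}dx_idx_j$ on $M$. The stress tensor $S$ of $\phi$ is the symmetric bilinear form with $\frac{d}{dt}\big|_{t=0}E(\phi,g_t)=\langle \partial_tg_t|_{t=0},S\rangle_{L^2}$ for all smooth variations $g_t$ of the Euclidean metric $g_0$. A field is an energy minimizer if it minimizes $E$ among all fields of its degree; an energy minimizer is a soliton lattice if $S$ is $L^2$-orthogonal to $\mathbb{E}$, and a soliton lattice is a soliton crystal if, in addition, the hessian at the Euclidean metric of $g\mapsto E(\phi,g)$, restricted to the constant-coefficient metrics, is a positive definite bilinear form on $\mathbb{E}$. Then the map $\phi_\wp:M\to S^2$ defined by $W=\wp(z)$ (with $W=\infty$ at the lattice points) is smooth and holomorphic and has degree $2$. Every field $\psi:M\to S^2$ of finite energy satisfies $$E_2(\psi)\ge 4\pi\deg\psi,\qquad E_0(\psi)+E_4(\psi)\ge 4\pi\langle U\rangle\deg\psi,$$ and $\phi_\wp$ attains equality in both bounds. Consequently $\phi_\wp$ is an energy minimizer, a soliton lattice,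 and a soliton crystal with periodicity $\Lambda$. -/

import Mathlib

open scoped ContDiff Matrix

noncomputable section

namespace BabySkyrme

open MeasureTheory

/-- Euclidean three-space. -/
abbrev E3 : Type := EuclideanSpace ℝ (Fin 3)

/-- The unit two-sphere, with the metric induced from `E3`. -/
abbrev S2 : Type := Metric.sphere (0 : E3) 1

/-- The north pole `(0, 0, 1)`, that is, the point `W = ∞`. -/
def northPole : S2 := ⟨!₂[0, 0, 1], by
  simp [EuclideanSpace.norm_eq, Fin.sum_univ_three]⟩

/-- The stereographic coordinate `W = (p₁ + i p₂) / (1 - p₃)`, for `p` other than the north pole. -/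
def stereo (p : S2) : ℂ :=
  ((p.1 0 : ℂ) + Complex.I * (p.1 1 : ℂ)) / (1 - (p.1 2 : ℂ))

/-- The point of the sphere whose stereographic coordinate is `W`. -/
def invStereo (W : ℂ) : S2 :=
  ⟨!₂[2 * W.re / (1 + ‖W‖ ^ 2), 2 * W.im / (1 + ‖W‖ ^ 2), (‖W‖ ^ 2 - 1) / (1 + ‖W‖ ^ 2)], by
    have h : (1 + ‖W‖ ^ 2) ≠ 0 := by positivity
    have h2 : ‖W‖ ^ 2 = W.re ^ 2 + W.im ^ 2 := by
      rw [← Complex.normSq_eq_norm_sq, Complex.normSq_apply]; ring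
    rw [mem_sphere_zero_iff_norm, EuclideanSpace.norm_eq, Real.sqrt_eq_one,
      Fin.sum_univ_three]
    simp only [Real.norm_eq_abs, sq_abs]
    simp only [Matrix.cons_val_zero, Matrix.cons_val_one, Matrix.cons_val]
    rw [div_pow, div_pow, div_pow, ← add_div, ← add_div, div_eq_one_iff_eq (pow_ne_zero 2 h), h2]
    ring⟩

/-- `invStereo` inverts the stereographic coordinate. -/
theorem stereo_invStereo (W : ℂ) : stereo (invStereo W) = W := by
  have h : (1 + (‖W‖ : ℂ) ^ 2) ≠ 0 := by
    have : (1 + ‖W‖ ^ 2) ≠ 0 := by positivity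
    exact_mod_cast this
  simp only [stereo, invStereo, PiLp.toLp_apply, Matrix.cons_val_zero, Matrix.cons_val_one,
    Matrix.cons_val]
  push_cast
  have h3 : (1 : ℂ) - ((‖W‖ : ℂ) ^ 2 - 1) / (1 + (‖W‖ : ℂ) ^ 2) = 2 / (1 + (‖W‖ : ℂ) ^ 2) := by
    field_simp; ring
  rw [h3]
  field_simp
  linear_combination Complex.re_add_im W

/-- The Kähler (area) form of the unit sphere at `p`. The orientation is the one given by the
complex structure in which the stereographic coordinate `W` is holomorphic; since `W` projects from
the north pole, this is `ω_p(X, Y) = p · (Y × X)`. -/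
def kahler (p : S2) (X Y : E3) : ℝ :=
  p.1.ofLp ⬝ᵥ (crossProduct Y.ofLp X.ofLp)

/-- The complex structure of the sphere at `p` in that orientation, `J X = X × p`. -/
def cplxStructure (p : S2) (X : E3) : E3 :=
  WithLp.toLp 2 (crossProduct X.ofLp p.1.ofLp)

/-- The average value of `U` over the unit sphere with respect to surface area. -/
def sphereAverage (U : S2 → ℝ) : ℝ :=
  ⨍ p, U p ∂((volume : Measure E3).toSphere)

/-- The coordinate frame `∂/∂x₁, ∂/∂x₂` of the plane, with complex coordinate `z = x₁ + i x₂`. -/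
def frame : Fin 2 → ℂ := ![1, Complex.I]

/-- A period cell for the torus `ℂ / Λ`. Integrals over the torus are integrals over the cell. -/
def cell (L : PeriodPair) : Set ℂ := ZSpan.fundamentalDomain L.basis

/-- A finite-energy `H¹` map from the torus `ℂ / Λ` to the unit sphere, given by its `Λ`-periodic
lift `toFun` to the plane together with its weak differential `diff`. -/
structure SkyrmeField (L : PeriodPair) where
  toFun : ℂ → S2
  diff : ℂ → (ℂ →L[ℝ] E3)
  periodic : ∀ l ∈ L.lattice, ∀ z, toFun (z + l) = toFun z
  diff_periodic : ∀ l ∈ L.lattice, ∀ z, diff (z + l) = diff z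
  measurable : AEStronglyMeasurable (fun z => (toFun z : E3)) volume
  diff_memLp : MemLp diff 2 (volume.restrict (cell L))
  weak_diff : ∀ f : ℂ → ℝ, ContDiff ℝ ∞ f → HasCompactSupport f → ∀ v : ℂ,
    ∫ z, (fderiv ℝ f z v) • (toFun z : E3) = -∫ z, f z • diff z v
  finite_energy :
    IntegrableOn (fun z => kahler (toFun z) (diff z 1) (diff z Complex.I) ^ 2) (cell L) volume

/-- Symmetric `2 × 2` real matrices, that is, constant-coefficient (parallel) symmetric bilinear
forms `∑ ε i j dxᵢ dxⱼ` on the torus. -/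
def parallelForms : Submodule ℝ (Matrix (Fin 2) (Fin 2) ℝ) where
  carrier := {ε | ε.IsSymm}
  add_mem' := fun ha hb => ha.add hb
  zero_mem' := Matrix.isSymm_zero
  smul_mem' := fun c _ ha => ha.smul c

/-- A smooth one-parameter variation of the Euclidean metric on the torus. Metrics on the torus are
`Λ`-periodic positive definite matrices `gᵢⱼ` of coefficients. -/
structure IsMetricVariation (L : PeriodPair) (g : ℝ → ℂ → Matrix (Fin 2) (Fin 2) ℝ) : Prop where
  smooth : ∀ i j, ContDiff ℝ ∞ (fun q : ℝ × ℂ => g q.1 q.2 i j)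
  periodic : ∀ t, ∀ l ∈ L.lattice, ∀ z, g t (z + l) = g t z
  posDef : ∀ t z, (g t z).PosDef
  at_zero : ∀ z, g 0 z = 1

/-- A smooth two-parameter variation of the Euclidean metric among constant-coefficient metrics. -/
structure IsParallelVariation (g : ℝ → ℝ → Matrix (Fin 2) (Fin 2) ℝ) : Prop where
  smooth : ∀ i j, ContDiff ℝ ∞ (fun q : ℝ × ℝ => g q.1 q.2 i j)
  posDef : ∀ s t, (g s t).PosDef
  at_zero : g 0 0 = 1

namespace SkyrmeField

variable {L : PeriodPair}

/-- The coefficient of the pulled back Kähler form `φ^*ω` with respect to `dx₁ ∧ dx₂`. -/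
def pullbackKahler (Φ : SkyrmeField L) (z : ℂ) : ℝ :=
  kahler (Φ.toFun z) (Φ.diff z (frame 0)) (Φ.diff z (frame 1))

/-- The degree `(4π)⁻¹ ∫ φ^*ω`. -/
def degree (Φ : SkyrmeField L) : ℝ :=
  (1 / (4 * Real.pi)) * ∫ z in cell L, Φ.pullbackKahler z

/-- `E₂ = ½ ∫ |dφ|² vol_g`. -/
def energy2 (Φ : SkyrmeField L) (g : ℂ → Matrix (Fin 2) (Fin 2) ℝ) : ℝ :=
  (1 / 2) * ∫ z in cell L,
    (∑ i, ∑ j, (g z)⁻¹ i j * inner ℝ (Φ.diff z (frame i)) (Φ.diff z (frame j))) *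
      Real.sqrt (g z).det

/-- `E₄ = ½ ∫ |φ^*ω|² vol_g`. -/
def energy4 (Φ : SkyrmeField L) (g : ℂ → Matrix (Fin 2) (Fin 2) ℝ) : ℝ :=
  (1 / 2) * ∫ z in cell L, (Φ.pullbackKahler z ^ 2 / (g z).det) * Real.sqrt (g z).det

/-- `E₀ = ½ ∫ U(φ)² vol_g`. -/
def energy0 (U : S2 → ℝ) (Φ : SkyrmeField L) (g : ℂ → Matrix (Fin 2) (Fin 2) ℝ) : ℝ :=
  (1 / 2) * ∫ z in cell L, U (Φ.toFun z) ^ 2 * Real.sqrt (g z).det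

/-- The baby Skyrme energy of a field with respect to the metric `g` on the torus. The Euclidean
metric is `g = 1`. -/
def energy (U : S2 → ℝ) (Φ : SkyrmeField L) (g : ℂ → Matrix (Fin 2) (Fin 2) ℝ) : ℝ :=
  Φ.energy2 g + Φ.energy4 g + energy0 U Φ g

/-- `Φ` minimizes the energy, on the fixed Euclidean torus, among all fields of its degree. -/
def IsMinimizer (U : S2 → ℝ) (Φ : SkyrmeField L) : Prop :=
  ∀ Ψ : SkyrmeField L, Ψ.degree = Φ.degree → energy U Φ 1 ≤ energy U Ψ 1

/-- The `L²` inner product, over the Euclidean torus, of two symmetric bilinear forms. -/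
def formInner (L : PeriodPair) (S ε : ℂ → Matrix (Fin 2) (Fin 2) ℝ) : ℝ :=
  ∫ z in cell L, ∑ i, ∑ j, S z i j * ε z i j

/-- `S` is the stress tensor of `Φ`: the integrable symmetric bilinear form on the torus that
represents the first variation of the energy under every variation of the Euclidean metric. -/
structure IsStressTensor (U : S2 → ℝ) (Φ : SkyrmeField L)
    (S : ℂ → Matrix (Fin 2) (Fin 2) ℝ) : Prop where
  symm : ∀ z, (S z).IsSymm
  periodic : ∀ l ∈ L.lattice, ∀ z, S (z + l) = S z
  integrable : ∀ i j, IntegrableOn (fun z => S z i j) (cell L) volume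
  first_variation : ∀ g : ℝ → ℂ → Matrix (Fin 2) (Fin 2) ℝ, IsMetricVariation L g →
    HasDerivAt (fun t => energy U Φ (g t))
      (formInner L S (fun z => Matrix.of fun i j => deriv (fun t => g t z i j) 0)) 0

/-- A soliton lattice: an energy minimizer whose stress tensor is `L²` orthogonal to all parallel
symmetric bilinear forms. -/
def IsSolitonLattice (U : S2 → ℝ) (Φ : SkyrmeField L) : Prop :=
  IsMinimizer U Φ ∧
    ∃ S, IsStressTensor U Φ S ∧ ∀ ε ∈ parallelForms, formInner L S (fun _ => ε) = 0

/-- `H` is the hessian of the energy at the Euclidean metric, with respect to variations among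
constant-coefficient metrics: `H(ε', ε) = ∂²E(Φ, g s t) / ∂s ∂t` at `s = t = 0`, where
`ε' = ∂g/∂s` and `ε = ∂g/∂t` there. -/
def IsHessian (U : S2 → ℝ) (Φ : SkyrmeField L) (H : LinearMap.BilinForm ℝ parallelForms) : Prop :=
  (∀ ε' ε, H ε' ε = H ε ε') ∧
  ∀ (g : ℝ → ℝ → Matrix (Fin 2) (Fin 2) ℝ) (ε' ε : parallelForms), IsParallelVariation g →
    (∀ i j, HasDerivAt (fun s => g s 0 i j) (ε'.1 i j) 0) →
    (∀ i j, HasDerivAt (fun t => g 0 t i j) (ε.1 i j) 0) →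
    ∃ F : ℝ → ℝ, (∀ s, HasDerivAt (fun t => energy U Φ (fun _ => g s t)) (F s) 0) ∧
      HasDerivAt F (H ε' ε) 0

/-- A soliton crystal: a soliton lattice whose hessian is positive definite. -/
def IsSolitonCrystal (U : S2 → ℝ) (Φ : SkyrmeField L) : Prop :=
  IsSolitonLattice U Φ ∧ ∃ H, IsHessian U Φ H ∧ ∀ ε, ε ≠ 0 → 0 < H ε ε

end SkyrmeField

/-- A smooth map from the plane to the sphere is holomorphic if its differential intertwines
multiplication by `i` with the complex structure of the sphere. -/
def IsHolomorphicMap (φ : ℂ → S2) : Prop :=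
  ContDiff ℝ ∞ (fun z => (φ z : E3)) ∧
    ∀ z v, fderiv ℝ (fun z => (φ z : E3)) z (Complex.I * v) =
      cplxStructure (φ z) (fderiv ℝ (fun z => (φ z : E3)) z v)

open Classical in
/-- The map `ℂ → S²` with stereographic coordinate `W = ℘(z)`, which is `∞` on the lattice. -/
def weierstrassMap (L : PeriodPair) (z : ℂ) : S2 :=
  if z ∈ L.lattice then northPole else invStereo (L.weierstrassP z)

open Classical in
/-- The function `U = 4 |4 W³ - c₂ W - c₃| / (1 + |W|²)²` on the sphere, extended continuously by
`U = 0` to `W = ∞`. -/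
def weierstrassPotential (c₂ c₃ : ℂ) (p : S2) : ℝ :=
  if p = northPole then 0
  else 4 * ‖4 * stereo p ^ 3 - c₂ * stereo p - c₃‖ / (1 + ‖stereo p‖ ^ 2) ^ 2

end BabySkyrme

end

open BabySkyrme BabySkyrme.SkyrmeField

noncomputable section

namespace BabySkyrme

open MeasureTheory Filter Topology

/-! ### Stereographic charts -/

/-! Both energy bounds are Bogomolny arguments. Pointwise `2 φ^*ω(∂₁,∂₂) ≤ |∂₁φ|² + |∂₂φ|²`, because
the difference is a sum of squares (`two_mul_kahler_le`); integrating gives the bound for `E₂`.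
Likewise `(U(φ) - φ^*ω)² ≥ 0` bounds `E₀ + E₄` below by `∫ U(φ) φ^*ω`, and this integral equals `4π
⟨U⟩ deg φ`.

For maps that are only `H¹`, the last identity is the analytic core
(`setIntegral_comp_mul_pullbackKahler`). For a polynomial `P` on `ℝ³`, the pullback of the exact
form `d(P dpⱼ)` has integral zero. For smooth `ℝ³`-valued maps this is Stokes on the torus, and it
passes to `φ` by mollification; the mollified maps need not stay on the sphere, since the form is
exact on all of `ℝ³` (`SkyrmeField.setIntegral_cell_minor`). These relations say that `P ↦ ∫ P(φ)
φ^*ω` is annihilated by infinitesimal rotations. So is the average over the sphere, and such a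
functional is determined by its value at `1`, by recursion on monomials
(`IsRotationInvariant.eq_zero`). Hence the two are proportional, and Stone–Weierstrass extends this
from polynomials to continuous `U`.

For `W = ℘(z)` the map is holomorphic, so the first inequality is a pointwise equality. The
differential equation of `℘` turns `U(φ)` into `4|℘'|²/(1+|℘|²)²`, which is both `|∂₁φ|²` and
`φ^*ω`, so the second one is an equality too (`weierstrassPotential_weierstrassMap`,
`pullbackKahler_weierstrassField`).

The degree comes from moments. With `h = (1 + p₃)/2` the average of `h^N` is `1/(N+1)`, so `(N+1) ∫
h(φ)^N φ^*ω = 4π deg φ` for every `N`. As `N → ∞` the integral concentrates at the pole of `℘`,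
where `h(φ) ≈ 1 - |z|⁴` and `φ^*ω ≈ 16|z|²`; Laplace's method gives the limit `8π`, so the degree is
`2`.

For a metric `m`, the energy density of `φ` is a combination of `tr m / √det m` and `√det m + 1/√det
m`. Both have a critical point at `m = 1`, so the stress tensor vanishes identically. Their second
derivatives see the trace-free part and the trace of a variation respectively, so with positive
weights the hessian is positive definite. -/

/-- The derivative of `invStereo` at `W` in the direction `V`. -/
def invStereoDeriv (W V : ℂ) : E3 :=
  !₂[2 * V.re / (1 + ‖W‖ ^ 2) - 2 * W.re * (2 * (W.re * V.re + W.im * V.im)) / (1 + ‖W‖ ^ 2) ^ 2,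
    2 * V.im / (1 + ‖W‖ ^ 2) - 2 * W.im * (2 * (W.re * V.re + W.im * V.im)) / (1 + ‖W‖ ^ 2) ^ 2,
    2 * (2 * (W.re * V.re + W.im * V.im)) / (1 + ‖W‖ ^ 2) ^ 2]

lemma norm_sq_eq_re_im (W : ℂ) : ‖W‖ ^ 2 = W.re ^ 2 + W.im ^ 2 := by
  rw [← Complex.normSq_eq_norm_sq, Complex.normSq_apply]; ring

lemma hasDerivAt_re {w : ℝ → ℂ} {w' : ℂ} {t : ℝ} (h : HasDerivAt w w' t) :
    HasDerivAt (fun t => (w t).re) w'.re t :=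
  Complex.reCLM.hasFDerivAt.comp_hasDerivAt t h

lemma hasDerivAt_im {w : ℝ → ℂ} {w' : ℂ} {t : ℝ} (h : HasDerivAt w w' t) :
    HasDerivAt (fun t => (w t).im) w'.im t :=
  Complex.imCLM.hasFDerivAt.comp_hasDerivAt t h

lemma hasDerivAt_euclidean {n : ℕ} {f : ℝ → EuclideanSpace ℝ (Fin n)}
    {f' : EuclideanSpace ℝ (Fin n)} {t : ℝ}
    (h : ∀ i, HasDerivAt (fun s => f s i) (f' i) t) : HasDerivAt f f' t := by
  rw [hasDerivAt_iff_hasFDerivAt, ← hasFDerivWithinAt_univ, hasFDerivWithinAt_euclidean]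
  intro i
  have := (h i).hasFDerivAt.hasFDerivWithinAt (s := Set.univ)
  convert! this using 1

lemma hasDerivAt_invStereo {w : ℝ → ℂ} {w' : ℂ} {t : ℝ} (h : HasDerivAt w w' t) :
    HasDerivAt (fun t => (invStereo (w t) : E3)) (invStereoDeriv (w t) w') t := by
  have hr := hasDerivAt_re h
  have hi := hasDerivAt_im h
  have hn : HasDerivAt (fun t => 1 + ‖w t‖ ^ 2)
      (2 * ((w t).re * w'.re + (w t).im * w'.im)) t := by
    simp_rw [norm_sq_eq_re_im]
    convert! ((hr.pow 2).add (hi.pow 2)).const_add 1 using 1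
    simp; ring
  have h0 : 1 + ‖w t‖ ^ 2 ≠ 0 := by positivity
  refine hasDerivAt_euclidean fun i => ?_
  fin_cases i
  · have := (hr.const_mul 2).div hn h0
    convert! this using 1
    simp [invStereoDeriv]
    field_simp
  · have := (hi.const_mul 2).div hn h0
    convert! this using 1
    simp [invStereoDeriv]
    field_simp
  · have := (hn.sub_const 2).div hn h0
    convert! this using 1
    · ext s; simp [invStereo]; ring
    · simp [invStereoDeriv]
      field_simp
      ring

/-- This checks the orientation convention: it is `X × p`, not `p × X`, that makes `W` a holomorphic
coordinate. -/
lemma cplxStructure_invStereoDeriv (W V : ℂ) :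
    cplxStructure (invStereo W) (invStereoDeriv W V) = invStereoDeriv W (Complex.I * V) := by
  have h0 : 1 + (W.re ^ 2 + W.im ^ 2) ≠ 0 := by positivity
  ext i
  fin_cases i <;>
  · simp [cplxStructure, invStereo, invStereoDeriv, cross_apply, norm_sq_eq_re_im]
    field_simp
    ring

lemma inner_e3 (X Y : E3) : inner ℝ X Y = X 0 * Y 0 + X 1 * Y 1 + X 2 * Y 2 := by
  simp [PiLp.inner_apply, Fin.sum_univ_three]; ring

lemma norm_sq_e3 (X : E3) : ‖X‖ ^ 2 = X 0 ^ 2 + X 1 ^ 2 + X 2 ^ 2 := by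
  rw [EuclideanSpace.norm_sq_eq, Fin.sum_univ_three]; simp

lemma inner_invStereoDeriv_self (W V : ℂ) :
    inner ℝ (invStereoDeriv W V) (invStereoDeriv W V) = 4 * ‖V‖ ^ 2 / (1 + ‖W‖ ^ 2) ^ 2 := by
  have h0 : 1 + (W.re ^ 2 + W.im ^ 2) ≠ 0 := by positivity
  rw [inner_e3]
  simp [invStereoDeriv, norm_sq_eq_re_im]
  field_simp
  ring

lemma inner_invStereo_invStereoDeriv (W V : ℂ) :
    inner ℝ (invStereo W : E3) (invStereoDeriv W V) = 0 := by
  have h0 : 1 + (W.re ^ 2 + W.im ^ 2) ≠ 0 := by positivity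
  rw [inner_e3]
  simp [invStereoDeriv, invStereo, norm_sq_eq_re_im]
  field_simp
  ring

lemma kahler_apply (p : S2) (X Y : E3) :
    kahler p X Y = p.1 0 * (Y 1 * X 2 - Y 2 * X 1) + p.1 1 * (Y 2 * X 0 - Y 0 * X 2) +
      p.1 2 * (Y 0 * X 1 - Y 1 * X 0) := by
  simp [kahler, cross_apply, dotProduct, Fin.sum_univ_three]

lemma sum_sq_sphere (p : S2) : p.1 0 ^ 2 + p.1 1 ^ 2 + p.1 2 ^ 2 = 1 := by
  rw [← norm_sq_e3]; simp

/-- The triple product expands to `|p|²|X|² - (p · X)²`, and tangency removes the second term. -/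
lemma kahler_cplxStructure (p : S2) (X : E3) (h : inner ℝ (p : E3) X = 0) :
    kahler p X (cplxStructure p X) = inner ℝ X X := by
  rw [inner_e3] at h ⊢
  rw [kahler_apply]
  simp only [cplxStructure, cross_apply]
  simp
  linear_combination (X 0 ^ 2 + X 1 ^ 2 + X 2 ^ 2) * sum_sq_sphere p -
    (p.1 0 * X 0 + p.1 1 * X 1 + p.1 2 * X 2) * h

lemma inner_cplxStructure (p : S2) (X : E3) :
    inner ℝ X (cplxStructure p X) = 0 := by
  rw [inner_e3]
  simp [cplxStructure, cross_apply]
  ring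

lemma inner_cplxStructure_self (p : S2) (X : E3) (h : inner ℝ (p : E3) X = 0) :
    inner ℝ (cplxStructure p X) (cplxStructure p X) = inner ℝ X X := by
  rw [inner_e3] at h ⊢
  rw [inner_e3]
  simp [cplxStructure, cross_apply]
  linear_combination (X 0 ^ 2 + X 1 ^ 2 + X 2 ^ 2) * sum_sq_sphere p -
    (p.1 0 * X 0 + p.1 1 * X 1 + p.1 2 * X 2) * h

/-- The point of the sphere at which the coordinate `1 / W` has the value `w`. -/
def invStereoAtInfty (w : ℂ) : E3 :=
  !₂[2 * w.re / (1 + ‖w‖ ^ 2), -(2 * w.im) / (1 + ‖w‖ ^ 2), (1 - ‖w‖ ^ 2) / (1 + ‖w‖ ^ 2)]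

lemma invStereo_eq_invStereoAtInfty {W : ℂ} (hW : W ≠ 0) :
    (invStereo W : E3) = invStereoAtInfty W⁻¹ := by
  have h0 : 1 + (W.re ^ 2 + W.im ^ 2) ≠ 0 := by positivity
  have h1 : W.re ^ 2 + W.im ^ 2 ≠ 0 := by
    rw [← norm_sq_eq_re_im]; positivity
  ext i
  fin_cases i <;>
  · simp [invStereo, invStereoAtInfty, norm_sq_eq_re_im, Complex.normSq_apply, ← sq,
      Complex.inv_re, Complex.inv_im]
    field_simp
    try ring

lemma invStereoAtInfty_zero : invStereoAtInfty 0 = (northPole : E3) := by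
  ext i
  fin_cases i <;> simp [invStereoAtInfty, northPole]

lemma contDiff_re {n : ℕ∞} : ContDiff ℝ n (fun W : ℂ => W.re) := Complex.reCLM.contDiff
lemma contDiff_im {n : ℕ∞} : ContDiff ℝ n (fun W : ℂ => W.im) := Complex.imCLM.contDiff

lemma contDiff_norm_sq_complex : ContDiff ℝ ∞ (fun W : ℂ => ‖W‖ ^ 2) := contDiff_norm_sq ℝ

lemma contDiff_invStereo : ContDiff ℝ ∞ (fun W : ℂ => (invStereo W : E3)) := by
  have hd : ContDiff ℝ ∞ (fun W : ℂ => 1 + ‖W‖ ^ 2) := contDiff_const.add contDiff_norm_sq_complex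
  have h0 : ∀ W : ℂ, 1 + ‖W‖ ^ 2 ≠ 0 := fun W => by positivity
  rw [contDiff_euclidean]
  intro i
  fin_cases i
  · exact (contDiff_const.mul contDiff_re).div hd h0
  · exact (contDiff_const.mul contDiff_im).div hd h0
  · exact (contDiff_norm_sq_complex.sub contDiff_const).div hd h0

lemma contDiff_invStereoAtInfty : ContDiff ℝ ∞ invStereoAtInfty := by
  have hd : ContDiff ℝ ∞ (fun W : ℂ => 1 + ‖W‖ ^ 2) := contDiff_const.add contDiff_norm_sq_complex
  have h0 : ∀ W : ℂ, 1 + ‖W‖ ^ 2 ≠ 0 := fun W => by positivity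
  rw [contDiff_euclidean]
  intro i
  fin_cases i
  · exact (contDiff_const.mul contDiff_re).div hd h0
  · exact (contDiff_const.mul contDiff_im).neg.div hd h0
  · exact (contDiff_const.sub contDiff_norm_sq_complex).div hd h0

section

open scoped Pointwise

/-! ### Periodic functions and the period cell -/

section Periodic

variable {L : PeriodPair}

lemma cell_isBounded (L : PeriodPair) : Bornology.IsBounded (cell L) :=
  ZSpan.fundamentalDomain_isBounded _

lemma measurableSet_cell (L : PeriodPair) : MeasurableSet (cell L) :=
  ZSpan.fundamentalDomain_measurableSet _

lemma volume_cell_lt_top (L : PeriodPair) : volume (cell L) < ⊤ :=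
  (cell_isBounded L).measure_lt_top

instance (L : PeriodPair) : IsFiniteMeasure (volume.restrict (cell L)) :=
  ⟨by simpa using volume_cell_lt_top L⟩

lemma isAddFundamentalDomain_cell (L : PeriodPair) (μ : Measure ℂ) :
    IsAddFundamentalDomain L.lattice.toAddSubgroup (cell L) μ := by
  rw [L.lattice_eq_span_range_basis]
  exact ZSpan.isAddFundamentalDomain' L.basis μ

lemma exists_add_mem_cell (L : PeriodPair) (z : ℂ) : ∃ l ∈ L.lattice, z + l ∈ cell L := by
  refine ⟨-(ZSpan.floor L.basis z : ℂ), ?_, ?_⟩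
  · rw [L.lattice_eq_span_range_basis]
    exact neg_mem (ZSpan.floor L.basis z).2
  · rw [← sub_eq_add_neg]
    exact ZSpan.fract_mem_fundamentalDomain L.basis z

instance (L : PeriodPair) : Countable L.lattice :=
  L.latticeEquivProd.toEquiv.countable_iff.mpr inferInstance

instance (L : PeriodPair) : Countable L.lattice.toAddSubgroup :=
  inferInstanceAs (Countable L.lattice)

variable {E : Type*} [NormedAddCommGroup E] [NormedSpace ℝ E]

/-- Any translate of the cell serves equally well for integrating periodic functions. This gives
translation invariance, and later a cell centred at the pole of `℘`. -/
lemma isAddFundamentalDomain_preimage_cell (L : PeriodPair) (c : ℂ) :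
    IsAddFundamentalDomain L.lattice.toAddSubgroup ((fun z => z + c) ⁻¹' cell L) volume := by
  refine IsAddFundamentalDomain.mk'
    ((measurableSet_cell L).preimage (measurable_add_const c)).nullMeasurableSet fun z => ?_
  have key : ∀ l : L.lattice.toAddSubgroup,
      (l +ᵥ z ∈ (fun z => z + c) ⁻¹' cell L) ↔ l +ᵥ (z + c) ∈ cell L := by
    intro l
    simp [AddSubgroup.vadd_def, add_assoc]
  simp_rw [key]
  have hL : ∀ x : ℂ, x ∈ L.lattice ↔ x ∈ Submodule.span ℤ (Set.range L.basis) := fun x => by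
    rw [L.lattice_eq_span_range_basis]
  obtain ⟨l, hl, hu⟩ := ZSpan.exist_unique_vadd_mem_fundamentalDomain L.basis (z + c)
  refine ⟨⟨l, (hL _).2 l.2⟩, hl, fun m hm => ?_⟩
  have := hu ⟨m, (hL _).1 m.2⟩ hm
  exact Subtype.ext (by rw [← this])

lemma setIntegral_cell_eq_preimage {G : ℂ → E}
    (hG : ∀ l ∈ L.lattice, ∀ z, G (z + l) = G z) (c : ℂ) :
    ∫ z in cell L, G z = ∫ z in (fun z => z + c) ⁻¹' cell L, G z :=
  (isAddFundamentalDomain_cell L volume).setIntegral_eq (isAddFundamentalDomain_preimage_cell L c)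
    fun l z => by rw [AddSubgroup.vadd_def, vadd_eq_add, add_comm]; exact hG l l.2 z

lemma integrableOn_preimage_cell {E : Type*} [NormedAddCommGroup E] {G : ℂ → E}
    (hG : ∀ l ∈ L.lattice, ∀ z, G (z + l) = G z) (hi : IntegrableOn G (cell L)) (c : ℂ) :
    IntegrableOn G ((fun z => z + c) ⁻¹' cell L) :=
  ((isAddFundamentalDomain_cell L volume).integrableOn_iff
    (isAddFundamentalDomain_preimage_cell L c)
    fun l z => by rw [AddSubgroup.vadd_def, vadd_eq_add, add_comm]; exact hG l l.2 z).1 hi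

/-- The integral of a periodic function over the cell is invariant under translations. -/
lemma setIntegral_cell_add {G : ℂ → E}
    (hG : ∀ l ∈ L.lattice, ∀ z, G (z + l) = G z) (c : ℂ) :
    ∫ z in cell L, G (z + c) = ∫ z in cell L, G z := by
  have h := (measurePreserving_add_right (volume : Measure ℂ) c).setIntegral_preimage_emb
    (MeasurableEquiv.addRight c).measurableEmbedding (fun z => G z) (cell L)
  rw [← h, setIntegral_cell_eq_preimage (G := fun z => G (z + c)) _ c]
  intro l hl z
  simpa [add_right_comm] using hG l hl (z + c)

/-- A periodic function that is integrable over the cell is locally integrable. -/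
lemma locallyIntegrable_of_periodic {E : Type*} [NormedAddCommGroup E] {G : ℂ → E}
    (hG : ∀ l ∈ L.lattice, ∀ z, G (z + l) = G z) (hi : IntegrableOn G (cell L)) :
    LocallyIntegrable G := by
  rw [locallyIntegrable_iff]
  intro K hK
  -- Lattice vectors that move some point of `K` into the cell. They lie in the bounded set `cell L
  -- - K`, so they are finite in number, and the corresponding translates of the cell cover `K`.
  let S : Set ℂ := {l | l ∈ L.lattice ∧ ∃ z ∈ K, z + l ∈ cell L}
  have hS : S.Finite := by
    have hb : Bornology.IsBounded (cell L - K) := (cell_isBounded L).sub hK.isBounded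
    refine (ZSpan.setFinite_inter L.basis hb).subset ?_
    rintro l ⟨hl, z, hz, hzl⟩
    refine ⟨⟨z + l, hzl, z, hz, by ring⟩, ?_⟩
    rw [← L.lattice_eq_span_range_basis]
    exact hl
  have hK' : K ⊆ ⋃ l ∈ S, (fun z => z + l) ⁻¹' cell L := by
    intro z hz
    obtain ⟨l, hl, hzl⟩ := exists_add_mem_cell L z
    exact Set.mem_biUnion (show l ∈ S from ⟨hl, z, hz, hzl⟩) hzl
  refine IntegrableOn.mono_set ?_ hK'
  rw [integrableOn_finite_biUnion hS]
  intro l _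
  exact integrableOn_preimage_cell hG hi l

lemma exists_bound_of_periodic {X : Type*} [SeminormedAddCommGroup X] {G : ℂ → X}
    (hc : Continuous G) (hG : ∀ l ∈ L.lattice, ∀ z, G (z + l) = G z) :
    ∃ C, ∀ z, ‖G z‖ ≤ C := by
  have := IsZLattice.isCompact_range_of_periodic L.lattice G hc (fun z w hw => hG w hw z)
  obtain ⟨C, hC⟩ := this.isBounded.exists_norm_le
  exact ⟨C, fun z => hC _ ⟨z, rfl⟩⟩

lemma integrableOn_cell_of_continuous {E : Type*} [NormedAddCommGroup E] {G : ℂ → E}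
    (hc : Continuous G) : IntegrableOn G (cell L) :=
  (hc.locallyIntegrable.integrableOn_isCompact (cell_isBounded L).isCompact_closure).mono_set
    subset_closure

lemma fderiv_periodic {G : ℂ → E} (hG : ∀ l ∈ L.lattice, ∀ z, G (z + l) = G z) :
    ∀ l ∈ L.lattice, ∀ z, fderiv ℝ G (z + l) = fderiv ℝ G z := by
  intro l hl z
  rw [← fderiv_comp_add_right]
  congr 1
  ext z
  exact hG l hl z

/-- Differentiation under the integral sign with a uniform bound. -/
lemma hasDerivAt_integral_of_bounded {X : Type*} [MeasurableSpace X] {μ : Measure X}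
    [IsFiniteMeasure μ] {f f' : ℝ → X → ℝ} (hm : ∀ t, AEStronglyMeasurable (f t) μ)
    (h0 : Integrable (f 0) μ) (hm' : AEStronglyMeasurable (f' 0) μ) {C : ℝ}
    (hb : ∀ t ∈ Set.Icc (-1 : ℝ) 1, ∀ x, ‖f' t x‖ ≤ C)
    (hd : ∀ t x, HasDerivAt (fun s => f s x) (f' t x) t) :
    HasDerivAt (fun t => ∫ x, f t x ∂μ) (∫ x, f' 0 x ∂μ) 0 := by
  refine (hasDerivAt_integral_of_dominated_loc_of_deriv_le (s := Set.Icc (-1 : ℝ) 1)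
    (bound := fun _ => C) (Icc_mem_nhds (by norm_num) (by norm_num))
    (Eventually.of_forall hm) h0 hm' ?_ (integrable_const C) ?_).2
  · exact Eventually.of_forall fun x t ht => hb t ht x
  · exact Eventually.of_forall fun x t _ => hd t x

/-- The integral of a directional derivative of a periodic function vanishes. -/
lemma setIntegral_cell_fderiv {G : ℂ → ℝ} (hs : ContDiff ℝ 1 G)
    (hG : ∀ l ∈ L.lattice, ∀ z, G (z + l) = G z) (v : ℂ) :
    ∫ z in cell L, fderiv ℝ G z v = 0 := by
  have hcf : Continuous (fun z => fderiv ℝ G z v) :=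
    (hs.continuous_fderiv (by norm_num)).clm_apply continuous_const
  obtain ⟨C, hC⟩ := exists_bound_of_periodic (L := L) hcf
    (fun l hl z => by rw [fderiv_periodic hG l hl z])
  -- Stokes on the torus: `t ↦ ∫ G(z + t v)` is constant, and its derivative at `0` is the integral
  -- in question.
  have key := hasDerivAt_integral_of_bounded (μ := volume.restrict (cell L))
    (f := fun t z => G (z + t • v)) (f' := fun t z => fderiv ℝ G (z + t • v) v) (C := C)
    (fun t => (hs.continuous.comp (by fun_prop)).aestronglyMeasurable)
    (integrableOn_cell_of_continuous (hs.continuous.comp (by fun_prop)))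
    (hcf.comp (g := fun z => fderiv ℝ G z v) (by fun_prop)).aestronglyMeasurable
    (fun t _ z => hC _) (fun t z => by
      have h1 : HasDerivAt (fun s : ℝ => z + s • v) v t := by
        simpa using ((hasDerivAt_id t).smul_const v).const_add z
      exact ((hs.differentiable (by norm_num)) _).hasFDerivAt.comp_hasDerivAt t h1)
  simp only [zero_smul, add_zero] at key
  have hconst : (fun t : ℝ => ∫ z in cell L, G (z + t • v)) = fun _ => ∫ z in cell L, G z := by
    ext t; exact setIntegral_cell_add hG _
  rw [hconst] at key
  exact key.unique (hasDerivAt_const _ _)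

/-- `∫ du ∧ dv = 0` on the torus. -/
lemma setIntegral_cell_wedge {u v : ℂ → ℝ} (hu : ContDiff ℝ ∞ u) (hv : ContDiff ℝ ∞ v)
    (hu' : ∀ l ∈ L.lattice, ∀ z, u (z + l) = u z) (hv' : ∀ l ∈ L.lattice, ∀ z, v (z + l) = v z)
    (a b : ℂ) :
    ∫ z in cell L, (fderiv ℝ u z a * fderiv ℝ v z b - fderiv ℝ u z b * fderiv ℝ v z a) = 0 := by
  -- The integrand is the coefficient of `d(u dv)`, a difference of two directional derivatives of
  -- periodic functions in which the second derivatives of `v` cancel by symmetry.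
  have hd : ∀ c, ContDiff ℝ ∞ (fun z => fderiv ℝ v z c) := fun c =>
    (hv.fderiv_right (m := ∞) (by simp)).clm_apply contDiff_const
  have hp : ∀ c, ContDiff ℝ ∞ (fun z => u z * fderiv ℝ v z c) := fun c => hu.mul (hd c)
  have hper : ∀ c, ∀ l ∈ L.lattice, ∀ z,
      u (z + l) * fderiv ℝ v (z + l) c = u z * fderiv ℝ v z c := by
    intro c l hl z
    rw [hu' l hl, fderiv_periodic hv' l hl]
  have hfd : ∀ c e z, fderiv ℝ (fun z => u z * fderiv ℝ v z c) z e =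
      u z * fderiv ℝ (fderiv ℝ v) z e c + fderiv ℝ v z c * fderiv ℝ u z e := by
    intro c e z
    have h2 : DifferentiableAt ℝ (fderiv ℝ v) z :=
      (hv.fderiv_right (m := ∞) (by simp)).differentiable (by simp) z
    have h3 : fderiv ℝ (fun z => fderiv ℝ v z c) z e = fderiv ℝ (fderiv ℝ v) z e c := by
      rw [fderiv_clm_apply h2 (differentiableAt_const c)]
      simp
    rw [fderiv_fun_mul (hu.differentiable (by simp) z) ((hd c).differentiable (by simp) z)]
    simp [h3]
  have h1 := setIntegral_cell_fderiv ((hp b).of_le (by simp)) (hper b) a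
  have h2 := setIntegral_cell_fderiv ((hp a).of_le (by simp)) (hper a) b
  have hint : ∀ c e, IntegrableOn (fun z => fderiv ℝ (fun z => u z * fderiv ℝ v z c) z e)
      (cell L) := fun c e => integrableOn_cell_of_continuous
    (((hp c).continuous_fderiv (by simp)).clm_apply continuous_const)
  have hsym : ∀ z, fderiv ℝ (fderiv ℝ v) z a b = fderiv ℝ (fderiv ℝ v) z b a := fun z =>
    (hv.contDiffAt.isSymmSndFDerivAt
      (by simp; exact WithTop.coe_le_coe.2 (le_top : (2 : ℕ∞) ≤ ⊤))).eq a b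
  rw [← sub_zero (0 : ℝ)]
  nth_rewrite 1 [← h1]
  rw [← h2, ← integral_sub (hint b a) (hint a b)]
  refine integral_congr_ae (Eventually.of_forall fun z => ?_)
  simp only [hfd, hsym]
  ring

end Periodic

end

section

open scoped Pointwise

/-! ### Mollification -/

section Mollify

open scoped Convolution

variable {L : PeriodPair}
variable {E : Type*} [NormedAddCommGroup E] [NormedSpace ℝ E]

/-- Dominated convergence with convergent dominating functions (Pratt's lemma). -/
lemma tendsto_integral_of_le_of_tendsto_integral {X : Type*} [MeasurableSpace X] {μ : Measure X}
    {h g : ℕ → X → ℝ} {h₀ g₀ : X → ℝ} (hh : ∀ n, AEStronglyMeasurable (h n) μ)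
    (hg : ∀ n, Integrable (g n) μ) (hg₀ : Integrable g₀ μ)
    (hle : ∀ n, ∀ᵐ x ∂μ, |h n x| ≤ g n x)
    (hlim : ∀ᵐ x ∂μ, Tendsto (fun n => h n x) atTop (𝓝 (h₀ x)))
    (glim : ∀ᵐ x ∂μ, Tendsto (fun n => g n x) atTop (𝓝 (g₀ x)))
    (gint : Tendsto (fun n => ∫ x, g n x ∂μ) atTop (𝓝 (∫ x, g₀ x ∂μ))) :
    Tendsto (fun n => ∫ x, h n x ∂μ) atTop (𝓝 (∫ x, h₀ x ∂μ)) := by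
  have hnn : ∀ᵐ x ∂μ, ∀ n, |h n x| ≤ g n x := ae_all_iff.2 hle
  have hh₀ : ∀ᵐ x ∂μ, |h₀ x| ≤ g₀ x := by
    filter_upwards [hnn, hlim, glim] with x h1 h2 h3
    exact le_of_tendsto_of_tendsto' h2.abs h3 h1
  have hmin : ∀ n, Integrable (fun x => min (g n x) (g₀ x)) μ := fun n => (hg n).inf hg₀
  have mlim : Tendsto (fun n => ∫ x, min (g n x) (g₀ x) ∂μ) atTop (𝓝 (∫ x, g₀ x ∂μ)) := by
    refine tendsto_integral_of_dominated_convergence g₀ (fun n => (hmin n).aestronglyMeasurable)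
      hg₀ (fun n => ?_) ?_
    · filter_upwards [hnn, hh₀] with x h1 h2
      have h3 := (abs_nonneg _).trans (h1 n)
      have h4 := (abs_nonneg _).trans h2
      rw [Real.norm_eq_abs, abs_of_nonneg (le_min h3 h4)]
      exact min_le_right _ _
    · filter_upwards [glim] with x h1
      simpa using h1.min (tendsto_const_nhds (x := g₀ x))
  -- Truncation of `h n` to `[-g₀, g₀]`, to which ordinary dominated convergence applies. The error
  -- is at most `g n - min (g n) g₀`, whose integral tends to `0`.
  let k : ℕ → X → ℝ := fun n x => max (-g₀ x) (min (h n x) (g₀ x))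
  have kmeas : ∀ n, AEStronglyMeasurable (k n) μ := fun n =>
    hg₀.aestronglyMeasurable.neg.sup ((hh n).inf hg₀.aestronglyMeasurable)
  have kb : ∀ n, ∀ᵐ x ∂μ, ‖k n x‖ ≤ g₀ x := by
    intro n
    filter_upwards [hh₀] with x h2
    have h4 := (abs_nonneg _).trans h2
    rw [Real.norm_eq_abs, abs_le]
    exact ⟨le_max_left _ _, max_le (by linarith) (min_le_right _ _)⟩
  have kint : ∀ n, Integrable (k n) μ := fun n => hg₀.mono' (kmeas n) (kb n)
  have klim : Tendsto (fun n => ∫ x, k n x ∂μ) atTop (𝓝 (∫ x, h₀ x ∂μ)) := by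
    refine tendsto_integral_of_dominated_convergence g₀ kmeas hg₀ kb ?_
    filter_upwards [hlim, hh₀] with x h1 h2
    have := (tendsto_const_nhds (x := -g₀ x)).max (h1.min (tendsto_const_nhds (x := g₀ x)))
    rwa [min_eq_left (abs_le.1 h2).2, max_eq_right (abs_le.1 h2).1] at this
  have hint : ∀ n, Integrable (h n) μ := fun n => (hg n).mono' (hh n) (hle n)
  have dlim : Tendsto (fun n => ∫ x, (h n x - k n x) ∂μ) atTop (𝓝 0) := by
    have h0 : Tendsto (fun n => ∫ x, (g n x - min (g n x) (g₀ x)) ∂μ) atTop (𝓝 0) := by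
      have := gint.sub mlim
      rw [sub_self] at this
      refine this.congr fun n => ?_
      rw [integral_sub (hg n) (hmin n)]
    refine squeeze_zero_norm (fun n => ?_) h0
    refine norm_integral_le_of_norm_le ((hg n).sub (hmin n)) ?_
    filter_upwards [hnn, hh₀] with x h1 h2
    have h4 := (abs_nonneg _).trans h2
    have h5 := abs_le.1 (h1 n)
    simp only [k, Real.norm_eq_abs]
    rw [abs_le]
    rcases le_total (h n x) (g₀ x) with h6 | h6 <;> rcases le_total (g n x) (g₀ x) with h7 | h7 <;>
      rcases le_total (-g₀ x) (h n x) with h8 | h8 <;>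
      simp only [min_eq_left h6, min_eq_right h6, min_eq_left h7, min_eq_right h7,
        max_eq_left h8, max_eq_right h8, max_eq_right (show -g₀ x ≤ g₀ x by linarith)] <;>
      constructor <;> linarith
  have := klim.add dlim
  rw [add_zero] at this
  refine this.congr fun n => ?_
  rw [integral_sub (hint n) (kint n)]
  ring

lemma locallyIntegrable_norm {E : Type*} [NormedAddCommGroup E] {g : ℂ → E}
    (hg : LocallyIntegrable g) :
    LocallyIntegrable (fun z => ‖g z‖) := fun z => (hg z).norm

/-- Convolution with a normalised bump function. -/
def mollify (b : ContDiffBump (0 : ℂ)) (g : ℂ → E) : ℂ → E :=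
  b.normed volume ⋆[ContinuousLinearMap.lsmul ℝ ℝ, volume] g

lemma mollify_apply (b : ContDiffBump (0 : ℂ)) (g : ℂ → E) (z : ℂ) :
    mollify b g z = ∫ t, b.normed volume t • g (z - t) := rfl

lemma mollify_apply' (b : ContDiffBump (0 : ℂ)) (g : ℂ → E) (z : ℂ) :
    mollify b g z = ∫ t, b.normed volume (z - t) • g t := by
  rw [mollify, convolution_eq_swap]; rfl

lemma integrable_mollify (b : ContDiffBump (0 : ℂ)) {g : ℂ → E} (hg : LocallyIntegrable g)
    (z : ℂ) : Integrable (fun t => b.normed volume t • g (z - t)) :=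
  b.hasCompactSupport_normed.convolutionExists_left (ContinuousLinearMap.lsmul ℝ ℝ)
    b.continuous_normed hg z

lemma contDiff_mollify (b : ContDiffBump (0 : ℂ)) {g : ℂ → E} (hg : LocallyIntegrable g) :
    ContDiff ℝ ∞ (mollify b g) :=
  b.hasCompactSupport_normed.contDiff_convolution_left (ContinuousLinearMap.lsmul ℝ ℝ)
    b.contDiff_normed hg

lemma mollify_periodic (b : ContDiffBump (0 : ℂ)) {g : ℂ → E}
    (hG : ∀ l ∈ L.lattice, ∀ z, g (z + l) = g z) :
    ∀ l ∈ L.lattice, ∀ z, mollify b g (z + l) = mollify b g z := by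
  intro l hl z
  simp only [mollify_apply]
  congr 1
  ext t
  rw [add_sub_right_comm, hG l hl]

lemma norm_mollify_le_mollify_norm (b : ContDiffBump (0 : ℂ)) (g : ℂ → E) (z : ℂ) :
    ‖mollify b g z‖ ≤ mollify b (fun z => ‖g z‖) z := by
  rw [mollify_apply, mollify_apply]
  refine (norm_integral_le_integral_norm _).trans_eq ?_
  congr 1
  ext t
  rw [norm_smul, smul_eq_mul, Real.norm_of_nonneg (b.nonneg_normed t)]

lemma mollify_const (b : ContDiffBump (0 : ℂ)) (c : E) [CompleteSpace E] (z : ℂ) :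
    mollify b (fun _ => c) z = c := by
  rw [mollify_apply, integral_smul_const, b.integral_normed, one_smul]

lemma norm_mollify_le (b : ContDiffBump (0 : ℂ)) {g : ℂ → E} (hg : LocallyIntegrable g) {C : ℝ}
    (hC : ∀ z, ‖g z‖ ≤ C) (z : ℂ) : ‖mollify b g z‖ ≤ C := by
  refine (norm_mollify_le_mollify_norm b g z).trans ?_
  rw [← mollify_const b C z, mollify_apply, mollify_apply]
  refine integral_mono (integrable_mollify b (locallyIntegrable_norm hg) z)
    (integrable_mollify b (locallyIntegrable_const C) z) fun t => ?_
  exact mul_le_mul_of_nonneg_left (hC _) (b.nonneg_normed t)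

/-- Jensen's inequality for the bump as a probability density `ρ`, read off from `∫ ρ (|g| - a)² ≥
0` with `a` the mollification of `|g|`. -/
lemma norm_sq_mollify_le (b : ContDiffBump (0 : ℂ)) {g : ℂ → E} (hg : LocallyIntegrable g)
    (hg2 : LocallyIntegrable (fun z => ‖g z‖ ^ 2)) (z : ℂ) :
    ‖mollify b g z‖ ^ 2 ≤ mollify b (fun z => ‖g z‖ ^ 2) z := by
  set a := mollify b (fun z => ‖g z‖) z with ha
  have h1 := norm_mollify_le_mollify_norm b g z
  have h2 : ‖mollify b g z‖ ^ 2 ≤ a ^ 2 := by gcongr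
  refine h2.trans ?_
  have i1 := integrable_mollify b hg2 z
  have i2 := (integrable_mollify b (locallyIntegrable_norm hg) z).const_mul (2 * a)
  have i3 := integrable_mollify b (locallyIntegrable_const (a ^ 2)) z
  have h3 : 0 ≤ ∫ t, (b.normed volume t • ‖g (z - t)‖ ^ 2 -
      2 * a * b.normed volume t • ‖g (z - t)‖ + b.normed volume t • a ^ 2) := by
    refine integral_nonneg fun t => ?_
    have h4 := mul_nonneg (b.nonneg_normed (μ := volume) t) (sq_nonneg (‖g (z - t)‖ - a))
    simp only [smul_eq_mul, Pi.zero_apply]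
    linarith
  have i4 : Integrable (fun t => b.normed volume t • ‖g (z - t)‖ ^ 2 -
      2 * a * b.normed volume t • ‖g (z - t)‖) := i1.sub i2
  rw [integral_add i4 i3, integral_sub i1 i2, integral_const_mul] at h3
  have h5 : ∫ t, b.normed volume t • ‖g (z - t)‖ = a := by rw [ha, mollify_apply]
  have h6 : ∫ t, b.normed volume t • a ^ 2 = a ^ 2 := by
    rw [← mollify_apply b (fun _ => a ^ 2) z, mollify_const]
  rw [h5, h6] at h3
  rw [mollify_apply]
  linarith

/-- Fubini and translation invariance of the cell integral. It makes the integrals of the dominating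
functions used with Pratt's lemma constant in `n`. -/
lemma setIntegral_cell_mollify (b : ContDiffBump (0 : ℂ)) {G : ℂ → ℝ}
    (hG : ∀ l ∈ L.lattice, ∀ z, G (z + l) = G z) (hi : IntegrableOn G (cell L)) :
    ∫ z in cell L, mollify b G z = ∫ z in cell L, G z := by
  have hloc := locallyIntegrable_of_periodic hG hi
  -- A compact set containing every `z - t` with `z` in the cell and `t` in the support of the bump.
  -- Cutting `G` off outside `B` makes it integrable on the plane, as Fubini needs, without changing
  -- the integrand.
  let B : Set ℂ := (fun p : ℂ × ℂ => p.1 - p.2) ''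
    (closure (cell L) ×ˢ Metric.closedBall 0 b.rOut)
  have hBc : IsCompact B := ((cell_isBounded L).isCompact_closure.prod
    (isCompact_closedBall _ _)).image (by fun_prop)
  have hGB : Integrable (B.indicator G) :=
    (integrable_indicator_iff hBc.measurableSet).2 (hloc.integrableOn_isCompact hBc)
  have hprod := (b.integrable_normed (μ := volume)).convolution_integrand
    (ContinuousLinearMap.lsmul ℝ ℝ) hGB
  have hprod2 : Integrable (fun p : ℂ × ℂ => b.normed volume p.2 * G (p.1 - p.2))
      ((volume.restrict (cell L)).prod volume) := by
    have h1 := hprod.mono_measure (Measure.prod_mono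
      (Measure.restrict_le_self (μ := volume) (s := cell L)) le_rfl)
    refine h1.congr ?_
    have h2 : ∀ᵐ p ∂((volume.restrict (cell L)).prod (volume : Measure ℂ)), p.1 ∈ cell L :=
      Measure.quasiMeasurePreserving_fst.ae (ae_restrict_mem (measurableSet_cell L))
    filter_upwards [h2] with p hp
    by_cases ht : p.2 ∈ Metric.closedBall (0 : ℂ) b.rOut
    · simp only [ContinuousLinearMap.lsmul_apply, smul_eq_mul]
      rw [Set.indicator_of_mem]
      exact ⟨p, ⟨subset_closure hp, ht⟩, rfl⟩
    · have : b.normed volume p.2 = 0 := by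
        by_contra h
        have h3 : p.2 ∈ Function.support (b.normed volume) := h
        rw [b.support_normed_eq] at h3
        exact ht (Metric.ball_subset_closedBall h3)
      simp [this]
  simp_rw [mollify_apply, smul_eq_mul]
  rw [integral_integral_swap hprod2]
  have : ∀ t, ∫ z in cell L, b.normed volume t * G (z - t) =
      b.normed volume t * ∫ z in cell L, G z := by
    intro t
    rw [integral_const_mul]
    simp_rw [sub_eq_add_neg]
    rw [setIntegral_cell_add hG]
  simp_rw [this]
  rw [integral_mul_const, b.integral_normed, one_mul]

/-- The mollification of a weakly differentiable function. -/
lemma fderiv_mollify [CompleteSpace E] (b : ContDiffBump (0 : ℂ)) {g : ℂ → E} {D : ℂ → ℂ →L[ℝ] E}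
    (hg : LocallyIntegrable g) (hD : LocallyIntegrable D)
    (hw : ∀ f : ℂ → ℝ, ContDiff ℝ ∞ f → HasCompactSupport f → ∀ v : ℂ,
      ∫ z, (fderiv ℝ f z v) • g z = -∫ z, f z • D z v) (z : ℂ) :
    fderiv ℝ (mollify b g) z = mollify b D z := by
  have h1 := b.hasCompactSupport_normed (μ := volume) |>.hasFDerivAt_convolution_left
    (ContinuousLinearMap.lsmul ℝ ℝ) b.contDiff_normed hg z
  rw [mollify, h1.fderiv]
  ext v
  have hcd : ContDiff ℝ ∞ (b.normed volume) := b.contDiff_normed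
  have hint1 : Integrable (fun t => ((ContinuousLinearMap.lsmul ℝ ℝ).precompL ℂ
      (fderiv ℝ (b.normed volume) (z - t))) (g t)) := by
    have := (b.hasCompactSupport_normed (μ := volume)).fderiv ℝ |>.convolutionExists_left
      ((ContinuousLinearMap.lsmul ℝ ℝ).precompL ℂ) (hcd.continuous_fderiv (by simp)) hg z
    exact this.integrable_swap
  have hint2 : Integrable (fun t => b.normed volume (z - t) • D t) :=
    ((b.hasCompactSupport_normed (μ := volume)).convolutionExists_left
      (ContinuousLinearMap.lsmul ℝ ℝ) b.continuous_normed hD z).integrable_swap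
  rw [convolution_eq_swap, ContinuousLinearMap.integral_apply hint1, mollify_apply',
    ContinuousLinearMap.integral_apply hint2]
  -- The test function for the weak differential is `t ↦ ρ(z - t)`; its derivative in `t` is minus
  -- the derivative in `z`, which cancels the sign of integration by parts.
  have hf : ContDiff ℝ ∞ (fun t => b.normed volume (z - t)) :=
    hcd.comp (contDiff_const.sub contDiff_id)
  have hfc : HasCompactSupport (fun t => b.normed volume (z - t)) :=
    (b.hasCompactSupport_normed (μ := volume)).comp_homeomorph (Homeomorph.subLeft z)
  have hfd : ∀ t, fderiv ℝ (fun t => b.normed volume (z - t)) t v =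
      -(fderiv ℝ (b.normed volume) (z - t) v) := by
    intro t
    have h2 : HasFDerivAt (fun t : ℂ => z - t) (-ContinuousLinearMap.id ℝ ℂ) t := by
      simpa using (hasFDerivAt_id t).const_sub z
    have h3 := ((hcd.differentiable (by simp)) (z - t)).hasFDerivAt.comp t h2
    rw [show (fun t => b.normed volume (z - t)) = b.normed volume ∘ fun t => z - t from rfl,
      h3.fderiv]
    simp
  have := hw _ hf hfc v
  simp_rw [hfd, neg_smul] at this
  rw [integral_neg, neg_inj] at this
  simpa [ContinuousLinearMap.precompL_apply] using this

end Mollify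

end

/-! ### Polynomials of a field -/

section FieldPolynomials

open MvPolynomial

lemma hasFDerivAt_eval {E σ : Type*} [Fintype σ] [NormedAddCommGroup E] [NormedSpace ℝ E]
    {f : E → σ → ℝ} {f' : σ → E →L[ℝ] ℝ} {x : E} (hf : ∀ i, HasFDerivAt (fun y => f y i) (f' i) x)
    (P : MvPolynomial σ ℝ) :
    HasFDerivAt (fun y => eval (f y) P) (∑ i, eval (f x) (pderiv i P) • f' i) x := by
  classical
  induction P using MvPolynomial.induction_on with
  | C a => simpa using hasFDerivAt_const a x
  | add p q hp hq =>
    simp only [map_add, add_smul, Finset.sum_add_distrib]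
    exact hp.add hq
  | mul_X p n hp =>
    have h := hp.mul (hf n)
    convert! h using 1
    · ext y; simp
    · simp only [Derivation.leibniz, pderiv_X, map_add, smul_eq_mul, eval_mul, eval_X, add_smul,
        Finset.sum_add_distrib, Finset.smul_sum, smul_smul]
      congr 1
      rw [Finset.sum_eq_single n]
      · simp
      · intro j _ hj
        simp [hj.symm]
      · simp

lemma contDiff_eval {E σ : Type*} [NormedAddCommGroup E] [NormedSpace ℝ E]
    {f : E → σ → ℝ} (hf : ∀ i, ContDiff ℝ ∞ (fun y => f y i)) (P : MvPolynomial σ ℝ) :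
    ContDiff ℝ ∞ (fun y => eval (f y) P) := by
  induction P using MvPolynomial.induction_on with
  | C a => simpa using contDiff_const
  | add p q hp hq => simpa using hp.add hq
  | mul_X p n hp => simpa using hp.mul (hf n)

lemma continuous_eval_e3 (P : MvPolynomial (Fin 3) ℝ) :
    Continuous (fun p : E3 => eval p.ofLp P) :=
  (MvPolynomial.continuous_eval P).comp (PiLp.continuous_ofLp 2 _)

lemma exists_eval_bound (P : MvPolynomial (Fin 3) ℝ) :
    ∃ C, 0 ≤ C ∧ ∀ p : E3, ‖p‖ ≤ 1 → |eval p.ofLp P| ≤ C := by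
  obtain ⟨C, hC⟩ := (isCompact_closedBall (0 : E3) 1).exists_bound_of_continuousOn
    (continuous_eval_e3 P).continuousOn
  have h : ∀ p : E3, ‖p‖ ≤ 1 → |eval p.ofLp P| ≤ C := fun p hp => hC p (by simpa using hp)
  exact ⟨C, (abs_nonneg _).trans (h 0 (by simp)), h⟩

/-- The `(k, j)` minor `D₁ₖ D₂ⱼ - D₂ₖ D₁ⱼ` of a linear map from the plane to `E3`. -/
def minor (k j : Fin 3) (D : ℂ →L[ℝ] E3) : ℝ :=
  D 1 k * D Complex.I j - D Complex.I k * D 1 j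

lemma abs_apply_le (D : ℂ →L[ℝ] E3) (v : ℂ) (hv : ‖v‖ = 1) (k : Fin 3) : |D v k| ≤ ‖D‖ := by
  have h1 := PiLp.norm_apply_le (D v) k
  have h2 := D.le_opNorm v
  rw [hv, mul_one] at h2
  exact h1.trans h2

lemma abs_minor_le (k j : Fin 3) (D : ℂ →L[ℝ] E3) : |minor k j D| ≤ 2 * ‖D‖ ^ 2 := by
  have h1 := fun k => abs_apply_le D 1 (by simp) k
  have h2 := fun k => abs_apply_le D Complex.I (by simp) k
  refine (abs_sub _ _).trans ?_
  rw [abs_mul, abs_mul]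
  have h3 := mul_le_mul (h1 k) (h2 j) (abs_nonneg _) (norm_nonneg _)
  have h4 := mul_le_mul (h2 k) (h1 j) (abs_nonneg _) (norm_nonneg _)
  nlinarith

lemma continuous_minor (k j : Fin 3) : Continuous (minor k j) := by
  have h : ∀ v : ℂ, ∀ k : Fin 3, Continuous (fun D : ℂ →L[ℝ] E3 => D v k) := fun v k =>
    (PiLp.continuous_apply 2 _ k).comp (ContinuousLinearMap.apply ℝ E3 v).continuous
  exact ((h _ _).mul (h _ _)).sub ((h _ _).mul (h _ _))

variable {L : PeriodPair}

lemma fderiv_apply_e3 {F : ℂ → E3} {z : ℂ} (hF : DifferentiableAt ℝ F z) (v : ℂ) (k : Fin 3) :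
    fderiv ℝ (fun z => F z k) z v = fderiv ℝ F z v k := by
  have h := hasFDerivWithinAt_univ.2 hF.hasFDerivAt
  rw [hasFDerivWithinAt_euclidean] at h
  rw [(hasFDerivWithinAt_univ.1 (h k)).fderiv]
  rfl

/-- By the chain rule the integrand is `d(P ∘ F) ∧ dFⱼ`. The target is all of `ℝ³`, so the lemma
applies to mollified fields, which leave the sphere. -/
lemma setIntegral_cell_minor_of_contDiff {F : ℂ → E3} (hF : ContDiff ℝ ∞ F)
    (hper : ∀ l ∈ L.lattice, ∀ z, F (z + l) = F z) (P : MvPolynomial (Fin 3) ℝ) (j : Fin 3) :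
    ∫ z in cell L, ∑ k, eval (F z).ofLp (pderiv k P) * minor k j (fderiv ℝ F z) = 0 := by
  have hc : ∀ i, ContDiff ℝ ∞ (fun z => F z i) := contDiff_euclidean.1 hF
  have hd : Differentiable ℝ F := hF.differentiable (by simp)
  rw [← setIntegral_cell_wedge (L := L) (contDiff_eval (f := fun z => (F z).ofLp) hc P) (hc j)
    (fun l hl z => by rw [hper l hl]) (fun l hl z => by rw [hper l hl]) 1 Complex.I]
  congr 1
  ext z
  have h1 := hasFDerivAt_eval (f := fun z => (F z).ofLp) (x := z)
    (fun i => ((hc i).differentiable (by simp) z).hasFDerivAt) P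
  rw [h1.fderiv]
  simp only [sum_apply, smul_apply, smul_eq_mul,
    fderiv_apply_e3 (hd z), minor]
  rw [Finset.sum_mul, Finset.sum_mul, ← Finset.sum_sub_distrib]
  refine Finset.sum_congr rfl fun k _ => ?_
  ring

/-- A sequence of bump functions shrinking to the origin. -/
def bump (n : ℕ) : ContDiffBump (0 : ℂ) where
  rIn := 1 / (2 * (n + 1))
  rOut := 1 / (n + 1)
  rIn_pos := by positivity
  rIn_lt_rOut := by
    apply one_div_lt_one_div_of_lt
    · positivity
    · have : (0 : ℝ) ≤ n := Nat.cast_nonneg n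
      linarith

lemma ae_tendsto_mollify {E : Type*} [NormedAddCommGroup E] [NormedSpace ℝ E] [CompleteSpace E]
    {g : ℂ → E} (hg : LocallyIntegrable g) :
    ∀ᵐ z, Tendsto (fun n => mollify (bump n) g z) atTop (𝓝 (g z)) := by
  refine ContDiffBump.ae_convolution_tendsto_right_of_locallyIntegrable (φ := bump) (K := 2)
    ?_ ?_ hg
  · exact tendsto_one_div_add_atTop_nhds_zero_nat
  · refine Eventually.of_forall fun n => ?_
    simp only [bump]
    apply le_of_eq
    field_simp

/-! ### Exact forms pulled back by an `H¹` field -/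

namespace SkyrmeField

variable (Φ : SkyrmeField L)

lemma locallyIntegrable_toFun : LocallyIntegrable (fun z => (Φ.toFun z : E3)) :=
  (locallyIntegrable_const (1 : ℝ)).mono Φ.measurable (Eventually.of_forall fun z => by simp)

lemma integrableOn_diff : IntegrableOn Φ.diff (cell L) :=
  Φ.diff_memLp.integrable (by norm_num)

lemma integrableOn_norm_sq_diff : IntegrableOn (fun z => ‖Φ.diff z‖ ^ 2) (cell L) :=
  Φ.diff_memLp.integrable_norm_pow (by norm_num)

lemma locallyIntegrable_diff : LocallyIntegrable Φ.diff :=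
  locallyIntegrable_of_periodic Φ.diff_periodic Φ.integrableOn_diff

lemma aestronglyMeasurable_eval_minor (P : MvPolynomial (Fin 3) ℝ) (k j : Fin 3) :
    AEStronglyMeasurable (fun z => eval (Φ.toFun z).1.ofLp P * minor k j (Φ.diff z))
      (volume.restrict (cell L)) :=
  ((continuous_eval_e3 P).comp_aestronglyMeasurable Φ.measurable.restrict).mul
    ((continuous_minor k j).comp_aestronglyMeasurable Φ.integrableOn_diff.aestronglyMeasurable)

lemma integrableOn_eval_minor (P : MvPolynomial (Fin 3) ℝ) (k j : Fin 3) :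
    IntegrableOn (fun z => eval (Φ.toFun z).1.ofLp P * minor k j (Φ.diff z)) (cell L) := by
  obtain ⟨C, hC0, hC⟩ := exists_eval_bound P
  refine (Φ.integrableOn_norm_sq_diff.const_mul (C * 2)).mono'
    (Φ.aestronglyMeasurable_eval_minor P k j) (Eventually.of_forall fun z => ?_)
  rw [Real.norm_eq_abs, abs_mul, mul_assoc]
  exact mul_le_mul (hC _ (by simp)) (abs_minor_le _ _ _) (abs_nonneg _) hC0

/-- The integral of the pull back of the closed form `d(P dpⱼ) = ∑ₖ ∂ₖP dpₖ ∧ dpⱼ` vanishes. -/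
lemma setIntegral_cell_minor (P : MvPolynomial (Fin 3) ℝ) (j : Fin 3) :
    ∫ z in cell L, ∑ k, eval (Φ.toFun z).1.ofLp (pderiv k P) * minor k j (Φ.diff z) = 0 := by
  have hloc := Φ.locallyIntegrable_toFun
  have hlocD := Φ.locallyIntegrable_diff
  have hper2 : ∀ l ∈ L.lattice, ∀ z, ‖Φ.diff (z + l)‖ ^ 2 = ‖Φ.diff z‖ ^ 2 := fun l hl z => by
    rw [Φ.diff_periodic l hl]
  have hloc2 : LocallyIntegrable (fun z => ‖Φ.diff z‖ ^ 2) :=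
    locallyIntegrable_of_periodic hper2 Φ.integrableOn_norm_sq_diff
  let F : ℕ → ℂ → E3 := fun n => mollify (bump n) (fun z => (Φ.toFun z : E3))
  have hFs : ∀ n, ContDiff ℝ ∞ (F n) := fun n => contDiff_mollify _ hloc
  have hFd : ∀ n z, fderiv ℝ (F n) z = mollify (bump n) Φ.diff z := fun n z =>
    fderiv_mollify _ hloc hlocD Φ.weak_diff z
  have hFper : ∀ n, ∀ l ∈ L.lattice, ∀ z, F n (z + l) = F n z := fun n =>
    mollify_periodic _ (fun l hl z => by rw [Φ.periodic l hl])
  have hF1 : ∀ n z, ‖F n z‖ ≤ 1 := fun n z => norm_mollify_le _ hloc (fun z => by simp) z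
  choose C hC0 hC using fun k => exists_eval_bound (pderiv k P)
  -- As `|dφ|²` is only integrable, the dominating function must vary with `n`: it is a multiple of
  -- the mollified `|dφ|²`. The polynomial factor is bounded because averages of points of the
  -- sphere stay in the unit ball.
  let g : ℕ → ℂ → ℝ := fun n z =>
    (∑ k, C k * 2) * mollify (bump n) (fun z => ‖Φ.diff z‖ ^ 2) z
  have key := tendsto_integral_of_le_of_tendsto_integral (μ := volume.restrict (cell L))
    (h := fun n z => ∑ k, eval (F n z).ofLp (pderiv k P) * minor k j (fderiv ℝ (F n) z))
    (h₀ := fun z => ∑ k, eval (Φ.toFun z).1.ofLp (pderiv k P) * minor k j (Φ.diff z))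
    (g := g) (g₀ := fun z => (∑ k, C k * 2) * ‖Φ.diff z‖ ^ 2) ?_ ?_ ?_ ?_ ?_ ?_ ?_
  · refine tendsto_nhds_unique key ?_
    simp_rw [fun n => setIntegral_cell_minor_of_contDiff (hFs n) (hFper n) P j]
    exact tendsto_const_nhds
  · intro n
    refine Continuous.aestronglyMeasurable (continuous_finsetSum _ fun k _ => ?_)
    exact ((continuous_eval_e3 _).comp (hFs n).continuous).mul
      ((continuous_minor k j).comp ((hFs n).continuous_fderiv (by simp)))
  · intro n
    exact (integrableOn_cell_of_continuous (contDiff_mollify _ hloc2).continuous).const_mul _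
  · exact Φ.integrableOn_norm_sq_diff.const_mul _
  · intro n
    refine Eventually.of_forall fun z => ?_
    refine (Finset.abs_sum_le_sum_abs _ _).trans ?_
    simp only [g]
    rw [Finset.sum_mul]
    refine Finset.sum_le_sum fun k _ => ?_
    rw [abs_mul, mul_assoc]
    refine mul_le_mul (hC k _ (hF1 n z)) ?_ (abs_nonneg _) (hC0 k)
    refine (abs_minor_le _ _ _).trans ?_
    rw [hFd]
    exact mul_le_mul_of_nonneg_left (norm_sq_mollify_le _ hlocD hloc2 z) (by norm_num)
  · refine ae_restrict_of_ae ?_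
    filter_upwards [ae_tendsto_mollify hloc, ae_tendsto_mollify hlocD] with z h1 h2
    refine tendsto_finsetSum _ fun k _ => ?_
    refine Tendsto.mul (((continuous_eval_e3 _).tendsto _).comp h1) ?_
    simp_rw [hFd]
    exact ((continuous_minor k j).tendsto _).comp h2
  · refine ae_restrict_of_ae ?_
    filter_upwards [ae_tendsto_mollify hloc2] with z h1
    exact h1.const_mul _
  · simp only [g]
    simp_rw [integral_const_mul,
      fun n => setIntegral_cell_mollify (bump n) hper2 Φ.integrableOn_norm_sq_diff]
    exact tendsto_const_nhds

end SkyrmeField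

end FieldPolynomials

/-! ### Rotation invariant functionals on polynomials -/

section RotationInvariant

open MvPolynomial

/-- The polynomial `|p|²`. -/
def normSqPoly : MvPolynomial (Fin 3) ℝ := X 0 ^ 2 + X 1 ^ 2 + X 2 ^ 2

/-- A linear functional on polynomial functions on the unit sphere that is annihilated by the
infinitesimal rotations. -/
structure IsRotationInvariant (ℓ : MvPolynomial (Fin 3) ℝ →ₗ[ℝ] ℝ) : Prop where
  normSq_mul : ∀ P, ℓ (normSqPoly * P) = ℓ P
  rotation : ∀ a b P, ℓ (X a * pderiv b P - X b * pderiv a P) = 0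

namespace IsRotationInvariant

variable {ℓ : MvPolynomial (Fin 3) ℝ →ₗ[ℝ] ℝ}

lemma sub_smul {ℓ' : MvPolynomial (Fin 3) ℝ →ₗ[ℝ] ℝ} (h : IsRotationInvariant ℓ)
    (h' : IsRotationInvariant ℓ') (c : ℝ) : IsRotationInvariant (ℓ - c • ℓ') where
  normSq_mul P := by simp [h.normSq_mul, h'.normSq_mul]
  rotation a b P := by
    have h1 := h.rotation a b P
    have h2 := h'.rotation a b P
    rw [LinearMap.sub_apply, LinearMap.smul_apply, h1, h2]
    simp

lemma map_natCast_mul (n : ℕ) (P : MvPolynomial (Fin 3) ℝ) :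
    ℓ ((n : MvPolynomial (Fin 3) ℝ) * P) = n * ℓ P := by
  rw [← nsmul_eq_mul, map_nsmul, nsmul_eq_mul]

/-- The monomial with the given exponents. -/
def mono (i j k : ℕ) : MvPolynomial (Fin 3) ℝ := X 0 ^ i * X 1 ^ j * X 2 ^ k

lemma pderiv_zero_mono (i j k : ℕ) :
    pderiv 0 (mono i j k) = (i : MvPolynomial (Fin 3) ℝ) * mono (i - 1) j k := by
  simp [mono, Derivation.leibniz, Derivation.leibniz_pow, pderiv_X]
  ring

lemma pderiv_one_mono (i j k : ℕ) :
    pderiv 1 (mono i j k) = (j : MvPolynomial (Fin 3) ℝ) * mono i (j - 1) k := by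
  simp [mono, Derivation.leibniz, Derivation.leibniz_pow, pderiv_X]
  ring

lemma pderiv_two_mono (i j k : ℕ) :
    pderiv 2 (mono i j k) = (k : MvPolynomial (Fin 3) ℝ) * mono i j (k - 1) := by
  simp [mono, Derivation.leibniz, Derivation.leibniz_pow, pderiv_X]
  ring

/-- Invariance tested on `p₀^(i+1) p₁^(j+1) p₂^k`; it trades two powers of one coordinate for two of
another. -/
lemma mono_rel_zero_one (h : IsRotationInvariant ℓ) (i j k : ℕ) :
    (j + 1) * ℓ (mono (i + 2) j k) = (i + 1) * ℓ (mono i (j + 2) k) := by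
  have h1 := h.rotation 0 1 (mono (i + 1) (j + 1) k)
  rw [pderiv_zero_mono, pderiv_one_mono,
    show X 0 * (((j + 1 : ℕ) : MvPolynomial (Fin 3) ℝ) * mono (i + 1) (j + 1 - 1) k) -
      X 1 * (((i + 1 : ℕ) : MvPolynomial (Fin 3) ℝ) * mono (i + 1 - 1) (j + 1) k) =
      ((j + 1 : ℕ) : MvPolynomial (Fin 3) ℝ) * mono (i + 2) j k -
      ((i + 1 : ℕ) : MvPolynomial (Fin 3) ℝ) * mono i (j + 2) k by
    simp only [mono, Nat.add_sub_cancel]; ring, map_sub, map_natCast_mul, map_natCast_mul] at h1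
  push_cast at h1
  linarith

lemma mono_rel_zero_two (h : IsRotationInvariant ℓ) (i j k : ℕ) :
    (k + 1) * ℓ (mono (i + 2) j k) = (i + 1) * ℓ (mono i j (k + 2)) := by
  have h1 := h.rotation 0 2 (mono (i + 1) j (k + 1))
  rw [pderiv_zero_mono, pderiv_two_mono,
    show X 0 * (((k + 1 : ℕ) : MvPolynomial (Fin 3) ℝ) * mono (i + 1) j (k + 1 - 1)) -
      X 2 * (((i + 1 : ℕ) : MvPolynomial (Fin 3) ℝ) * mono (i + 1 - 1) j (k + 1)) =
      ((k + 1 : ℕ) : MvPolynomial (Fin 3) ℝ) * mono (i + 2) j k -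
      ((i + 1 : ℕ) : MvPolynomial (Fin 3) ℝ) * mono i j (k + 2) by
    simp only [mono, Nat.add_sub_cancel]; ring, map_sub, map_natCast_mul, map_natCast_mul] at h1
  push_cast at h1
  linarith

/-- Multiplication by `|p|² = 1`, with all three resulting terms reduced to the first by the trading
relations, lowers the degree by two. -/
lemma mono_rec (h : IsRotationInvariant ℓ) (i j k : ℕ) :
    ((i + j + k + 3 : ℕ) : ℝ) * ℓ (mono (i + 2) j k) = (i + 1) * ℓ (mono i j k) := by
  have h1 := h.normSq_mul (mono i j k)
  rw [show normSqPoly * mono i j k = mono (i + 2) j k + mono i (j + 2) k + mono i j (k + 2) by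
    simp only [mono, normSqPoly]; ring, map_add, map_add] at h1
  rw [← h1]
  push_cast
  linear_combination h.mono_rel_zero_one i j k + h.mono_rel_zero_two i j k

/-- A monomial with a simple factor `p₀` is, up to the factor `j + 1`, the infinitesimal rotation of
a monomial without `p₀`. -/
lemma mono_one_left (h : IsRotationInvariant ℓ) (j k : ℕ) : ℓ (mono 1 j k) = 0 := by
  have h1 := h.rotation 0 1 (mono 0 (j + 1) k)
  rw [pderiv_zero_mono, pderiv_one_mono,
    show X 0 * (((j + 1 : ℕ) : MvPolynomial (Fin 3) ℝ) * mono 0 (j + 1 - 1) k) -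
      X 1 * (((0 : ℕ) : MvPolynomial (Fin 3) ℝ) * mono (0 - 1) (j + 1) k) =
      ((j + 1 : ℕ) : MvPolynomial (Fin 3) ℝ) * mono 1 j k by
    simp only [mono, Nat.add_sub_cancel]; push_cast; ring, map_natCast_mul] at h1
  exact (mul_eq_zero.1 h1).resolve_left (by positivity)

lemma mono_one_middle (h : IsRotationInvariant ℓ) (i k : ℕ) : ℓ (mono i 1 k) = 0 := by
  have h1 := h.rotation 1 0 (mono (i + 1) 0 k)
  rw [pderiv_zero_mono, pderiv_one_mono,
    show X 1 * (((i + 1 : ℕ) : MvPolynomial (Fin 3) ℝ) * mono (i + 1 - 1) 0 k) -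
      X 0 * (((0 : ℕ) : MvPolynomial (Fin 3) ℝ) * mono (i + 1) (0 - 1) k) =
      ((i + 1 : ℕ) : MvPolynomial (Fin 3) ℝ) * mono i 1 k by
    simp only [mono, Nat.add_sub_cancel]; push_cast; ring, map_natCast_mul] at h1
  exact (mul_eq_zero.1 h1).resolve_left (by positivity)

lemma mono_one_right (h : IsRotationInvariant ℓ) (i j : ℕ) : ℓ (mono i j 1) = 0 := by
  have h1 := h.rotation 2 0 (mono (i + 1) j 0)
  rw [pderiv_zero_mono, pderiv_two_mono,
    show X 2 * (((i + 1 : ℕ) : MvPolynomial (Fin 3) ℝ) * mono (i + 1 - 1) j 0) -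
      X 0 * (((0 : ℕ) : MvPolynomial (Fin 3) ℝ) * mono (i + 1) j (0 - 1)) =
      ((i + 1 : ℕ) : MvPolynomial (Fin 3) ℝ) * mono i j 1 by
    simp only [mono, Nat.add_sub_cancel]; push_cast; ring, map_natCast_mul] at h1
  exact (mul_eq_zero.1 h1).resolve_left (by positivity)

/-- Strong induction on the degree: an exponent of at least two is lowered by `mono_rec`, after
moving it to the first coordinate if needed. Otherwise either some exponent is one and the monomial
is annihilated, or the monomial is `1`. -/
lemma mono_eq_zero (h : IsRotationInvariant ℓ) (h1 : ℓ 1 = 0) :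
    ∀ n i j k : ℕ, i + j + k = n → ℓ (mono i j k) = 0 := by
  intro n
  induction n using Nat.strong_induction_on with
  | _ n ih =>
    intro i j k hn
    have step : ∀ i j k, i + j + k < n → ℓ (mono (i + 2) j k) = 0 := by
      intro i j k hlt
      have h2 := h.mono_rec i j k
      rw [ih _ hlt i j k rfl, mul_zero] at h2
      exact (mul_eq_zero.1 h2).resolve_left (by positivity)
    match i, j, k with
    | i + 2, j, k => exact step i j k (by omega)
    | 1, j, k => exact h.mono_one_left j k
    | 0, j + 2, k =>
      have h2 := h.mono_rel_zero_one 0 j k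
      rw [step 0 j k (by omega)] at h2
      simpa using h2.symm
    | 0, 1, k => exact h.mono_one_middle 0 k
    | 0, 0, k + 2 =>
      have h2 := h.mono_rel_zero_two 0 0 k
      rw [step 0 0 k (by omega)] at h2
      simpa using h2.symm
    | 0, 0, 1 => exact h.mono_one_right 0 0
    | 0, 0, 0 => simpa [mono] using h1

/-- A rotation invariant functional is determined by its value at `1`. -/
lemma eq_zero (h : IsRotationInvariant ℓ) (h1 : ℓ 1 = 0) : ℓ = 0 := by
  refine LinearMap.ext fun P => ?_
  rw [LinearMap.zero_apply]
  induction P using MvPolynomial.induction_on' with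
  | monomial s a =>
    have h2 := h.mono_eq_zero h1 _ (s 0) (s 1) (s 2) rfl
    rw [monomial_eq, Finsupp.prod_fintype _ _ (by simp), Fin.prod_univ_three, ← smul_eq_C_mul,
      map_smul]
    rw [mono] at h2
    rw [h2, smul_zero]
  | add p q hp hq => rw [map_add, hp, hq, add_zero]

lemma eq_smul {σ : MvPolynomial (Fin 3) ℝ →ₗ[ℝ] ℝ} (h : IsRotationInvariant ℓ)
    (hσ : IsRotationInvariant σ) (h1 : σ 1 = 1) : ℓ = ℓ 1 • σ :=
  sub_eq_zero.1 ((h.sub_smul hσ (ℓ 1)).eq_zero (by simp [h1]))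

/-- The argument is the `p₃`-derivative of `(1 - p₃²) g(p₃)`, so this is Archimedes' theorem in
infinitesimal form: functions of the height integrate as on `[-1, 1]`. It is the sum of the
rotations of `p₁ g` and `p₂ g` towards the `p₃` axis, modulo `|p|² = 1`. -/
lemma height_rel (h : IsRotationInvariant ℓ) {g g' : MvPolynomial (Fin 3) ℝ}
    (h0 : pderiv 0 g = 0) (h1 : pderiv 1 g = 0) (h2 : pderiv 2 g = g') :
    ℓ ((1 - X 2 ^ 2) * g' - 2 * X 2 * g) = 0 := by
  have e0 := h.rotation 0 2 (X 0 * g)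
  have e1 := h.rotation 1 2 (X 1 * g)
  have e2 := h.normSq_mul g'
  have p0 : X 0 * pderiv 2 (X 0 * g) - X 2 * pderiv 0 (X 0 * g) = X 0 ^ 2 * g' - X 2 * g := by
    simp [Derivation.leibniz, pderiv_X, h0, h2]; ring
  have p1 : X 1 * pderiv 2 (X 1 * g) - X 2 * pderiv 1 (X 1 * g) = X 1 ^ 2 * g' - X 2 * g := by
    simp [Derivation.leibniz, pderiv_X, h1, h2]; ring
  rw [p0] at e0
  rw [p1] at e1
  have : (1 - X 2 ^ 2) * g' - 2 * X 2 * g = (X 0 ^ 2 * g' - X 2 * g) + (X 1 ^ 2 * g' - X 2 * g)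
      - (normSqPoly * g' - g') := by
    simp only [normSqPoly]; ring
  rw [this, map_sub, map_add, e0, e1, map_sub, e2]
  simp

/-- The moments of the height function: `∫ (1 + p₃)^N = 2^N / (N + 1)`. -/
lemma height_pow (h : IsRotationInvariant ℓ) (N : ℕ) :
    (N + 1) * ℓ ((1 + X 2) ^ N) = 2 ^ N * ℓ 1 := by
  induction N with
  | zero => simp
  | succ N ih =>
    rcases N with _ | N
    -- The passage from `0` to `1` is separate, since the derivative of `(1 + p₃)^0` does not have
    -- the form used in the general step.
    · have := h.height_rel (g := 1) (g' := 0) (by simp) (by simp) (by simp)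
      rw [show (1 - X 2 ^ 2) * (0 : MvPolynomial (Fin 3) ℝ) - 2 * X 2 * 1 =
        ((2 : ℕ) : MvPolynomial (Fin 3) ℝ) * (1 - (1 + X 2)) by push_cast; ring,
        map_natCast_mul, map_sub] at this
      norm_num at this ⊢
      linarith
    -- Writing `1 - p₃² = (1 + p₃)(2 - (1 + p₃))` yields `(N+3) M_{N+2} = 2(N+2) M_{N+1}` for the
    -- moments `M_N` of `1 + p₃`.
    · have := h.height_rel (g := (1 + X 2) ^ (N + 1))
        (g' := ((N + 1 : ℕ) : MvPolynomial (Fin 3) ℝ) * (1 + X 2) ^ N)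
        (by simp [Derivation.leibniz_pow, pderiv_X])
        (by simp [Derivation.leibniz_pow, pderiv_X])
        (by simp [Derivation.leibniz_pow, pderiv_X])
      rw [show (1 - X 2 ^ 2) * (((N + 1 : ℕ) : MvPolynomial (Fin 3) ℝ) * (1 + X 2) ^ N) -
          2 * X 2 * (1 + X 2) ^ (N + 1) =
          ((2 * (N + 2) : ℕ) : MvPolynomial (Fin 3) ℝ) * (1 + X 2) ^ (N + 1) -
          ((N + 3 : ℕ) : MvPolynomial (Fin 3) ℝ) * (1 + X 2) ^ (N + 2) by push_cast; ring,
        map_sub, map_natCast_mul, map_natCast_mul] at this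
      push_cast at this ih ⊢
      rw [pow_succ (2 : ℝ) (N + 1)]
      linear_combination 2 * ih - this

end IsRotationInvariant

/-- If the functionals `Aⱼ` satisfy `A × ∇ = 0` and live on the unit sphere, then
`P ↦ ∑ⱼ Aⱼ(pⱼ P)` is rotation invariant. -/
lemma isRotationInvariant_of_curl {A : Fin 3 → MvPolynomial (Fin 3) ℝ →ₗ[ℝ] ℝ}
    (h1 : ∀ j k P, A j (pderiv k P) = A k (pderiv j P))
    (h2 : ∀ j P, A j (normSqPoly * P) = A j P)
    {ℓ : MvPolynomial (Fin 3) ℝ →ₗ[ℝ] ℝ}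
    (hℓ : ∀ P, ℓ P = A 0 (X 0 * P) + A 1 (X 1 * P) + A 2 (X 2 * P)) : IsRotationInvariant ℓ := by
  have hp : ∀ (k : Fin 3) (P : MvPolynomial (Fin 3) ℝ), pderiv k (normSqPoly * P) =
      normSqPoly * pderiv k P + (X k * P + X k * P) := by
    intro k P
    fin_cases k <;>
    · simp [normSqPoly, Derivation.leibniz, Derivation.leibniz_pow, pderiv_X]
      ring
  -- The curl relation for `|p|² P` differs from that for `P` by the terms `2 pₖ P`. Their symmetry
  -- says that the vector `A` is normal to the sphere, so `ℓ` determines `A` in the next step.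
  have h3 : ∀ j k P, A j (X k * P) = A k (X j * P) := by
    intro j k P
    have := h1 j k (normSqPoly * P)
    simp only [hp, map_add, h2, h1 j k P] at this
    linarith
  have h4 : ∀ a P, ℓ (X a * P) = A a P := by
    intro a P
    rw [hℓ, h3 0 a |> fun h => show A 0 (X 0 * (X a * P)) = A a (X 0 * (X 0 * P)) by
        rw [← h, mul_left_comm],
      h3 1 a |> fun h => show A 1 (X 1 * (X a * P)) = A a (X 1 * (X 1 * P)) by
        rw [← h, mul_left_comm],
      h3 2 a |> fun h => show A 2 (X 2 * (X a * P)) = A a (X 2 * (X 2 * P)) by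
        rw [← h, mul_left_comm], ← map_add, ← map_add, ← h2 a P]
    congr 1
    simp only [normSqPoly]; ring
  constructor
  · intro P
    rw [hℓ, hℓ, mul_left_comm, h2, mul_left_comm, h2, mul_left_comm, h2]
  · intro a b P
    rw [map_sub, h4, h4, h1 a b, sub_self]

end RotationInvariant

/-! ### The pulled back area form as a functional on polynomials -/

namespace SkyrmeField

open MvPolynomial

variable {L : PeriodPair} (Φ : SkyrmeField L)

/-- The functional `P ↦ ∫ P(φ) Dₖⱼ`, where `Dₖⱼ` is a minor of `dφ`. -/
def minorFunctional (k j : Fin 3) : MvPolynomial (Fin 3) ℝ →ₗ[ℝ] ℝ where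
  toFun P := ∫ z in cell L, eval (Φ.toFun z).1.ofLp P * minor k j (Φ.diff z)
  map_add' P Q := by
    rw [← integral_add (Φ.integrableOn_eval_minor P k j) (Φ.integrableOn_eval_minor Q k j)]
    simp only [map_add, add_mul]
  map_smul' c P := by
    rw [RingHom.id_apply, smul_eq_mul, ← integral_const_mul]
    simp only [smul_eval, mul_assoc]

lemma pullbackKahler_eq (z : ℂ) :
    Φ.pullbackKahler z = -((Φ.toFun z).1 0 * minor 1 2 (Φ.diff z) +
      (Φ.toFun z).1 1 * minor 2 0 (Φ.diff z) + (Φ.toFun z).1 2 * minor 0 1 (Φ.diff z)) := by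
  rw [pullbackKahler, kahler_apply]
  simp only [frame, minor, Matrix.cons_val_zero, Matrix.cons_val_one]
  ring

lemma integrableOn_eval_pullbackKahler (P : MvPolynomial (Fin 3) ℝ) :
    IntegrableOn (fun z => eval (Φ.toFun z).1.ofLp P * Φ.pullbackKahler z) (cell L) := by
  have := (((Φ.integrableOn_eval_minor (P * X 0) 1 2).add
    (Φ.integrableOn_eval_minor (P * X 1) 2 0)).add (Φ.integrableOn_eval_minor (P * X 2) 0 1)).neg
  refine this.congr (Eventually.of_forall fun z => ?_)
  simp [pullbackKahler_eq]
  ring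

lemma integrableOn_pullbackKahler : IntegrableOn Φ.pullbackKahler (cell L) := by
  simpa using Φ.integrableOn_eval_pullbackKahler 1

/-- The functional `P ↦ ∫ P(φ) φ^*ω`. -/
def kahlerFunctional : MvPolynomial (Fin 3) ℝ →ₗ[ℝ] ℝ where
  toFun P := ∫ z in cell L, eval (Φ.toFun z).1.ofLp P * Φ.pullbackKahler z
  map_add' P Q := by
    rw [← integral_add (Φ.integrableOn_eval_pullbackKahler P)
      (Φ.integrableOn_eval_pullbackKahler Q)]
    simp only [map_add, add_mul]
  map_smul' c P := by
    rw [RingHom.id_apply, smul_eq_mul, ← integral_const_mul]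
    simp only [smul_eval, mul_assoc]

lemma minorFunctional_swap (k j : Fin 3) (P : MvPolynomial (Fin 3) ℝ) :
    Φ.minorFunctional k j P = -Φ.minorFunctional j k P := by
  simp only [minorFunctional, LinearMap.coe_mk, AddHom.coe_mk]
  rw [← integral_neg]
  congr 1
  ext z
  simp only [minor]
  ring

lemma sum_minorFunctional (P : MvPolynomial (Fin 3) ℝ) (j : Fin 3) :
    ∑ k, Φ.minorFunctional k j (pderiv k P) = 0 := by
  rw [← Φ.setIntegral_cell_minor P j, integral_finsetSum]
  · rfl
  · exact fun k _ => Φ.integrableOn_eval_minor _ k j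

lemma minorFunctional_self (j : Fin 3) (P : MvPolynomial (Fin 3) ℝ) :
    Φ.minorFunctional j j P = 0 := by
  have := Φ.minorFunctional_swap j j P
  linarith

/-- The `Aⱼ` are the components of `-∂₁φ × ∂₂φ`, integrated against `P(φ)`. Since the minors are
antisymmetric, the vanishing of `∫ φ^*d(P dpⱼ)` for the three `j` is exactly the curl condition. -/
lemma isRotationInvariant_kahlerFunctional : IsRotationInvariant Φ.kahlerFunctional := by
  refine isRotationInvariant_of_curl
    (A := ![-Φ.minorFunctional 1 2, -Φ.minorFunctional 2 0, -Φ.minorFunctional 0 1]) ?_ ?_ ?_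
  · intro j k P
    have h0 := Φ.sum_minorFunctional P 0
    have h1 := Φ.sum_minorFunctional P 1
    have h2 := Φ.sum_minorFunctional P 2
    rw [Fin.sum_univ_three, minorFunctional_self] at h0 h1 h2
    have s0 := fun P => Φ.minorFunctional_swap 1 0 P
    have s1 := fun P => Φ.minorFunctional_swap 2 1 P
    have s2 := fun P => Φ.minorFunctional_swap 0 2 P
    simp only [s0, s1, s2] at h0 h1 h2
    fin_cases j <;> fin_cases k <;> simp <;> linarith
  · intro j P
    have key : ∀ k j, Φ.minorFunctional k j (normSqPoly * P) = Φ.minorFunctional k j P := by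
      intro k j
      simp only [minorFunctional, LinearMap.coe_mk, AddHom.coe_mk]
      congr 1
      ext z
      have := sum_sq_sphere (Φ.toFun z)
      simp only [normSqPoly, map_mul, map_add, map_pow, eval_X, this, one_mul]
    fin_cases j <;> simp [key]
  · intro P
    have h0 := Φ.integrableOn_eval_minor (X 0 * P) 1 2
    have h1 := Φ.integrableOn_eval_minor (X 1 * P) 2 0
    have h2 := Φ.integrableOn_eval_minor (X 2 * P) 0 1
    simp only [kahlerFunctional, minorFunctional, LinearMap.coe_mk, AddHom.coe_mk,
      Matrix.cons_val_zero, Matrix.cons_val_one, Matrix.cons_val, LinearMap.neg_apply]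
    have e1 := integral_add h0 h1
    have e2 := integral_add (h0.add h1) h2
    simp only [Pi.add_apply] at e2
    rw [← neg_add, ← neg_add, ← e1, ← e2, ← integral_neg]
    congr 1
    ext z
    simp [pullbackKahler_eq]
    ring

lemma kahlerFunctional_one : Φ.kahlerFunctional 1 = 4 * Real.pi * Φ.degree := by
  have := Real.pi_ne_zero
  simp only [kahlerFunctional, LinearMap.coe_mk, AddHom.coe_mk, degree, map_one, one_mul]
  field_simp

end SkyrmeField

/-! ### The average over the sphere -/

section SphereAverage

open MvPolynomial
open scoped Pointwise

/-- Surface area on the unit sphere. -/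
abbrev surface : Measure S2 := (volume : Measure E3).toSphere

lemma surface_univ_ne_zero : surface.real Set.univ ≠ 0 := by
  have : surface Set.univ ≠ 0 := by
    rw [Ne, Measure.measure_univ_eq_zero]
    exact Measure.toSphere_ne_zero _
  rw [Measure.real]
  exact ENNReal.toReal_ne_zero.2 ⟨this, measure_ne_top _ _⟩

lemma integrable_surface {f : S2 → ℝ} (hf : Continuous f) : Integrable f surface :=
  hf.integrable_of_hasCompactSupport (HasCompactSupport.of_compactSpace f)

/-- The action of a linear isometry on the sphere. -/
def sphereMap (R : E3 ≃ₗᵢ[ℝ] E3) (p : S2) : S2 := ⟨R p, by simp⟩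

lemma continuous_sphereMap (R : E3 ≃ₗᵢ[ℝ] E3) : Continuous (sphereMap R) :=
  (R.continuous.comp continuous_subtype_val).subtype_mk _

/-- Surface area is, up to a constant, the volume of the cone over a set; a linear isometry maps
cones to cones and preserves volume. -/
lemma measurePreserving_sphereMap (R : E3 ≃ₗᵢ[ℝ] E3) :
    MeasurePreserving (sphereMap R) surface surface := by
  refine ⟨(continuous_sphereMap R).measurable, Measure.ext fun s hs => ?_⟩
  have hs' : MeasurableSet (sphereMap R ⁻¹' s) := (continuous_sphereMap R).measurable hs
  rw [Measure.map_apply (continuous_sphereMap R).measurable hs, Measure.toSphere_apply' _ hs,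
    Measure.toSphere_apply' _ hs']
  congr 1
  have : Set.Ioo (0 : ℝ) 1 • (Subtype.val '' (sphereMap R ⁻¹' s)) =
      R ⁻¹' (Set.Ioo (0 : ℝ) 1 • (Subtype.val '' s)) := by
    ext x
    simp only [Set.mem_smul, Set.mem_image, Set.mem_preimage]
    constructor
    · rintro ⟨r, hr, _, ⟨p, hp, rfl⟩, rfl⟩
      exact ⟨r, hr, R p, ⟨sphereMap R p, hp, rfl⟩, by simp⟩
    · rintro ⟨r, hr, _, ⟨p, hp, rfl⟩, h⟩
      refine ⟨r, hr, R.symm p, ⟨sphereMap R.symm p, ?_, rfl⟩, ?_⟩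
      · have : sphereMap R (sphereMap R.symm p) = p := by
          ext1; simp [sphereMap]
        rwa [this]
      · apply R.injective
        rw [map_smul, R.apply_symm_apply, h]
  rw [this]
  exact R.measurePreserving.measure_preimage_emb R.toMeasurableEquiv.measurableEmbedding _

/-- The rotation by the angle `t` in the `(a, b)` coordinate plane. -/
def rotFun (a b : Fin 3) (t : ℝ) (x : E3) : E3 :=
  WithLp.toLp 2 fun i => if i = a then Real.cos t * x a - Real.sin t * x b
    else if i = b then Real.sin t * x a + Real.cos t * x b else x i

/-- `rotFun` as a linear isometry. -/
def rotIsometry {a b : Fin 3} (hab : a ≠ b) (t : ℝ) : E3 →ₗᵢ[ℝ] E3 where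
  toFun := rotFun a b t
  map_add' x y := by
    ext i
    simp only [rotFun, PiLp.add_apply]
    split_ifs <;> ring
  map_smul' c x := by
    ext i
    simp only [rotFun, PiLp.smul_apply, smul_eq_mul, RingHom.id_apply]
    split_ifs <;> ring
  norm_map' x := by
    rw [← sq_eq_sq₀ (norm_nonneg _) (norm_nonneg _), norm_sq_e3, norm_sq_e3]
    have h := Real.sin_sq_add_cos_sq t
    fin_cases a <;> fin_cases b <;> simp [rotFun] at hab ⊢ <;>
    [linear_combination (x 0 ^ 2 + x 1 ^ 2) * h; linear_combination (x 0 ^ 2 + x 2 ^ 2) * h;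
      linear_combination (x 0 ^ 2 + x 1 ^ 2) * h; linear_combination (x 1 ^ 2 + x 2 ^ 2) * h;
      linear_combination (x 0 ^ 2 + x 2 ^ 2) * h; linear_combination (x 1 ^ 2 + x 2 ^ 2) * h]

/-- `rotFun` as a linear isometric equivalence. -/
def rot {a b : Fin 3} (hab : a ≠ b) (t : ℝ) : E3 ≃ₗᵢ[ℝ] E3 :=
  (rotIsometry hab t).toLinearIsometryEquiv rfl

lemma rot_apply {a b : Fin 3} (hab : a ≠ b) (t : ℝ) (x : E3) : rot hab t x = rotFun a b t x := rfl

lemma hasDerivAt_eval_rot {a b : Fin 3} (hab : a ≠ b) (P : MvPolynomial (Fin 3) ℝ) (x : E3)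
    (t : ℝ) : HasDerivAt (fun t => eval (rot hab t x).ofLp P)
      (eval (rot hab t x).ofLp (X a * pderiv b P - X b * pderiv a P)) t := by
  have hf : ∀ i, HasDerivAt (fun t => (rot hab t x).ofLp i)
      (if i = a then -(rot hab t x).ofLp b else if i = b then (rot hab t x).ofLp a else 0) t := by
    intro i
    simp only [rot_apply, rotFun, hab.symm, if_false, if_true]
    split_ifs
    · convert! ((Real.hasDerivAt_cos t).mul_const (x a)).sub
        ((Real.hasDerivAt_sin t).mul_const (x b)) using 1
      ring
    · convert! ((Real.hasDerivAt_sin t).mul_const (x a)).add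
        ((Real.hasDerivAt_cos t).mul_const (x b)) using 1
      ring
    · exact hasDerivAt_const _ _
  have h := (hasFDerivAt_eval (fun i => (hf i).hasFDerivAt) P).hasDerivAt
  convert! h using 1
  simp only [sum_apply, smul_apply, ContinuousLinearMap.toSpanSingleton_apply, smul_eq_mul, one_mul]
  rw [map_sub, map_mul, map_mul, eval_X, eval_X]
  rw [← Finset.add_sum_erase _ _ (Finset.mem_univ a),
    ← Finset.add_sum_erase _ _ (Finset.mem_erase.2 ⟨hab.symm, Finset.mem_univ b⟩),
    Finset.sum_eq_zero]
  · simp [hab.symm]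
    ring
  · intro i hi
    simp only [Finset.mem_erase, Finset.mem_univ, and_true] at hi
    simp [hi.1, hi.2]

lemma continuous_eval_sphere (P : MvPolynomial (Fin 3) ℝ) :
    Continuous (fun p : S2 => eval p.1.ofLp P) :=
  (continuous_eval_e3 P).comp continuous_subtype_val

lemma sphereAverage_eq (U : S2 → ℝ) :
    sphereAverage U = (surface.real Set.univ)⁻¹ * ∫ p, U p ∂surface := by
  rw [sphereAverage, average_eq, smul_eq_mul]

/-- The functional `P ↦ ⟨P⟩` on polynomials. -/
def averageFunctional : MvPolynomial (Fin 3) ℝ →ₗ[ℝ] ℝ where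
  toFun P := sphereAverage fun p => eval p.1.ofLp P
  map_add' P Q := by
    simp only [sphereAverage_eq, map_add]
    rw [integral_add (integrable_surface (continuous_eval_sphere P))
      (integrable_surface (continuous_eval_sphere Q)), mul_add]
  map_smul' c P := by
    simp only [sphereAverage_eq, smul_eval, integral_const_mul, RingHom.id_apply, smul_eq_mul]
    ring

lemma averageFunctional_one : averageFunctional 1 = 1 := by
  simp only [averageFunctional, LinearMap.coe_mk, AddHom.coe_mk, sphereAverage_eq, map_one,
    integral_const, smul_eq_mul, mul_one]
  exact inv_mul_cancel₀ surface_univ_ne_zero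

lemma continuous_eval_isometry (R : E3 ≃ₗᵢ[ℝ] E3) (Q : MvPolynomial (Fin 3) ℝ) :
    Continuous fun p : S2 => eval (R p).ofLp Q :=
  (continuous_eval_e3 Q).comp (R.continuous.comp continuous_subtype_val)

lemma integral_eval_isometry (R : E3 ≃ₗᵢ[ℝ] E3) (Q : MvPolynomial (Fin 3) ℝ) :
    ∫ p : S2, eval (R p).ofLp Q ∂surface = ∫ p : S2, eval p.1.ofLp Q ∂surface := by
  have := integral_map (μ := surface) (continuous_sphereMap R).measurable.aemeasurable
    (continuous_eval_sphere Q).aestronglyMeasurable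
  rw [(measurePreserving_sphereMap R).map_eq] at this
  exact this.symm

/-- The integrand is the derivative at `t = 0` of `P` along the rotations in the `(a, b)` plane,
whose integral does not depend on `t`. -/
lemma integral_rotation (a b : Fin 3) (P : MvPolynomial (Fin 3) ℝ) :
    ∫ p : S2, eval p.1.ofLp (X a * pderiv b P - X b * pderiv a P) ∂surface = 0 := by
  by_cases hab : a = b
  · rw [hab, sub_self]
    simp only [map_zero, integral_zero]
  obtain ⟨R, hR⟩ : ∃ R : ℝ → E3 ≃ₗᵢ[ℝ] E3, R = rot hab := ⟨_, rfl⟩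
  have hd : ∀ (t : ℝ) (p : S2), HasDerivAt (fun t => eval (R t p).ofLp P)
      (eval (R t p).ofLp (X a * pderiv b P - X b * pderiv a P)) t := fun t p => by
    rw [hR]
    exact hasDerivAt_eval_rot hab P p t
  generalize X a * pderiv b P - X b * pderiv a P = Q at hd ⊢
  obtain ⟨C, _, hC⟩ := exists_eval_bound Q
  have hbd : ∀ t ∈ Set.Icc (-1 : ℝ) 1, ∀ p : S2, ‖eval (R t p).ofLp Q‖ ≤ C := fun t _ p =>
    hC _ (by rw [LinearIsometryEquiv.norm_map, norm_eq_of_mem_sphere])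
  have key := hasDerivAt_integral_of_bounded (μ := surface)
    (f := fun t (p : S2) => eval (R t p).ofLp P) (f' := fun t (p : S2) => eval (R t p).ofLp Q)
    (fun t => (continuous_eval_isometry (R t) P).aestronglyMeasurable)
    (integrable_surface (continuous_eval_isometry (R 0) P))
    (continuous_eval_isometry (R 0) Q).aestronglyMeasurable hbd hd
  rw [integral_eval_isometry, funext fun t => integral_eval_isometry (R t) P] at key
  exact key.unique (hasDerivAt_const _ _)

lemma isRotationInvariant_averageFunctional : IsRotationInvariant averageFunctional where
  normSq_mul P := by
    simp only [averageFunctional, LinearMap.coe_mk, AddHom.coe_mk]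
    congr 1
    ext p
    have := sum_sq_sphere p
    simp only [normSqPoly, map_mul, map_add, map_pow, eval_X, this, one_mul]
  rotation a b P := by
    simp only [averageFunctional, LinearMap.coe_mk, AddHom.coe_mk]
    rw [sphereAverage_eq, integral_rotation, mul_zero]

/-- Continuous functions on the sphere are uniform limits of polynomials. -/
lemma exists_polynomial_near {U : S2 → ℝ} (hU : Continuous U) {ε : ℝ} (hε : 0 < ε) :
    ∃ P : MvPolynomial (Fin 3) ℝ, ∀ p : S2, |eval p.1.ofLp P - U p| < ε := by
  let c : Fin 3 → C(S2, ℝ) := fun i =>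
    ⟨fun p => p.1 i, (PiLp.continuous_apply 2 _ i).comp continuous_subtype_val⟩
  let A : Subalgebra ℝ C(S2, ℝ) := (aeval (R := ℝ) c).range
  have hA : A.SeparatesPoints := by
    intro p q hpq
    by_contra! h
    apply hpq
    ext i
    exact h _ ⟨c i, ⟨X i, by simp⟩, rfl⟩
  obtain ⟨⟨g, P, hP⟩, hg⟩ := ContinuousMap.exists_mem_subalgebra_near_continuous_of_separatesPoints
    A hA U hU ε hε
  refine ⟨P, fun p => ?_⟩
  have h1 : g p = eval p.1.ofLp P := by
    have h2 : ∀ Q : MvPolynomial (Fin 3) ℝ, (aeval c Q : C(S2, ℝ)) p = eval p.1.ofLp Q := by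
      intro Q
      induction Q using MvPolynomial.induction_on with
      | C a => simp
      | add P Q hP hQ => simp [hP, hQ]
      | mul_X P i hP => simp [hP, c]
    rw [← h2 P, ← hP]
    rfl
  have := hg p
  rwa [h1] at this

end SphereAverage

/-! ### Integrals of `U(φ) φ^*ω` for continuous `U` -/

namespace SkyrmeField

open MvPolynomial

variable {L : PeriodPair} (Φ : SkyrmeField L)

lemma kahlerFunctional_eq (P : MvPolynomial (Fin 3) ℝ) :
    Φ.kahlerFunctional P = 4 * Real.pi * Φ.degree * averageFunctional P := by
  have := Φ.isRotationInvariant_kahlerFunctional.eq_smul isRotationInvariant_averageFunctional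
    averageFunctional_one
  rw [this, LinearMap.smul_apply, smul_eq_mul, kahlerFunctional_one]

lemma aestronglyMeasurable_comp {U : S2 → ℝ} (hU : Continuous U) :
    AEStronglyMeasurable (fun z => U (Φ.toFun z)) volume := by
  have h : AEStronglyMeasurable Φ.toFun volume :=
    (Topology.IsEmbedding.subtypeVal.aestronglyMeasurable_comp_iff).1 Φ.measurable
  exact hU.comp_aestronglyMeasurable h

lemma integrableOn_comp_mul_pullbackKahler {U : S2 → ℝ} (hU : Continuous U) :
    IntegrableOn (fun z => U (Φ.toFun z) * Φ.pullbackKahler z) (cell L) := by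
  obtain ⟨C, hC⟩ := isCompact_univ.exists_bound_of_continuousOn hU.continuousOn
  exact Φ.integrableOn_pullbackKahler.bdd_mul (c := C) (Φ.aestronglyMeasurable_comp hU).restrict
    (Eventually.of_forall fun z => hC _ trivial)

/-- The integral of `U(φ) φ^*ω` depends only on the degree. -/
lemma setIntegral_comp_mul_pullbackKahler {U : S2 → ℝ} (hU : Continuous U) :
    ∫ z in cell L, U (Φ.toFun z) * Φ.pullbackKahler z =
      4 * Real.pi * sphereAverage U * Φ.degree := by
  set K := ∫ z in cell L, |Φ.pullbackKahler z| with hK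
  have hK0 : 0 ≤ K := integral_nonneg fun z => abs_nonneg _
  rw [← sub_eq_zero, ← abs_nonpos_iff]
  refine le_of_forall_pos_le_add fun ε hε => ?_
  rw [zero_add]
  -- Approximating `U` within `ε / B` costs `K ε / B` in the integral over the torus and `4π |deg| ε
  -- / B` in the average. The `1` keeps `B` positive.
  set B := K + 4 * Real.pi * |Φ.degree| + 1 with hB
  have hB0 : 0 < B := by positivity
  obtain ⟨P, hP⟩ := exists_polynomial_near hU (div_pos hε hB0)
  have h1 : |(∫ z in cell L, U (Φ.toFun z) * Φ.pullbackKahler z) - Φ.kahlerFunctional P| ≤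
      ε / B * K := by
    simp only [kahlerFunctional, LinearMap.coe_mk, AddHom.coe_mk]
    rw [← integral_sub (Φ.integrableOn_comp_mul_pullbackKahler hU)
      (Φ.integrableOn_eval_pullbackKahler P), hK, ← integral_const_mul, ← Real.norm_eq_abs]
    refine norm_integral_le_of_norm_le (Φ.integrableOn_pullbackKahler.abs.const_mul _)
      (Eventually.of_forall fun z => ?_)
    rw [← sub_mul, norm_mul, Real.norm_eq_abs, Real.norm_eq_abs, abs_sub_comm]
    exact mul_le_mul_of_nonneg_right (hP _).le (abs_nonneg _)
  have h2 : |averageFunctional P - sphereAverage U| ≤ ε / B := by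
    have h3 : averageFunctional P - sphereAverage U =
        sphereAverage fun p => eval p.1.ofLp P - U p := by
      simp only [averageFunctional, LinearMap.coe_mk, AddHom.coe_mk, sphereAverage_eq]
      rw [integral_sub (integrable_surface (continuous_eval_sphere P)) (integrable_surface hU),
        mul_sub]
    rw [h3, sphereAverage_eq, abs_mul, abs_of_nonneg (by positivity),
      inv_mul_le_iff₀ (lt_of_le_of_ne measureReal_nonneg surface_univ_ne_zero.symm)]
    have := norm_integral_le_of_norm_le_const (μ := surface) (C := ε / B)
      (f := fun p => eval p.1.ofLp P - U p)
      (Eventually.of_forall fun p => (hP p).le)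
    rw [mul_comm]
    exact this
  have h4 := Φ.kahlerFunctional_eq P
  have h5 : (∫ z in cell L, U (Φ.toFun z) * Φ.pullbackKahler z) -
      4 * Real.pi * sphereAverage U * Φ.degree =
      ((∫ z in cell L, U (Φ.toFun z) * Φ.pullbackKahler z) - Φ.kahlerFunctional P) +
      4 * Real.pi * Φ.degree * (averageFunctional P - sphereAverage U) := by
    rw [h4]; ring
  rw [h5]
  refine (abs_add_le _ _).trans ?_
  rw [abs_mul (4 * Real.pi * Φ.degree), abs_mul, abs_of_nonneg (show 0 ≤ 4 * Real.pi by positivity)]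
  have h6 : 4 * Real.pi * |Φ.degree| * |averageFunctional P - sphereAverage U| ≤
      4 * Real.pi * |Φ.degree| * (ε / B) := by gcongr
  have h7 : ε / B * K + 4 * Real.pi * |Φ.degree| * (ε / B) ≤ ε / B * B := by
    have : 0 < ε / B := div_pos hε hB0
    rw [hB]
    nlinarith
  rw [div_mul_cancel₀ _ hB0.ne'] at h7
  linarith

end SkyrmeField

/-! ### The energy bounds -/

namespace SkyrmeField

variable {L : PeriodPair} (Φ : SkyrmeField L)

/-- The difference of the two sides is `|Y - X × p|² + (X · p)²`. Tangency of `X` and `Y` is not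
needed, so the weak differential need not be shown tangent to the sphere. -/
lemma two_mul_kahler_le (p : S2) (X Y : E3) :
    2 * kahler p X Y ≤ inner ℝ X X + inner ℝ Y Y := by
  rw [kahler_apply, inner_e3, inner_e3]
  have h := sum_sq_sphere p
  have e : (X 0 * X 0 + X 1 * X 1 + X 2 * X 2) + (Y 0 * Y 0 + Y 1 * Y 1 + Y 2 * Y 2) -
      2 * (p.1 0 * (Y 1 * X 2 - Y 2 * X 1) + p.1 1 * (Y 2 * X 0 - Y 0 * X 2) +
        p.1 2 * (Y 0 * X 1 - Y 1 * X 0)) =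
      (Y 0 - (X 1 * p.1 2 - X 2 * p.1 1)) ^ 2 + (Y 1 - (X 2 * p.1 0 - X 0 * p.1 2)) ^ 2 +
        (Y 2 - (X 0 * p.1 1 - X 1 * p.1 0)) ^ 2 +
        (X 0 * p.1 0 + X 1 * p.1 1 + X 2 * p.1 2) ^ 2 := by
    linear_combination -(X 0 ^ 2 + X 1 ^ 2 + X 2 ^ 2) * h
  have : 0 ≤ (Y 0 - (X 1 * p.1 2 - X 2 * p.1 1)) ^ 2 + (Y 1 - (X 2 * p.1 0 - X 0 * p.1 2)) ^ 2 +
        (Y 2 - (X 0 * p.1 1 - X 1 * p.1 0)) ^ 2 +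
        (X 0 * p.1 0 + X 1 * p.1 1 + X 2 * p.1 2) ^ 2 := by positivity
  linarith

lemma energy2_one : Φ.energy2 1 = (1 / 2) * ∫ z in cell L,
    (inner ℝ (Φ.diff z (frame 0)) (Φ.diff z (frame 0)) +
      inner ℝ (Φ.diff z (frame 1)) (Φ.diff z (frame 1))) := by
  simp [energy2, Fin.sum_univ_two, Matrix.one_apply]

lemma energy4_one : Φ.energy4 1 = (1 / 2) * ∫ z in cell L, Φ.pullbackKahler z ^ 2 := by
  simp [energy4]

lemma energy0_one (U : S2 → ℝ) :
    energy0 U Φ 1 = (1 / 2) * ∫ z in cell L, U (Φ.toFun z) ^ 2 := by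
  simp [energy0]

lemma setIntegral_pullbackKahler :
    ∫ z in cell L, Φ.pullbackKahler z = 4 * Real.pi * Φ.degree := by
  rw [← kahlerFunctional_one]
  simp [kahlerFunctional]

lemma integrableOn_pullbackKahler_sq :
    IntegrableOn (fun z => Φ.pullbackKahler z ^ 2) (cell L) := Φ.finite_energy

lemma integrableOn_comp_sq {U : S2 → ℝ} (hU : Continuous U) :
    IntegrableOn (fun z => U (Φ.toFun z) ^ 2) (cell L) := by
  obtain ⟨C, hC⟩ := isCompact_univ.exists_bound_of_continuousOn (hU.pow 2).continuousOn
  exact (integrable_const C).mono' (Φ.aestronglyMeasurable_comp (hU.pow 2)).restrict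
    (Eventually.of_forall fun z => hC _ trivial)

lemma norm_frame (i : Fin 2) : ‖frame i‖ = 1 := by
  fin_cases i <;> simp [frame]

lemma integrableOn_inner_diff (i : Fin 2) :
    IntegrableOn (fun z => inner ℝ (Φ.diff z (frame i)) (Φ.diff z (frame i))) (cell L) := by
  have hm : AEStronglyMeasurable (fun z => Φ.diff z (frame i)) (volume.restrict (cell L)) :=
    (ContinuousLinearMap.apply ℝ E3 (frame i)).continuous.comp_aestronglyMeasurable
      Φ.integrableOn_diff.aestronglyMeasurable
  refine Φ.integrableOn_norm_sq_diff.mono' (hm.inner hm) (Eventually.of_forall fun z => ?_)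
  rw [real_inner_self_eq_norm_sq, norm_pow, norm_norm]
  have := (Φ.diff z).le_opNorm (frame i)
  rw [norm_frame, mul_one] at this
  gcongr

/-- The Bogomolny type bound for `E₂`. -/
lemma le_energy2 : 4 * Real.pi * Φ.degree ≤ Φ.energy2 1 := by
  rw [energy2_one, ← setIntegral_pullbackKahler, ← integral_const_mul]
  refine integral_mono Φ.integrableOn_pullbackKahler
    (((Φ.integrableOn_inner_diff 0).add (Φ.integrableOn_inner_diff 1)).const_mul _) fun z => ?_
  have := two_mul_kahler_le (Φ.toFun z) (Φ.diff z (frame 0)) (Φ.diff z (frame 1))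
  rw [pullbackKahler]
  simp only
  linarith

/-- The Bogomolny type bound for `E₀ + E₄`. -/
lemma le_energy0_add_energy4 {U : S2 → ℝ} (hU : Continuous U) :
    4 * Real.pi * sphereAverage U * Φ.degree ≤ energy0 U Φ 1 + Φ.energy4 1 := by
  rw [← Φ.setIntegral_comp_mul_pullbackKahler hU, energy0_one, energy4_one, ← mul_add,
    ← integral_add (Φ.integrableOn_comp_sq hU) Φ.integrableOn_pullbackKahler_sq,
    ← integral_const_mul]
  refine integral_mono (Φ.integrableOn_comp_mul_pullbackKahler hU)
    (((Φ.integrableOn_comp_sq hU).add Φ.integrableOn_pullbackKahler_sq).const_mul _) fun z => ?_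
  simp only
  nlinarith [sq_nonneg (U (Φ.toFun z) - Φ.pullbackKahler z)]

end SkyrmeField

/-! ### The potential -/

lemma apply_two_lt_one {p : S2} (hp : p ≠ northPole) : p.1 2 < 1 := by
  have h := sum_sq_sphere p
  refine lt_of_le_of_ne (by nlinarith [sq_nonneg (p.1 0), sq_nonneg (p.1 1)]) fun h2 => hp ?_
  have h0 : p.1 0 = 0 := by nlinarith [sq_nonneg (p.1 0), sq_nonneg (p.1 1)]
  have h1 : p.1 1 = 0 := by nlinarith [sq_nonneg (p.1 0), sq_nonneg (p.1 1)]
  ext i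
  fin_cases i
  · simpa [northPole] using h0
  · simpa [northPole] using h1
  · simpa [northPole] using h2

lemma one_sub_ofReal_ne_zero {x : ℝ} (hx : 1 - x ≠ 0) : (1 : ℂ) - (x : ℂ) ≠ 0 := by
  rw [← Complex.ofReal_one, ← Complex.ofReal_sub]
  exact Complex.ofReal_ne_zero.2 hx

lemma one_add_norm_stereo_sq {p : S2} (hp : p ≠ northPole) :
    1 + ‖stereo p‖ ^ 2 = 2 / (1 - p.1 2) := by
  have h := sum_sq_sphere p
  have h1 : 1 - p.1 2 ≠ 0 := (sub_pos.2 (apply_two_lt_one hp)).ne'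
  have h2 : stereo p = ⟨p.1 0 / (1 - p.1 2), p.1 1 / (1 - p.1 2)⟩ := by
    have h3 : (1 : ℂ) - (p.1 2 : ℂ) ≠ 0 := one_sub_ofReal_ne_zero h1
    have h4 : (⟨p.1 0 / (1 - p.1 2), p.1 1 / (1 - p.1 2)⟩ : ℂ) =
        ((p.1 0 / (1 - p.1 2) : ℝ) : ℂ) + ((p.1 1 / (1 - p.1 2) : ℝ) : ℂ) * Complex.I :=
      Complex.mk_eq_add_mul_I _ _
    rw [h4, stereo]
    push_cast
    field_simp
  rw [norm_sq_eq_re_im, h2]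
  field_simp
  linear_combination h

lemma continuous_sphere_apply (i : Fin 3) : Continuous (fun p : S2 => p.1 i) :=
  (PiLp.continuous_apply 2 _ i).comp continuous_subtype_val

lemma continuousAt_stereo {p : S2} (hp : p ≠ northPole) : ContinuousAt stereo p := by
  have h1 : (1 : ℂ) - (p.1 2 : ℂ) ≠ 0 :=
    one_sub_ofReal_ne_zero (sub_pos.2 (apply_two_lt_one hp)).ne'
  have hc : ∀ i, Continuous (fun p : S2 => ((p.1 i : ℝ) : ℂ)) := fun i =>
    Complex.continuous_ofReal.comp (continuous_sphere_apply i)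
  exact (((hc 0).add (continuous_const.mul (hc 1))).continuousAt).div
    (continuous_const.sub (hc 2)).continuousAt h1

lemma weierstrassPotential_nonneg (c₂ c₃ : ℂ) (p : S2) : 0 ≤ weierstrassPotential c₂ c₃ p := by
  rw [weierstrassPotential]
  split_ifs <;> positivity

/-- The square root equals `(1 + |W|²)^(-1/2)`, and a cubic over `(1 + |W|²)²` decays at that rate.
This gives continuity at the north pole. -/
lemma weierstrassPotential_le (c₂ c₃ : ℂ) (p : S2) :
    weierstrassPotential c₂ c₃ p ≤ 4 * (4 + ‖c₂‖ + ‖c₃‖) * √((1 - p.1 2) / 2) := by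
  by_cases hp : p = northPole
  · rw [weierstrassPotential, if_pos hp]
    positivity
  rw [weierstrassPotential, if_neg hp]
  have h1 : (1 - p.1 2) / 2 = (1 + ‖stereo p‖ ^ 2)⁻¹ := by
    rw [one_add_norm_stereo_sq hp, inv_div]
  rw [h1, Real.sqrt_inv]
  set r := ‖stereo p‖ with hr
  have hr0 : 0 ≤ r := norm_nonneg _
  set q := √(1 + r ^ 2) with hq
  have hq2 : 1 + r ^ 2 = q ^ 2 := (Real.sq_sqrt (by positivity)).symm
  have hq1 : 1 ≤ q := by rw [hq, Real.one_le_sqrt]; nlinarith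
  have hrq : r ≤ q := by
    rw [hq]; exact Real.le_sqrt_of_sq_le (by linarith)
  have h2 : ‖4 * stereo p ^ 3 - c₂ * stereo p - c₃‖ ≤ (4 + ‖c₂‖ + ‖c₃‖) * q ^ 3 := by
    calc ‖4 * stereo p ^ 3 - c₂ * stereo p - c₃‖
        ≤ 4 * r ^ 3 + ‖c₂‖ * r + ‖c₃‖ := by
          refine (norm_sub_le _ _).trans (add_le_add ((norm_sub_le _ _).trans_eq ?_) le_rfl)
          simp [hr]
      _ ≤ 4 * q ^ 3 + ‖c₂‖ * q ^ 3 + ‖c₃‖ * q ^ 3 := by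
          have h3 : r ≤ q ^ 3 := hrq.trans (le_self_pow₀ hq1 (by norm_num))
          have h4 : 1 ≤ q ^ 3 := one_le_pow₀ hq1
          have h5 : r ^ 3 ≤ q ^ 3 := by gcongr
          have h6 := mul_le_mul_of_nonneg_left h3 (norm_nonneg c₂)
          have h7 := mul_le_mul_of_nonneg_left h4 (norm_nonneg c₃)
          linarith
      _ = _ := by ring
  rw [hq2, div_le_iff₀ (by positivity)]
  have h3 : 4 * (4 + ‖c₂‖ + ‖c₃‖) * q⁻¹ * (q ^ 2) ^ 2 = 4 * ((4 + ‖c₂‖ + ‖c₃‖) * q ^ 3) := by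
    have : q ≠ 0 := by positivity
    field_simp
  rw [h3]
  gcongr

lemma continuous_weierstrassPotential (c₂ c₃ : ℂ) : Continuous (weierstrassPotential c₂ c₃) := by
  rw [continuous_iff_continuousAt]
  intro p
  by_cases hp : p = northPole
  · have h0 : weierstrassPotential c₂ c₃ p = 0 := by rw [weierstrassPotential, if_pos hp]
    rw [ContinuousAt, h0]
    refine squeeze_zero (weierstrassPotential_nonneg c₂ c₃) (weierstrassPotential_le c₂ c₃) ?_
    have hc : Continuous fun p : S2 => 4 * (4 + ‖c₂‖ + ‖c₃‖) * √((1 - p.1 2) / 2) :=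
      continuous_const.mul
        ((continuous_const.sub (continuous_sphere_apply 2)).div_const 2).sqrt
    have h1 := hc.tendsto p
    rwa [hp, show 4 * (4 + ‖c₂‖ + ‖c₃‖) * √((1 - northPole.1 2) / 2) = 0 by
      simp [northPole], ← hp] at h1
  · have hs := continuousAt_stereo hp
    have h1 : ContinuousAt (fun p => 4 * ‖4 * stereo p ^ 3 - c₂ * stereo p - c₃‖ /
        (1 + ‖stereo p‖ ^ 2) ^ 2) p := by
      refine ContinuousAt.div (by fun_prop) (by fun_prop) (by positivity)
    refine h1.congr ?_
    filter_upwards [isOpen_ne.mem_nhds hp] with q hq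
    rw [weierstrassPotential, if_neg hq]

lemma invStereo_ne_northPole (W : ℂ) : invStereo W ≠ northPole := by
  intro h
  have h1 : (invStereo W).1 2 = northPole.1 2 := by rw [h]
  have h2 : (1 : ℝ) + ‖W‖ ^ 2 ≠ 0 := by positivity
  simp only [invStereo, northPole, Matrix.cons_val] at h1
  rw [div_eq_one_iff_eq h2] at h1
  linarith

lemma weierstrassPotential_invStereo (c₂ c₃ W : ℂ) :
    weierstrassPotential c₂ c₃ (invStereo W) =
      4 * ‖4 * W ^ 3 - c₂ * W - c₃‖ / (1 + ‖W‖ ^ 2) ^ 2 := by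
  rw [weierstrassPotential, if_neg (invStereo_ne_northPole W), stereo_invStereo]

/-! ### The Weierstrass map -/

section WeierstrassMap

variable (L : PeriodPair)

/-- `weierstrassMap` as a map into `E3`. -/
def weierstrassE3 (z : ℂ) : E3 := weierstrassMap L z

lemma weierstrassMap_of_mem {z : ℂ} (hz : z ∈ L.lattice) : weierstrassMap L z = northPole := by
  rw [weierstrassMap, if_pos hz]

lemma weierstrassMap_of_notMem {z : ℂ} (hz : z ∉ L.lattice) :
    weierstrassMap L z = invStereo (L.weierstrassP z) := by
  rw [weierstrassMap, if_neg hz]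

lemma weierstrassMap_periodic : ∀ l ∈ L.lattice, ∀ z,
    weierstrassMap L (z + l) = weierstrassMap L z := by
  intro l hl z
  have h : z + l ∈ L.lattice ↔ z ∈ L.lattice := Submodule.add_mem_iff_left _ hl
  by_cases hz : z ∈ L.lattice
  · rw [weierstrassMap_of_mem L hz, weierstrassMap_of_mem L (h.2 hz)]
  · rw [weierstrassMap_of_notMem L hz, weierstrassMap_of_notMem L (mt h.1 hz),
      L.weierstrassP_add_coe z ⟨l, hl⟩]

lemma weierstrassE3_periodic : ∀ l ∈ L.lattice, ∀ z,
    weierstrassE3 L (z + l) = weierstrassE3 L z := fun l hl z => by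
  rw [weierstrassE3, weierstrassMap_periodic L l hl, weierstrassE3]

lemma hasDerivAt_weierstrassP {z : ℂ} (hz : z ∉ L.lattice) :
    HasDerivAt L.weierstrassP (L.derivWeierstrassP z) z := by
  have := (L.analyticOnNhd_weierstrassP z hz).differentiableAt.hasDerivAt
  rwa [L.deriv_weierstrassP] at this

lemma eventually_notMem_lattice {z : ℂ} (hz : z ∉ L.lattice) : ∀ᶠ w in 𝓝 z, w ∉ L.lattice :=
  L.isClosed_lattice.isOpen_compl.mem_nhds hz

lemma weierstrassE3_eventuallyEq {z : ℂ} (hz : z ∉ L.lattice) :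
    weierstrassE3 L =ᶠ[𝓝 z] fun w => (invStereo (L.weierstrassP w) : E3) := by
  filter_upwards [eventually_notMem_lattice L hz] with w hw
  rw [weierstrassE3, weierstrassMap_of_notMem L hw]

/-- The holomorphic function `z² ℘(z)` near the origin. -/
def poleFactor (z : ℂ) : ℂ := z ^ 2 * L.weierstrassPExcept 0 z + 1

lemma analyticAt_poleFactor : AnalyticAt ℂ (poleFactor L) 0 := by
  have := L.analyticAt_weierstrassPExcept 0
  unfold poleFactor
  fun_prop

lemma poleFactor_zero : poleFactor L 0 = 1 := by simp [poleFactor]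

lemma weierstrassP_eq_poleFactor {z : ℂ} (hz : z ≠ 0) :
    L.weierstrassP z = poleFactor L z / z ^ 2 := by
  have h := L.weierstrassPExcept_add ⟨0, zero_mem _⟩ z
  rw [← h, poleFactor]
  simp only [sub_zero]
  field_simp
  simp

lemma eventually_notMem_lattice_of_ne_zero : ∀ᶠ z in 𝓝 (0 : ℂ), z ≠ 0 → z ∉ L.lattice := by
  filter_upwards [L.compl_lattice_sdiff_singleton_mem_nhds 0] with z hz hz0 hmem
  exact hz ⟨hmem, hz0⟩

/-- In the coordinate `1/W` the map is `1/℘ = z² / (z² ℘)`, which is analytic at the origin, so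
smoothness there reduces to that of the chart. -/
lemma weierstrassE3_eventuallyEq_zero :
    weierstrassE3 L =ᶠ[𝓝 0] fun w => invStereoAtInfty (w ^ 2 / poleFactor L w) := by
  have hne : ∀ᶠ z in 𝓝 (0 : ℂ), poleFactor L z ≠ 0 :=
    (analyticAt_poleFactor L).continuousAt.eventually_ne (by simp [poleFactor_zero])
  filter_upwards [hne, eventually_notMem_lattice_of_ne_zero L] with z h1 h2
  by_cases hz : z = 0
  · subst hz
    rw [weierstrassE3, weierstrassMap_of_mem L (zero_mem _)]
    simp [invStereoAtInfty_zero]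
  · rw [weierstrassE3, weierstrassMap_of_notMem L (h2 hz), weierstrassP_eq_poleFactor L hz,
      invStereo_eq_invStereoAtInfty (div_ne_zero h1 (pow_ne_zero 2 hz)), inv_div]

lemma contDiffAt_real_of_analyticAt {f : ℂ → ℂ} {z : ℂ} (h : AnalyticAt ℂ f z) :
    ContDiffAt ℝ ∞ f z :=
  (h.contDiffAt (n := ∞)).restrict_scalars ℝ

lemma analyticAt_inv_weierstrassP : AnalyticAt ℂ (fun w => w ^ 2 / poleFactor L w) 0 :=
  (analyticAt_id.pow 2).div (analyticAt_poleFactor L) (by simp [poleFactor_zero])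

lemma contDiff_weierstrassE3 : ContDiff ℝ ∞ (weierstrassE3 L) := by
  have h0 : ContDiffAt ℝ ∞ (weierstrassE3 L) 0 :=
    (contDiff_invStereoAtInfty.contDiffAt.comp (0 : ℂ)
      (contDiffAt_real_of_analyticAt (analyticAt_inv_weierstrassP L))).congr_of_eventuallyEq
      (weierstrassE3_eventuallyEq_zero L)
  rw [contDiff_iff_contDiffAt]
  intro z
  by_cases hz : z ∈ L.lattice
  · have h1 : weierstrassE3 L = weierstrassE3 L ∘ fun w => w + -z := by
      ext1 w
      exact (weierstrassE3_periodic L (-z) (neg_mem hz) w).symm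
    rw [h1]
    refine ContDiffAt.comp z ?_ (contDiffAt_id.add contDiffAt_const)
    rwa [add_neg_cancel]
  · exact (contDiff_invStereo.contDiffAt.comp z
      (contDiffAt_real_of_analyticAt (L.analyticOnNhd_weierstrassP z hz))).congr_of_eventuallyEq
      (weierstrassE3_eventuallyEq L hz)

/-- The pole of `℘` is double, so `1/℘` has a double zero and the differential vanishes. -/
lemma fderiv_weierstrassE3_of_mem {z : ℂ} (hz : z ∈ L.lattice) :
    fderiv ℝ (weierstrassE3 L) z = 0 := by
  have h0 : fderiv ℝ (weierstrassE3 L) 0 = 0 := by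
    have h1 : HasDerivAt (fun w => w ^ 2 / poleFactor L w) 0 (0 : ℂ) := by
      have := ((hasDerivAt_id (0 : ℂ)).pow 2).div
        (analyticAt_poleFactor L).differentiableAt.hasDerivAt (by simp [poleFactor_zero])
      convert! this using 1
      simp
    have h2 := (contDiff_invStereoAtInfty.differentiable (by simp)
      ((0 : ℂ) ^ 2 / poleFactor L 0)).hasFDerivAt
    have h3 := h2.comp (0 : ℂ) (h1.hasFDerivAt.restrictScalars ℝ)
    rw [(weierstrassE3_eventuallyEq_zero L).fderiv_eq]
    refine h3.fderiv.trans ?_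
    ext v
    simp
  rw [← h0, ← fderiv_periodic (weierstrassE3_periodic L) z hz 0, zero_add]

lemma fderiv_weierstrassE3_of_notMem {z : ℂ} (hz : z ∉ L.lattice) (v : ℂ) :
    fderiv ℝ (weierstrassE3 L) z v =
      invStereoDeriv (L.weierstrassP z) (L.derivWeierstrassP z * v) := by
  have h1 : HasDerivAt (fun t : ℝ => z + t • v) v 0 := by
    simpa using ((hasDerivAt_id (0 : ℝ)).smul_const v).const_add z
  have hz0 : z + (0 : ℝ) • v = z := by simp
  have h2 : HasDerivAt (fun t : ℝ => L.weierstrassP (z + t • v)) (L.derivWeierstrassP z * v) 0 := by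
    have := HasFDerivAt.comp_hasDerivAt (0 : ℝ)
      (by rw [hz0]; exact (hasDerivAt_weierstrassP L hz).hasFDerivAt.restrictScalars ℝ) h1
    convert! this using 1
    simp [mul_comm]
  have h3 := hasDerivAt_invStereo h2
  rw [hz0] at h3
  have hd : HasFDerivAt (weierstrassE3 L) (fderiv ℝ (weierstrassE3 L) z) (z + (0 : ℝ) • v) := by
    rw [hz0]
    exact ((contDiff_weierstrassE3 L).differentiable (by simp) z).hasFDerivAt
  have h4 := hd.comp_hasDerivAt (0 : ℝ) h1
  have hcont : Tendsto (fun t : ℝ => z + t • v) (𝓝 0) (𝓝 z) := by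
    have := h1.continuousAt.tendsto
    rwa [hz0] at this
  exact h4.unique (h3.congr_of_eventuallyEq
    (hcont.eventually (weierstrassE3_eventuallyEq L hz)))

lemma cplxStructure_fderiv_weierstrassE3 (z v : ℂ) :
    fderiv ℝ (weierstrassE3 L) z (Complex.I * v) =
      cplxStructure (weierstrassMap L z) (fderiv ℝ (weierstrassE3 L) z v) := by
  by_cases hz : z ∈ L.lattice
  · rw [fderiv_weierstrassE3_of_mem L hz]
    ext i
    fin_cases i <;> simp [cplxStructure]
  · rw [fderiv_weierstrassE3_of_notMem L hz, fderiv_weierstrassE3_of_notMem L hz,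
      weierstrassMap_of_notMem L hz, cplxStructure_invStereoDeriv]
    congr 1
    ring

lemma inner_fderiv_weierstrassE3 (z v : ℂ) :
    inner ℝ (weierstrassMap L z : E3) (fderiv ℝ (weierstrassE3 L) z v) = 0 := by
  by_cases hz : z ∈ L.lattice
  · simp [fderiv_weierstrassE3_of_mem L hz]
  · rw [fderiv_weierstrassE3_of_notMem L hz, weierstrassMap_of_notMem L hz,
      inner_invStereo_invStereoDeriv]

lemma isHolomorphicMap_weierstrassMap : IsHolomorphicMap (weierstrassMap L) :=
  ⟨contDiff_weierstrassE3 L, cplxStructure_fderiv_weierstrassE3 L⟩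

/-- The conformal factor `|∂φ/∂x₁|²` of the Weierstrass map. -/
def conformalFactor (z : ℂ) : ℝ :=
  inner ℝ (fderiv ℝ (weierstrassE3 L) z 1) (fderiv ℝ (weierstrassE3 L) z 1)

lemma contDiff_conformalFactor : ContDiff ℝ ∞ (conformalFactor L) := by
  have h : ContDiff ℝ ∞ (fun z => fderiv ℝ (weierstrassE3 L) z 1) :=
    ((contDiff_weierstrassE3 L).fderiv_right (m := ∞) (by simp)).clm_apply contDiff_const
  exact h.inner ℝ h

lemma conformalFactor_periodic : ∀ l ∈ L.lattice, ∀ z,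
    conformalFactor L (z + l) = conformalFactor L z := fun l hl z => by
  rw [conformalFactor, fderiv_periodic (weierstrassE3_periodic L) l hl, conformalFactor]

lemma conformalFactor_nonneg (z : ℂ) : 0 ≤ conformalFactor L z := real_inner_self_nonneg

lemma conformalFactor_of_notMem {z : ℂ} (hz : z ∉ L.lattice) :
    conformalFactor L z = 4 * ‖L.derivWeierstrassP z‖ ^ 2 / (1 + ‖L.weierstrassP z‖ ^ 2) ^ 2 := by
  rw [conformalFactor, fderiv_weierstrassE3_of_notMem L hz, inner_invStereoDeriv_self, mul_one]

lemma conformalFactor_of_mem {z : ℂ} (hz : z ∈ L.lattice) : conformalFactor L z = 0 := by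
  rw [conformalFactor, fderiv_weierstrassE3_of_mem L hz]
  simp

/-- The potential is made for this: by the differential equation its numerator along `℘` is `4
|℘'|²`. With `pullbackKahler_weierstrassField` it gives `U(φ) = φ^*ω` pointwise, the equality case
of the second bound. -/
lemma weierstrassPotential_weierstrassMap (z : ℂ) :
    weierstrassPotential L.g₂ L.g₃ (weierstrassMap L z) = conformalFactor L z := by
  by_cases hz : z ∈ L.lattice
  · rw [weierstrassMap_of_mem L hz, conformalFactor_of_mem L hz, weierstrassPotential, if_pos rfl]
  · rw [weierstrassMap_of_notMem L hz, conformalFactor_of_notMem L hz,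
      weierstrassPotential_invStereo, ← L.derivWeierstrassP_sq z hz, norm_pow]

/-- The Weierstrass map as a field. -/
def weierstrassField : SkyrmeField L where
  toFun := weierstrassMap L
  diff := fun z => fderiv ℝ (weierstrassE3 L) z
  periodic := weierstrassMap_periodic L
  diff_periodic := fderiv_periodic (weierstrassE3_periodic L)
  measurable := (contDiff_weierstrassE3 L).continuous.aestronglyMeasurable
  diff_memLp := by
    have hc := (contDiff_weierstrassE3 L).continuous_fderiv (by simp)
    obtain ⟨C, hC⟩ := exists_bound_of_periodic (L := L) hc
      (fderiv_periodic (weierstrassE3_periodic L))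
    exact MemLp.of_bound hc.aestronglyMeasurable C (Eventually.of_forall hC)
  weak_diff := by
    intro f hf hfc v
    have hs := contDiff_weierstrassE3 L
    have h1 : Continuous fun z => fderiv ℝ f z v :=
      (hf.continuous_fderiv (by simp)).clm_apply continuous_const
    have h2 : Continuous fun z => fderiv ℝ (weierstrassE3 L) z v :=
      (hs.continuous_fderiv (by simp)).clm_apply continuous_const
    have hfc' : HasCompactSupport fun z => fderiv ℝ f z v := hfc.fderiv_apply ℝ v
    have := integral_smul_fderiv_eq_neg_fderiv_smul_of_integrable (μ := volume) (f := f)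
      (g := weierstrassE3 L) (v := v)
      ((h1.smul hs.continuous).integrable_of_hasCompactSupport hfc'.smul_right)
      ((hf.continuous.smul h2).integrable_of_hasCompactSupport hfc.smul_right)
      ((hf.continuous.smul hs.continuous).integrable_of_hasCompactSupport hfc.smul_right)
      (fun z _ => hf.differentiable (by simp) z) (fun z _ => hs.differentiable (by simp) z)
    rw [this, neg_neg]
    rfl
  finite_energy := by
    refine (integrableOn_cell_of_continuous (L := L)
      ((contDiff_conformalFactor L).continuous.pow 2)).congr (Eventually.of_forall fun z => ?_)
    have h := cplxStructure_fderiv_weierstrassE3 L z 1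
    rw [mul_one] at h
    simp only
    rw [h, kahler_cplxStructure _ _ (inner_fderiv_weierstrassE3 L z 1)]
    rfl

lemma inner_weierstrassField_diff (z : ℂ) (i j : Fin 2) :
    inner ℝ ((weierstrassField L).diff z (frame i)) ((weierstrassField L).diff z (frame j)) =
      if i = j then conformalFactor L z else 0 := by
  have h := cplxStructure_fderiv_weierstrassE3 L z 1
  rw [mul_one] at h
  fin_cases i <;> fin_cases j
  · simp [frame, weierstrassField, conformalFactor]
  · simp [frame, weierstrassField, h, inner_cplxStructure]
  · rw [real_inner_comm]
    simp [frame, weierstrassField, h, inner_cplxStructure]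
  · simp only [frame, weierstrassField, Matrix.cons_val_one, Matrix.cons_val_zero,
      Fin.mk_one, if_true, h]
    exact inner_cplxStructure_self _ _ (inner_fderiv_weierstrassE3 L z 1)

lemma pullbackKahler_weierstrassField (z : ℂ) :
    (weierstrassField L).pullbackKahler z = conformalFactor L z := by
  have h := cplxStructure_fderiv_weierstrassE3 L z 1
  rw [mul_one] at h
  simp only [SkyrmeField.pullbackKahler, frame, weierstrassField, Matrix.cons_val_one,
    Matrix.cons_val_zero, h]
  exact kahler_cplxStructure _ _ (inner_fderiv_weierstrassE3 L z 1)

end WeierstrassMap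

/-! ### The degree of the Weierstrass map -/

section Degree

lemma integrable_radial_bound {c : ℝ} (hc : 0 < c) (C : ℝ) :
    Integrable (fun s : ℂ => C * (‖s‖ ^ 2 / (1 + c * ‖s‖ ^ 4) ^ 2)) := by
  refine Integrable.const_mul ?_ C
  rw [integrable_fun_norm_addHaar (μ := (volume : Measure ℂ))
    (f := fun y => y ^ 2 / (1 + c * y ^ 4) ^ 2)]
  have hpos : ∀ y : ℝ, 1 + c * y ^ 4 ≠ 0 := fun y => by positivity
  -- In polar coordinates the integrand becomes `r³ / (1 + c r⁴)²`, with an explicit bounded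
  -- primitive.
  refine integrableOn_Ioi_deriv_of_nonneg' (a := 0) (l := 0)
    (g := fun y => -(4 * c)⁻¹ * (1 + c * y ^ 4)⁻¹) (fun y _ => ?_) (fun y hy => ?_) ?_
  · have h1 : HasDerivAt (fun y : ℝ => 1 + c * y ^ 4) (c * (4 * y ^ 3)) y := by
      simpa using ((hasDerivAt_pow 4 y).const_mul c).const_add 1
    convert! (h1.inv (hpos y)).const_mul (-(4 * c)⁻¹) using 1
    have := hpos y
    simp
    field_simp
  · simp only [smul_eq_mul]
    have : (0 : ℝ) < y := hy
    positivity
  · have h1 : Tendsto (fun y : ℝ => 1 + c * y ^ 4) atTop atTop :=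
      tendsto_atTop_add_const_left _ _
        ((tendsto_pow_atTop (by norm_num)).const_mul_atTop hc)
    simpa using (tendsto_inv_atTop_zero.comp h1).const_mul (-(4 * c)⁻¹)

lemma integral_radial_limit :
    ∫ s : ℂ, 32 * ‖s‖ ^ 2 * (Real.exp (‖s‖ ^ 4) ^ 2)⁻¹ = 8 * Real.pi := by
  rw [integral_fun_norm_addHaar (μ := (volume : Measure ℂ))
    (f := fun y => 32 * y ^ 2 * (Real.exp (y ^ 4) ^ 2)⁻¹)]
  have h2 : ∫ y in Set.Ioi (0 : ℝ), y ^ (Module.finrank ℝ ℂ - 1) •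
      (32 * y ^ 2 * (Real.exp (y ^ 4) ^ 2)⁻¹) = 4 := by
    -- The radial integrand `32 r³ exp(-2r⁴)` has primitive `-4 exp(-2r⁴)`, so the radial integral
    -- is `4`; the angle contributes `2π`.
    have h := integral_Ioi_of_hasDerivAt_of_nonneg' (a := 0) (l := 0)
      (g := fun y : ℝ => -4 * Real.exp (-(2 * y ^ 4)))
      (g' := fun y => y ^ (Module.finrank ℝ ℂ - 1) •
        (32 * y ^ 2 * (Real.exp (y ^ 4) ^ 2)⁻¹)) (fun y _ => ?_) (fun y hy => ?_) ?_
    · simpa using h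
    · have h1 : HasDerivAt (fun y : ℝ => -(2 * y ^ 4)) (-(2 * (4 * y ^ 3))) y := by
        simpa [Pi.neg_def] using ((hasDerivAt_pow 4 y).const_mul 2).neg
      convert! (h1.exp).const_mul (-4) using 1
      rw [Complex.finrank_real_complex, ← Real.exp_nat_mul, ← Real.exp_neg]
      simp
      ring
    · have : (0 : ℝ) < y := hy
      simp only [smul_eq_mul]
      positivity
    · have h1 : Tendsto (fun y : ℝ => 2 * y ^ 4) atTop atTop :=
        (tendsto_pow_atTop (by norm_num)).const_mul_atTop (by norm_num)
      simpa using (Real.tendsto_exp_neg_atTop_nhds_zero.comp h1).const_mul (-4)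
  rw [h2, Complex.finrank_real_complex, Measure.real, Complex.volume_ball]
  simp
  ring

/-! ### The Weierstrass map near its pole -/

variable (L : PeriodPair)

/-- The function `z³ ℘'(z)` near the origin. -/
def derivPoleFactor (z : ℂ) : ℂ := z ^ 3 * L.derivWeierstrassPExcept 0 z - 2

lemma derivWeierstrassP_eq_derivPoleFactor {z : ℂ} (hz : z ≠ 0) :
    L.derivWeierstrassP z = derivPoleFactor L z / z ^ 3 := by
  have h := L.derivWeierstrassPExcept_sub ⟨0, zero_mem _⟩ z
  rw [← h, derivPoleFactor]
  simp only [sub_zero]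
  field_simp

lemma continuousAt_derivPoleFactor : ContinuousAt (derivPoleFactor L) 0 := by
  have := (L.analyticAt_derivWeierstrassPExcept 0).continuousAt
  unfold derivPoleFactor
  fun_prop

/-- The height function `(1 + p₃) / 2` of the Weierstrass map. -/
def height (z : ℂ) : ℝ := (1 + weierstrassE3 L z 2) / 2

lemma continuous_height : Continuous (height L) :=
  (continuous_const.add ((PiLp.continuous_apply 2 _ 2).comp
    (contDiff_weierstrassE3 L).continuous)).div_const 2

lemma height_of_notMem {z : ℂ} (hz : z ∉ L.lattice) :
    height L z = ‖L.weierstrassP z‖ ^ 2 / (1 + ‖L.weierstrassP z‖ ^ 2) := by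
  have : (1 : ℝ) + ‖L.weierstrassP z‖ ^ 2 ≠ 0 := by positivity
  rw [height, weierstrassE3, weierstrassMap_of_notMem L hz]
  simp only [invStereo, Matrix.cons_val]
  field_simp
  ring

lemma height_of_mem {z : ℂ} (hz : z ∈ L.lattice) : height L z = 1 := by
  rw [height, weierstrassE3, weierstrassMap_of_mem L hz]
  simp [northPole]

lemma height_nonneg (z : ℂ) : 0 ≤ height L z := by
  by_cases hz : z ∈ L.lattice
  · rw [height_of_mem L hz]; norm_num
  · rw [height_of_notMem L hz]; positivity

lemma height_lt_one {z : ℂ} (hz : z ∉ L.lattice) : height L z < 1 := by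
  rw [height_of_notMem L hz, div_lt_one (by positivity)]
  linarith

lemma height_periodic : ∀ l ∈ L.lattice, ∀ z, height L (z + l) = height L z := fun l hl z => by
  rw [height, weierstrassE3_periodic L l hl, height]

lemma height_eventuallyEq :
    ∀ᶠ z in 𝓝 (0 : ℂ), height L z = (1 + ‖z‖ ^ 4 / ‖poleFactor L z‖ ^ 2)⁻¹ := by
  have hne : ∀ᶠ z in 𝓝 (0 : ℂ), poleFactor L z ≠ 0 :=
    (analyticAt_poleFactor L).continuousAt.eventually_ne (by simp [poleFactor_zero])
  filter_upwards [hne, eventually_notMem_lattice_of_ne_zero L] with z h1 h2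
  by_cases hz : z = 0
  · subst hz
    rw [height_of_mem L (zero_mem _)]
    simp
  · rw [height_of_notMem L (h2 hz), weierstrassP_eq_poleFactor L hz, norm_div, norm_pow]
    have h3 : ‖poleFactor L z‖ ≠ 0 := norm_ne_zero_iff.2 h1
    have h4 : ‖z‖ ≠ 0 := norm_ne_zero_iff.2 hz
    field_simp
    ring

/-- The quotient of the conformal factor by `|z|²` near the origin. -/
def conformalQuotient (z : ℂ) : ℝ :=
  4 * ‖derivPoleFactor L z‖ ^ 2 / (‖z‖ ^ 4 + ‖poleFactor L z‖ ^ 2) ^ 2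

lemma tendsto_conformalQuotient : Tendsto (conformalQuotient L) (𝓝 0) (𝓝 16) := by
  have h1 := continuousAt_derivPoleFactor L
  have h2 := (analyticAt_poleFactor L).continuousAt
  have h3 : ContinuousAt (conformalQuotient L) 0 := by
    unfold conformalQuotient
    refine ContinuousAt.div (by fun_prop) (by fun_prop) ?_
    simp [poleFactor_zero]
  -- `16 = 4 · |-2|²`, from `℘'(z) ≈ -2 / z³` and `℘(z) ≈ 1 / z²`.
  have h4 : conformalQuotient L 0 = 16 := by
    simp [conformalQuotient, poleFactor_zero, derivPoleFactor]
    norm_num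
  rw [← h4]
  exact h3

lemma conformalFactor_eventuallyEq :
    ∀ᶠ z in 𝓝 (0 : ℂ), conformalFactor L z = ‖z‖ ^ 2 * conformalQuotient L z := by
  filter_upwards [eventually_notMem_lattice_of_ne_zero L] with z h2
  by_cases hz : z = 0
  · subst hz
    rw [conformalFactor_of_mem L (zero_mem _)]
    simp
  · rw [conformalFactor_of_notMem L (h2 hz), weierstrassP_eq_poleFactor L hz,
      derivWeierstrassP_eq_derivPoleFactor L hz, norm_div, norm_pow, norm_div, norm_pow,
      conformalQuotient]
    have h4 : ‖z‖ ≠ 0 := norm_ne_zero_iff.2 hz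
    have h5 : ‖z‖ ^ 4 + ‖poleFactor L z‖ ^ 2 ≠ 0 := by positivity
    have h6 : 1 + (‖poleFactor L z‖ / ‖z‖ ^ 2) ^ 2 =
        (‖z‖ ^ 4 + ‖poleFactor L z‖ ^ 2) / ‖z‖ ^ 4 := by field_simp
    rw [h6]
    field_simp

lemma exists_conformalFactor_le : ∃ C, 0 ≤ C ∧ ∀ z, conformalFactor L z ≤ C * ‖z‖ ^ 2 := by
  obtain ⟨B, hB⟩ := exists_bound_of_periodic (L := L) (contDiff_conformalFactor L).continuous
    (conformalFactor_periodic L)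
  have hev : ∀ᶠ z in 𝓝 (0 : ℂ), conformalFactor L z ≤ 17 * ‖z‖ ^ 2 := by
    filter_upwards [conformalFactor_eventuallyEq L,
      (tendsto_conformalQuotient L).eventually_le_const (show (16 : ℝ) < 17 by norm_num)]
      with z h1 h2
    rw [h1, mul_comm]
    gcongr
  obtain ⟨δ, hδ, h⟩ := Metric.eventually_nhds_iff.1 hev
  have hB0 : 0 ≤ B := (norm_nonneg _).trans (hB 0)
  -- `17` works within distance `δ` of the origin, where the quotient is close to `16`; outside, `B
  -- / δ²` absorbs the global bound `B`.
  refine ⟨17 + B / δ ^ 2, by positivity, fun z => ?_⟩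
  rcases lt_or_ge (dist z 0) δ with hz | hz
  · refine (h hz).trans ?_
    have : 0 ≤ B / δ ^ 2 := by positivity
    gcongr
    linarith
  · rw [dist_zero_right] at hz
    have h1 : B ≤ B / δ ^ 2 * ‖z‖ ^ 2 := by
      rw [div_mul_eq_mul_div, le_div_iff₀ (by positivity)]
      gcongr
    have h2 := (le_abs_self _).trans (hB z)
    nlinarith [sq_nonneg ‖z‖]

/-! ### The centred cell and the height function on it -/

/-- The period cell centred at the origin. -/
def centredCell : Set ℂ := (fun z => z + (L.ω₁ + L.ω₂) / 2) ⁻¹' cell L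

lemma mem_centredCell {z : ℂ} :
    z ∈ centredCell L ↔ ∀ i, L.basis.repr z i + 1 / 2 ∈ Set.Ico (0 : ℝ) 1 := by
  have hc : ∀ i, L.basis.repr ((L.ω₁ + L.ω₂) / 2) i = 1 / 2 := by
    have h : (L.ω₁ + L.ω₂) / 2 = (1 / 2 : ℝ) • (L.basis 0 + L.basis 1) := by
      rw [L.basis_zero, L.basis_one, Complex.real_smul]
      push_cast
      ring
    intro i
    rw [h, map_smul, map_add, L.basis.repr_self, L.basis.repr_self]
    fin_cases i <;> simp
  rw [centredCell, Set.mem_preimage, cell, ZSpan.mem_fundamentalDomain]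
  simp only [map_add, Finsupp.add_apply, hc]

lemma continuous_repr (i : Fin 2) : Continuous fun z => L.basis.repr z i :=
  (L.basis.coord i).continuous_of_finiteDimensional

lemma centredCell_mem_nhds : centredCell L ∈ 𝓝 (0 : ℂ) := by
  have h : ∀ᶠ z in 𝓝 (0 : ℂ), ∀ i, L.basis.repr z i + 1 / 2 ∈ Set.Ico (0 : ℝ) 1 := by
    rw [eventually_all]
    intro i
    have hc : Continuous fun z => L.basis.repr z i + 1 / 2 := (continuous_repr L i).add_const _
    exact hc.continuousAt.eventually (Ico_mem_nhds (by simp) (by simp; norm_num))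
  filter_upwards [h] with z hz
  exact (mem_centredCell L).2 hz

lemma measurableSet_centredCell : MeasurableSet (centredCell L) :=
  (measurableSet_cell L).preimage (measurable_add_const _)

lemma isCompact_closure_centredCell : IsCompact (closure (centredCell L)) := by
  refine Bornology.IsBounded.isCompact_closure ?_
  have : centredCell L = (fun z => z - (L.ω₁ + L.ω₂) / 2) '' cell L := by
    ext z
    simp only [centredCell, Set.mem_preimage, Set.mem_image]
    constructor
    · intro h
      exact ⟨_, h, by ring⟩
    · rintro ⟨w, hw, rfl⟩
      simpa using hw
  rw [this]
  obtain ⟨R, hR⟩ := (cell_isBounded L).exists_norm_le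
  refine isBounded_iff_forall_norm_le.2 ⟨R + ‖(L.ω₁ + L.ω₂) / 2‖, ?_⟩
  rintro _ ⟨w, hw, rfl⟩
  exact (norm_sub_le _ _).trans (add_le_add (hR w hw) le_rfl)

/-- Coordinates in the closure lie in `[-1/2, 1/2]`, which contains no integer but `0`. Thus the
origin is the only point where the height reaches `1`, hence the only point of concentration. -/
lemma eq_zero_of_mem_closure_centredCell {z : ℂ} (hz : z ∈ closure (centredCell L))
    (hl : z ∈ L.lattice) : z = 0 := by
  have h1 : ∀ i, L.basis.repr z i + 1 / 2 ∈ Set.Icc (0 : ℝ) 1 := by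
    intro i
    have hc : IsClosed {w | L.basis.repr w i + 1 / 2 ∈ Set.Icc (0 : ℝ) 1} :=
      isClosed_Icc.preimage ((continuous_repr L i).add_const _)
    have hs : centredCell L ⊆ {w | L.basis.repr w i + 1 / 2 ∈ Set.Icc (0 : ℝ) 1} :=
      fun w hw => Set.Ico_subset_Icc_self ((mem_centredCell L).1 hw i)
    exact closure_minimal hs hc hz
  have h2 : ∀ i, ∃ n : ℤ, (n : ℝ) = L.basis.repr z i := by
    rw [L.lattice_eq_span_range_basis] at hl
    exact (L.basis.mem_span_iff_repr_mem ℤ z).1 hl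
  rw [← L.basis.repr.map_eq_zero_iff]
  ext i
  obtain ⟨n, hn⟩ := h2 i
  have h3 := h1 i
  rw [← hn] at h3 ⊢
  have h4 : (-1 : ℝ) < n := by linarith [h3.1]
  have h5 : (n : ℝ) < 1 := by linarith [h3.2]
  have h6 : -1 < n := by exact_mod_cast h4
  have h7 : n < 1 := by exact_mod_cast h5
  have : n = 0 := by omega
  simp [this]

lemma exists_height_le : ∃ c, 0 < c ∧ ∀ z ∈ centredCell L, height L z * (1 + c * ‖z‖ ^ 4) ≤ 1 := by
  have hev : ∀ᶠ z in 𝓝 (0 : ℂ), height L z * (1 + 1 / 2 * ‖z‖ ^ 4) ≤ 1 := by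
    have h2 : Tendsto (fun z => ‖poleFactor L z‖ ^ 2) (𝓝 0) (𝓝 1) := by
      have := ((analyticAt_poleFactor L).continuousAt.norm.pow 2).tendsto
      simpa [poleFactor_zero, Pi.pow_def] using this
    filter_upwards [height_eventuallyEq L, h2.eventually_le_const (show (1 : ℝ) < 2 by norm_num),
      h2.eventually_const_lt (show (0 : ℝ) < 1 by norm_num)] with z h3 h4 h5
    rw [h3, inv_mul_le_iff₀ (by positivity), mul_one]
    have : 1 / 2 * ‖z‖ ^ 4 ≤ ‖z‖ ^ 4 / ‖poleFactor L z‖ ^ 2 := by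
      rw [le_div_iff₀ h5]
      nlinarith [pow_nonneg (norm_nonneg z) 4]
    linarith
  obtain ⟨δ, hδ, h⟩ := Metric.eventually_nhds_iff.1 hev
  let S := closure (centredCell L) \ Metric.ball 0 δ
  have hS : IsCompact S := (isCompact_closure_centredCell L).diff Metric.isOpen_ball
  have hlt : ∀ z ∈ S, height L z < 1 := by
    rintro z ⟨hz, hzb⟩
    refine height_lt_one L fun hl => hzb ?_
    rw [eq_zero_of_mem_closure_centredCell L hz hl]
    exact Metric.mem_ball_self hδ
  obtain ⟨q, hq1, hq⟩ : ∃ q < 1, ∀ z ∈ S, height L z ≤ q := by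
    rcases S.eq_empty_or_nonempty with hem | hne
    · exact ⟨0, by norm_num, fun z hz => by simp [hem] at hz⟩
    · obtain ⟨w, hw, hmax⟩ := hS.exists_isMaxOn hne (continuous_height L).continuousOn
      exact ⟨_, hlt w hw, fun z hz => hmax hz⟩
  obtain ⟨R, hR⟩ := (isCompact_closure_centredCell L).isBounded.exists_norm_le
  -- Near the pole the constant `1/2` suffices. Elsewhere the height is at most `q < 1`, and the
  -- second entry forces `c |z|⁴ ≤ 1 - q`, so the product is at most `q (2 - q) ≤ 1`.
  refine ⟨min (1 / 2) ((1 - q) / (1 + R ^ 4)), ?_, fun z hz => ?_⟩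
  · have : 0 < 1 - q := by linarith
    positivity
  · by_cases hzb : z ∈ Metric.ball (0 : ℂ) δ
    · refine le_trans ?_ (h hzb)
      have := height_nonneg L z
      gcongr
      exact min_le_left _ _
    · have hzc := subset_closure hz
      have h1 := hq z ⟨hzc, hzb⟩
      have h2 : ‖z‖ ^ 4 ≤ 1 + R ^ 4 := by
        have h6 : ‖z‖ ^ 4 ≤ R ^ 4 := by gcongr; exact hR z hzc
        linarith
      have h3 : min (1 / 2) ((1 - q) / (1 + R ^ 4)) * ‖z‖ ^ 4 ≤ 1 - q := by
        have h7 : 0 ≤ (1 - q) / (1 + R ^ 4) := by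
          have : 0 < 1 - q := by linarith
          positivity
        calc min (1 / 2) ((1 - q) / (1 + R ^ 4)) * ‖z‖ ^ 4
            ≤ (1 - q) / (1 + R ^ 4) * (1 + R ^ 4) :=
              mul_le_mul (min_le_right _ _) h2 (by positivity) h7
          _ = 1 - q := div_mul_cancel₀ _ (by positivity)
      have h4 := height_nonneg L z
      have h5 := hlt z ⟨hzc, hzb⟩
      nlinarith

/-- Archimedes' moments make the left side independent of `N`, so the degree can be read off as `N →
∞`. -/
lemma height_moment (N : ℕ) :
    (N + 1) * ∫ z in centredCell L, height L z ^ N * conformalFactor L z =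
      4 * Real.pi * (weierstrassField L).degree := by
  have h := (weierstrassField L).isRotationInvariant_kahlerFunctional.height_pow N
  rw [SkyrmeField.kahlerFunctional_one] at h
  have h1 : (weierstrassField L).kahlerFunctional ((1 + MvPolynomial.X 2) ^ N) =
      2 ^ N * ∫ z in cell L, height L z ^ N * conformalFactor L z := by
    simp only [SkyrmeField.kahlerFunctional, LinearMap.coe_mk, AddHom.coe_mk,
      pullbackKahler_weierstrassField]
    rw [← integral_const_mul]
    congr 1
    ext z
    simp only [map_pow, map_add, map_one, MvPolynomial.eval_X, height, div_pow, weierstrassE3,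
      weierstrassField]
    field_simp
  rw [h1, setIntegral_cell_eq_preimage (L := L) _ ((L.ω₁ + L.ω₂) / 2)] at h
  · have h2 : (2 : ℝ) ^ N ≠ 0 := by positivity
    refine mul_left_cancel₀ h2 ?_
    rw [← h, centredCell]
    ring
  · intro l hl z
    rw [height_periodic L l hl, conformalFactor_periodic L l hl]

/-! ### Rescaling at the pole and the limit of the moments -/

/-- The scaling factor `m^(-1/4)`. -/
def scale (m : ℕ) : ℝ := √√((m : ℝ)⁻¹)

lemma scale_pow_four (m : ℕ) : scale m ^ 4 = (m : ℝ)⁻¹ := by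
  rw [scale, show 4 = 2 * 2 from rfl, pow_mul, Real.sq_sqrt (by positivity),
    Real.sq_sqrt (by positivity)]

lemma scale_nonneg (m : ℕ) : 0 ≤ scale m := Real.sqrt_nonneg _

lemma tendsto_scale : Tendsto scale atTop (𝓝 0) := by
  have h := (Real.continuous_sqrt.comp Real.continuous_sqrt).tendsto 0
  simp only [Function.comp_apply, Real.sqrt_zero] at h
  exact h.comp tendsto_inv_atTop_nhds_zero_nat

/-- The rescaled integrand concentrating at the pole. -/
def rescaled (m : ℕ) (s : ℂ) : ℝ :=
  (2 * m + 1) * scale m ^ 2 * (centredCell L).indicator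
    (fun z => height L z ^ (2 * m) * conformalFactor L z) (scale m • s)

lemma integral_rescaled {m : ℕ} (hm : m ≠ 0) :
    ∫ s, rescaled L m s = 4 * Real.pi * (weierstrassField L).degree := by
  -- The change of variables needs a nonzero scale; `scale 0 = 0` because `0⁻¹ = 0`, whence `m ≠ 0`.
  have hs : scale m ≠ 0 := by
    intro h
    have := scale_pow_four m
    rw [h] at this
    have h2 : (m : ℝ) ≠ 0 := by exact_mod_cast hm
    have h3 : (m : ℝ)⁻¹ ≠ 0 := inv_ne_zero h2
    exact h3 (by rw [← this]; norm_num)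
  simp only [rescaled]
  rw [integral_const_mul, Measure.integral_comp_smul, Complex.finrank_real_complex,
    integral_indicator (measurableSet_centredCell L), smul_eq_mul,
    abs_of_nonneg (inv_nonneg.2 (sq_nonneg _)), ← height_moment L (2 * m)]
  push_cast
  field_simp

/-- At `z = m^(-1/4) s` the height is about `(1 + |s|⁴/m)⁻¹`, so its power `2m` tends to
`exp(-2|s|⁴)`. The conformal factor is about `16 m^(-1/2) |s|²`, and the remaining powers of `m`
tend to `2`. -/
lemma tendsto_rescaled (s : ℂ) : Tendsto (fun m => rescaled L m s) atTop
    (𝓝 (32 * ‖s‖ ^ 2 * (Real.exp (‖s‖ ^ 4) ^ 2)⁻¹)) := by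
  have hz : Tendsto (fun m => scale m • s) atTop (𝓝 0) := by
    simpa using tendsto_scale.smul_const s
  have h1 : Tendsto (fun m => conformalQuotient L (scale m • s)) atTop (𝓝 16) :=
    (tendsto_conformalQuotient L).comp hz
  have h2 : Tendsto (fun m => ‖poleFactor L (scale m • s)‖ ^ 2) atTop (𝓝 1) := by
    have := ((analyticAt_poleFactor L).continuousAt.norm.pow 2).tendsto
    have h0 : Tendsto (fun z => ‖poleFactor L z‖ ^ 2) (𝓝 0) (𝓝 1) := by
      simpa [poleFactor_zero, Pi.pow_def] using this
    exact h0.comp hz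
  have hm : ∀ᶠ m : ℕ in atTop, (m : ℝ) ≠ 0 := by
    filter_upwards [eventually_ne_atTop 0] with m hm
    exact_mod_cast hm
  have h3 : Tendsto (fun m : ℕ => (m : ℝ) * (‖scale m • s‖ ^ 4 / ‖poleFactor L (scale m • s)‖ ^ 2))
      atTop (𝓝 (‖s‖ ^ 4)) := by
    have h := (tendsto_const_nhds (x := ‖s‖ ^ 4)).div h2 one_ne_zero
    rw [div_one] at h
    refine h.congr' ?_
    filter_upwards [hm] with m hm
    rw [norm_smul, mul_pow, Real.norm_of_nonneg (scale_nonneg m), scale_pow_four, Pi.div_apply]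
    field_simp
  have h4 := Real.tendsto_one_add_pow_exp_of_tendsto h3
  have h5 : Tendsto (fun m : ℕ => (2 + (m : ℝ)⁻¹) * ‖s‖ ^ 2 *
      conformalQuotient L (scale m • s) *
      (((1 + ‖scale m • s‖ ^ 4 / ‖poleFactor L (scale m • s)‖ ^ 2) ^ m) ^ 2)⁻¹) atTop
      (𝓝 ((2 + 0) * ‖s‖ ^ 2 * 16 * (Real.exp (‖s‖ ^ 4) ^ 2)⁻¹)) :=
    (((tendsto_inv_atTop_nhds_zero_nat.const_add 2).mul_const _).mul h1).mul
      ((h4.pow 2).inv₀ (by positivity))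
  rw [show (2 + 0) * ‖s‖ ^ 2 * 16 * (Real.exp (‖s‖ ^ 4) ^ 2)⁻¹ =
    32 * ‖s‖ ^ 2 * (Real.exp (‖s‖ ^ 4) ^ 2)⁻¹ by ring] at h5
  refine h5.congr' ?_
  filter_upwards [hm, hz.eventually (height_eventuallyEq L),
    hz.eventually (conformalFactor_eventuallyEq L), hz.eventually (centredCell_mem_nhds L)]
    with m hm h6 h7 h8
  have h8 : scale m • s ∈ centredCell L := h8
  rw [rescaled, Set.indicator_of_mem h8, h6, h7, norm_smul, Real.norm_of_nonneg (scale_nonneg m),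
    inv_pow, mul_pow, show 2 * m = m * 2 by ring, pow_mul]
  have h9 : (2 + (m : ℝ)⁻¹) = (2 * m + 1) * scale m ^ 4 := by
    rw [scale_pow_four]
    field_simp
  rw [h9]
  ring

/-- Bernoulli gives `h^m ≤ (1 + c|s|⁴)⁻¹`. Times `|s|²` this is not integrable over the plane, but
its square is; hence the exponent `2m` rather than `m`. -/
lemma norm_rescaled_le {C c : ℝ} (hC0 : 0 ≤ C) (hC : ∀ z, conformalFactor L z ≤ C * ‖z‖ ^ 2)
    (hc0 : 0 < c) (hc : ∀ z ∈ centredCell L, height L z * (1 + c * ‖z‖ ^ 4) ≤ 1) {m : ℕ}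
    (hm : m ≠ 0) (s : ℂ) :
    ‖rescaled L m s‖ ≤ 3 * C * (‖s‖ ^ 2 / (1 + c * ‖s‖ ^ 4) ^ 2) := by
  have hm1 : (1 : ℝ) ≤ m := by exact_mod_cast Nat.one_le_iff_ne_zero.2 hm
  by_cases hs : scale m • s ∈ centredCell L
  · have h0 := height_nonneg L (scale m • s)
    have hk := conformalFactor_nonneg L (scale m • s)
    rw [rescaled, Set.indicator_of_mem hs, Real.norm_of_nonneg (by positivity)]
    have h1 := hC (scale m • s)
    have h2 := hc _ hs
    rw [norm_smul, Real.norm_of_nonneg (scale_nonneg m), mul_pow] at h1 h2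
    rw [scale_pow_four] at h2
    have h3 : height L (scale m • s) ^ m * (1 + c * ‖s‖ ^ 4) ≤ 1 := by
      have hb := one_add_mul_le_pow (a := c * ((m : ℝ)⁻¹ * ‖s‖ ^ 4))
        (by have : 0 ≤ c * ((m : ℝ)⁻¹ * ‖s‖ ^ 4) := by positivity
            linarith) m
      have e : 1 + (m : ℝ) * (c * ((m : ℝ)⁻¹ * ‖s‖ ^ 4)) = 1 + c * ‖s‖ ^ 4 := by
        field_simp
      rw [e] at hb
      calc height L (scale m • s) ^ m * (1 + c * ‖s‖ ^ 4)
          ≤ height L (scale m • s) ^ m * (1 + c * ((m : ℝ)⁻¹ * ‖s‖ ^ 4)) ^ m := by gcongr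
        _ = (height L (scale m • s) * (1 + c * ((m : ℝ)⁻¹ * ‖s‖ ^ 4))) ^ m := by rw [mul_pow]
        _ ≤ 1 := pow_le_one₀ (by positivity) h2
    have h4 : height L (scale m • s) ^ (2 * m) ≤ ((1 + c * ‖s‖ ^ 4) ^ 2)⁻¹ := by
      have h5 : height L (scale m • s) ^ m ≤ (1 + c * ‖s‖ ^ 4)⁻¹ := by
        rw [← one_div, le_div_iff₀ (by positivity)]
        exact h3
      rw [mul_comm 2 m, pow_mul, ← inv_pow]
      gcongr
    have h6 : (2 * m + 1) * scale m ^ 4 ≤ 3 := by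
      rw [scale_pow_four, ← div_eq_mul_inv, div_le_iff₀ (by positivity)]
      linarith
    calc (2 * m + 1) * scale m ^ 2 * (height L (scale m • s) ^ (2 * m) *
          conformalFactor L (scale m • s))
        ≤ (2 * m + 1) * scale m ^ 2 * (((1 + c * ‖s‖ ^ 4) ^ 2)⁻¹ *
          (C * (scale m ^ 2 * ‖s‖ ^ 2))) := by gcongr
      _ = ((2 * m + 1) * scale m ^ 4) * (C * (‖s‖ ^ 2 / (1 + c * ‖s‖ ^ 4) ^ 2)) := by
          rw [div_eq_mul_inv]; ring
      _ ≤ 3 * (C * (‖s‖ ^ 2 / (1 + c * ‖s‖ ^ 4) ^ 2)) := by gcongr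
      _ = _ := by ring
  · rw [rescaled, Set.indicator_of_notMem hs, mul_zero, norm_zero]
    positivity

lemma aestronglyMeasurable_rescaled (m : ℕ) : AEStronglyMeasurable (rescaled L m) volume := by
  have h1 : Measurable ((centredCell L).indicator
      (fun z => height L z ^ (2 * m) * conformalFactor L z)) :=
    (((continuous_height L).pow _).mul
      (contDiff_conformalFactor L).continuous).measurable.indicator (measurableSet_centredCell L)
  exact ((h1.comp (measurable_const_smul (scale m))).const_mul _).aestronglyMeasurable

/-- The Weierstrass map has degree two. -/
lemma degree_weierstrassField : (weierstrassField L).degree = 2 := by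
  obtain ⟨C, hC0, hC⟩ := exists_conformalFactor_le L
  obtain ⟨c, hc0, hc⟩ := exists_height_le L
  have h := tendsto_integral_filter_of_dominated_convergence (μ := volume) (l := atTop)
    (F := rescaled L) (f := fun s => 32 * ‖s‖ ^ 2 * (Real.exp (‖s‖ ^ 4) ^ 2)⁻¹)
    (fun s => 3 * C * (‖s‖ ^ 2 / (1 + c * ‖s‖ ^ 4) ^ 2))
    (Eventually.of_forall (aestronglyMeasurable_rescaled L))
    (by
      filter_upwards [eventually_ne_atTop 0] with m hm
      exact Eventually.of_forall (norm_rescaled_le L hC0 hC hc0 hc hm))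
    (integrable_radial_bound hc0 _) (Eventually.of_forall (tendsto_rescaled L))
  rw [integral_radial_limit] at h
  have h2 : Tendsto (fun m => ∫ s, rescaled L m s) atTop
      (𝓝 (4 * Real.pi * (weierstrassField L).degree)) := by
    refine tendsto_const_nhds.congr' ?_
    filter_upwards [eventually_ne_atTop 0] with m hm
    rw [integral_rescaled L hm]
  have h3 := tendsto_nhds_unique h2 h
  have := Real.pi_pos
  have h4 : (4 * Real.pi) * (weierstrassField L).degree = (4 * Real.pi) * 2 := by
    rw [h3]; ring
  exact mul_left_cancel₀ (by positivity) h4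

end Degree

/-! ### Variations of the metric -/

section Metric

variable (p q : ℝ)

/-- The energy density, with respect to the metric `m`, of a conformal map whose conformal factor is
`p` and whose Kähler density and (weierstrassPotential L.g₂ L.g₃) square to `q`. -/
def metricDensity (m : Matrix (Fin 2) (Fin 2) ℝ) : ℝ :=
  1 / 2 * (p * (m.trace * (√m.det)⁻¹) + q * ((√m.det)⁻¹ + √m.det))

/-- The derivative of `Matrix.det` at `m` in the direction `ε`. -/
def detVariation (m ε : Matrix (Fin 2) (Fin 2) ℝ) : ℝ :=
  ε 0 0 * m 1 1 + m 0 0 * ε 1 1 - (ε 0 1 * m 1 0 + m 0 1 * ε 1 0)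

/-- The derivative of `metricDensity` at `m` in the direction `ε`. -/
def metricDensityVariation (m ε : Matrix (Fin 2) (Fin 2) ℝ) : ℝ :=
  1 / 2 * (p * (ε.trace * (√m.det)⁻¹ - m.trace * (detVariation m ε / 2 * (√m.det)⁻¹ ^ 3)) +
    q * (detVariation m ε / 2 * ((√m.det)⁻¹ - (√m.det)⁻¹ ^ 3)))

/-- The second derivative of `metricDensity` at the Euclidean metric. -/
def metricHessian : LinearMap.BilinForm ℝ parallelForms :=
  LinearMap.mk₂ ℝ (fun ε' ε =>
    p * (1 / 4 * (ε'.1 0 0 - ε'.1 1 1) * (ε.1 0 0 - ε.1 1 1) + ε'.1 0 1 * ε.1 0 1) +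
      q / 4 * ((ε'.1 0 0 + ε'.1 1 1) * (ε.1 0 0 + ε.1 1 1)))
    (fun _ _ _ => by simp; ring) (fun _ _ _ => by simp; ring)
    (fun _ _ _ => by simp; ring) (fun _ _ _ => by simp; ring)

lemma metricHessian_apply (ε' ε : parallelForms) : metricHessian p q ε' ε =
    p * (1 / 4 * (ε'.1 0 0 - ε'.1 1 1) * (ε.1 0 0 - ε.1 1 1) + ε'.1 0 1 * ε.1 0 1) +
      q / 4 * ((ε'.1 0 0 + ε'.1 1 1) * (ε.1 0 0 + ε.1 1 1)) := rfl

/-- The form is a sum of squares: `p` weights the trace-free part of `ε`, `q` weights its trace, and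
together they determine `ε`. -/
lemma metricHessian_pos {p q : ℝ} (hp : 0 < p) (hq : 0 < q) {ε : parallelForms} (hε : ε ≠ 0) :
    0 < metricHessian p q ε ε := by
  rw [metricHessian_apply]
  by_contra! h
  have h1 := mul_nonneg hp.le (sq_nonneg (ε.1 0 0 - ε.1 1 1))
  have h2 := mul_nonneg hp.le (sq_nonneg (ε.1 0 1))
  have h3 := mul_nonneg hq.le (sq_nonneg (ε.1 0 0 + ε.1 1 1))
  have e1 : p * (ε.1 0 0 - ε.1 1 1) ^ 2 = 0 := by nlinarith
  have e2 : p * ε.1 0 1 ^ 2 = 0 := by nlinarith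
  have e3 : q * (ε.1 0 0 + ε.1 1 1) ^ 2 = 0 := by nlinarith
  simp only [mul_eq_zero, hp.ne', hq.ne', false_or, pow_eq_zero_iff, ne_eq, OfNat.ofNat_ne_zero,
    not_false_eq_true] at e1 e2 e3
  have e4 : ε.1 1 0 = ε.1 0 1 := ε.2.apply 0 1
  apply hε
  ext i j
  fin_cases i <;> fin_cases j <;> simp <;> linarith

lemma hasDerivAt_det {m : ℝ → Matrix (Fin 2) (Fin 2) ℝ} {ε : Matrix (Fin 2) (Fin 2) ℝ} {x : ℝ}
    (hm : ∀ i j, HasDerivAt (fun t => m t i j) (ε i j) x) :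
    HasDerivAt (fun t => (m t).det) (detVariation (m x) ε) x := by
  simp only [Matrix.det_fin_two]
  exact ((hm 0 0).mul (hm 1 1)).sub ((hm 0 1).mul (hm 1 0))

lemma hasDerivAt_trace {m : ℝ → Matrix (Fin 2) (Fin 2) ℝ} {ε : Matrix (Fin 2) (Fin 2) ℝ} {x : ℝ}
    (hm : ∀ i j, HasDerivAt (fun t => m t i j) (ε i j) x) :
    HasDerivAt (fun t => (m t).trace) ε.trace x := by
  simp only [Matrix.trace_fin_two]
  exact (hm 0 0).add (hm 1 1)

lemma hasDerivAt_inv_sqrt_det {m : ℝ → Matrix (Fin 2) (Fin 2) ℝ} {ε : Matrix (Fin 2) (Fin 2) ℝ}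
    {x : ℝ} (hm : ∀ i j, HasDerivAt (fun t => m t i j) (ε i j) x) (h0 : 0 < (m x).det) :
    HasDerivAt (fun t => (√(m t).det)⁻¹) (-(detVariation (m x) ε / 2 * (√(m x).det)⁻¹ ^ 3)) x := by
  have hs : √(m x).det ≠ 0 := (Real.sqrt_pos.2 h0).ne'
  convert! ((hasDerivAt_det hm).sqrt h0.ne').inv hs using 1
  field_simp

lemma hasDerivAt_metricDensity {m : ℝ → Matrix (Fin 2) (Fin 2) ℝ}
    {ε : Matrix (Fin 2) (Fin 2) ℝ} {x : ℝ}
    (hm : ∀ i j, HasDerivAt (fun t => m t i j) (ε i j) x) (h0 : 0 < (m x).det) :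
    HasDerivAt (fun t => metricDensity p q (m t)) (metricDensityVariation p q (m x) ε) x := by
  have hs : √(m x).det ≠ 0 := (Real.sqrt_pos.2 h0).ne'
  have h1 := hasDerivAt_inv_sqrt_det hm h0
  convert! (((((hasDerivAt_trace hm).mul h1).const_mul p).add
    ((h1.add ((hasDerivAt_det hm).sqrt h0.ne')).const_mul q)).const_mul (1 / 2)) using 1
  rw [metricDensityVariation]
  field_simp
  ring

/-- The first-order changes of `tr m` and `√det m` cancel in their quotient, and `x + 1/x` is
stationary at `x = 1`. -/
lemma metricDensityVariation_one (ε : Matrix (Fin 2) (Fin 2) ℝ) :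
    metricDensityVariation p q 1 ε = 0 := by
  simp [metricDensityVariation, detVariation, Matrix.trace_fin_two]
  right
  ring

/-- The acceleration `η` enters only through the first variation at the identity, which vanishes. So
the second derivative depends on `ε'` and `ε` alone. -/
lemma hasDerivAt_metricDensityVariation {m e : ℝ → Matrix (Fin 2) (Fin 2) ℝ}
    {ε' ε : parallelForms} {η : Matrix (Fin 2) (Fin 2) ℝ} (h0 : m 0 = 1) (he0 : e 0 = ε.1)
    (hm : ∀ i j, HasDerivAt (fun t => m t i j) (ε'.1 i j) 0)
    (he : ∀ i j, HasDerivAt (fun t => e t i j) (η i j) 0) :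
    HasDerivAt (fun t => metricDensityVariation p q (m t) (e t)) (metricHessian p q ε' ε) 0 := by
  have h1 := hasDerivAt_inv_sqrt_det hm (by simp [h0])
  have hd : HasDerivAt (fun t => detVariation (m t) (e t)) (_) 0 :=
    (((he 0 0).mul (hm 1 1)).add ((hm 0 0).mul (he 1 1))).sub
      (((he 0 1).mul (hm 1 0)).add ((hm 0 1).mul (he 1 0)))
  have hd2 := hd.div_const 2
  convert! ((((((hasDerivAt_trace he).mul h1).sub
    ((hasDerivAt_trace hm).mul (hd2.mul (h1.pow 3)))).const_mul p).add
      ((hd2.mul (h1.sub (h1.pow 3))).const_mul q)).const_mul (1 / 2)) using 1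
  have e1 : ε.1 1 0 = ε.1 0 1 := ε.2.apply 0 1
  have e2 : ε'.1 1 0 = ε'.1 0 1 := ε'.2.apply 0 1
  simp [h0, he0, detVariation, metricHessian_apply, e1, e2, Matrix.trace_fin_two]
  ring

end Metric

/-! ### Energy of the Weierstrass map under variations of the metric -/

namespace SkyrmeField

variable (L : PeriodPair)

/-- Conformality leaves only the trace of `g⁻¹`, which for a `2 × 2` matrix is `tr g / det g`. The
`E₄` and `E₀` densities share the factor `κ²`, `κ` being the conformal factor, because `U(φ) =
φ^*ω`. -/
lemma energy_weierstrassField {g : ℂ → Matrix (Fin 2) (Fin 2) ℝ}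
    (hg : ∀ i j, Continuous fun z => g z i j) (hp : ∀ z, (g z).PosDef) :
    energy (weierstrassPotential L.g₂ L.g₃) (weierstrassField L) g =
      ∫ z in cell L, metricDensity (conformalFactor L z) (conformalFactor L z ^ 2) (g z) := by
  have hK := (contDiff_conformalFactor L).continuous
  have hd : Continuous fun z => √(g z).det := by
    simp only [Matrix.det_fin_two]
    exact (((hg 0 0).mul (hg 1 1)).sub ((hg 0 1).mul (hg 1 0))).sqrt
  have hd' : Continuous fun z => (√(g z).det)⁻¹ :=
    hd.inv₀ fun z => (Real.sqrt_pos.2 (hp z).det_pos).ne'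
  have h2 : (weierstrassField L).energy2 g = 1 / 2 *
      ∫ z in cell L, conformalFactor L z * ((g z).trace * (√(g z).det)⁻¹) := by
    rw [energy2]
    congr 2 with z
    have := (hp z).det_pos
    have hs := Real.sqrt_pos.2 this
    simp only [Fin.sum_univ_two, inner_weierstrassField_diff, Matrix.inv_def, Ring.inverse_eq_inv',
      Matrix.adjugate_fin_two, Matrix.trace_fin_two]
    simp
    rw [← Real.sqrt_div_self]
    ring
  have h4 : (weierstrassField L).energy4 g = 1 / 2 *
      ∫ z in cell L, conformalFactor L z ^ 2 * (√(g z).det)⁻¹ := by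
    rw [energy4]
    congr 2 with z
    rw [pullbackKahler_weierstrassField, ← Real.sqrt_div_self]
    ring
  have h0 : energy0 (weierstrassPotential L.g₂ L.g₃) (weierstrassField L) g = 1 / 2 *
      ∫ z in cell L, conformalFactor L z ^ 2 * √(g z).det := by
    rw [energy0]
    congr 2 with z
    rw [show (weierstrassField L).toFun z = weierstrassMap L z from rfl,
      weierstrassPotential_weierstrassMap]
  have ht : Continuous fun z => (g z).trace := by
    simp only [Matrix.trace_fin_two]
    exact (hg 0 0).add (hg 1 1)
  have i2 : IntegrableOn (fun z => conformalFactor L z * ((g z).trace * (√(g z).det)⁻¹)) (cell L) :=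
    integrableOn_cell_of_continuous (hK.mul (ht.mul hd'))
  have i4 : IntegrableOn (fun z => conformalFactor L z ^ 2 * (√(g z).det)⁻¹) (cell L) :=
    integrableOn_cell_of_continuous ((hK.pow 2).mul hd')
  have i0 : IntegrableOn (fun z => conformalFactor L z ^ 2 * √(g z).det) (cell L) :=
    integrableOn_cell_of_continuous ((hK.pow 2).mul hd)
  have i24 : IntegrableOn (fun z => conformalFactor L z * ((g z).trace * (√(g z).det)⁻¹) +
      conformalFactor L z ^ 2 * (√(g z).det)⁻¹) (cell L) := i2.add i4
  rw [energy, h2, h4, h0, ← mul_add, ← mul_add, ← integral_add i2 i4, ← integral_add i24 i0,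
    ← integral_const_mul]
  congr 1 with z
  simp only [metricDensity]
  ring

lemma energy_weierstrassField_const {m : Matrix (Fin 2) (Fin 2) ℝ} (hm : m.PosDef) :
    energy (weierstrassPotential L.g₂ L.g₃) (weierstrassField L) (fun _ => m) =
      metricDensity (∫ z in cell L, conformalFactor L z)
        (∫ z in cell L, conformalFactor L z ^ 2) m := by
  have hK := (contDiff_conformalFactor L).continuous
  have h1 : IntegrableOn (fun z => conformalFactor L z) (cell L) :=
    integrableOn_cell_of_continuous hK
  have h2 : IntegrableOn (fun z => conformalFactor L z ^ 2) (cell L) :=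
    integrableOn_cell_of_continuous (hK.pow 2)
  rw [energy_weierstrassField L (g := fun _ => m) (fun _ _ => continuous_const)
    (fun _ => hm)]
  simp only [metricDensity]
  rw [integral_const_mul, integral_add (h1.mul_const _) (h2.mul_const _), integral_mul_const,
    integral_mul_const]

/-- A jointly smooth family of periodic functions has a uniformly bounded parameter derivative. -/
lemma exists_bound_fderiv_of_periodic {F : ℝ × ℂ → ℝ} (hF : ContDiff ℝ ∞ F)
    (hper : ∀ t, ∀ l ∈ L.lattice, ∀ z, F (t, z + l) = F (t, z)) :
    ∃ C, ∀ t ∈ Set.Icc (-1 : ℝ) 1, ∀ z, ‖fderiv ℝ F (t, z) (1, 0)‖ ≤ C := by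
  have hc : Continuous fun q => fderiv ℝ F q (1, 0) :=
    (hF.continuous_fderiv (by simp)).clm_apply continuous_const
  obtain ⟨C, hC⟩ := ((isCompact_Icc (a := (-1 : ℝ)) (b := 1)).prod
    (cell_isBounded L).isCompact_closure).exists_bound_of_continuousOn hc.continuousOn
  refine ⟨C, fun t ht z => ?_⟩
  -- By periodicity the derivative at `z` equals the one at a point of the cell, where compactness
  -- bounds it.
  obtain ⟨l, hl, hz⟩ := exists_add_mem_cell L z
  have h : fderiv ℝ F (t, z) = fderiv ℝ F (t, z + l) := by
    have e : F = fun q => F (q + (0, l)) := by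
      ext ⟨s, w⟩
      simp [hper s l hl w]
    conv_lhs => rw [e]
    rw [fderiv_comp_add_right]
    simp
  rw [h]
  exact hC _ ⟨ht, subset_closure hz⟩

/-- The stress tensor is zero, not merely orthogonal to parallel forms: `E₂` is stationary because
the map is conformal, and the contributions of `E₀` and `E₄` cancel pointwise. -/
lemma isStressTensor_weierstrassField :
    IsStressTensor (weierstrassPotential L.g₂ L.g₃) (weierstrassField L) (fun _ => 0) where
  symm := fun _ => Matrix.isSymm_zero
  periodic := fun _ _ _ => rfl
  integrable := fun _ _ => by simp
  first_variation := fun g hg => by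
    let F : ℝ × ℂ → ℝ := fun q =>
      metricDensity (conformalFactor L q.2) (conformalFactor L q.2 ^ 2) (g q.1 q.2)
    have hK : ContDiff ℝ ∞ fun q : ℝ × ℂ => conformalFactor L q.2 :=
      (contDiff_conformalFactor L).comp contDiff_snd
    have hdet : ContDiff ℝ ∞ fun q : ℝ × ℂ => √(g q.1 q.2).det := by
      refine ContDiff.sqrt ?_ fun q => (hg.posDef q.1 q.2).det_pos.ne'
      simp only [Matrix.det_fin_two]
      exact ((hg.smooth 0 0).mul (hg.smooth 1 1)).sub ((hg.smooth 0 1).mul (hg.smooth 1 0))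
    have hdet' : ContDiff ℝ ∞ fun q : ℝ × ℂ => (√(g q.1 q.2).det)⁻¹ :=
      hdet.inv fun q => (Real.sqrt_pos.2 (hg.posDef q.1 q.2).det_pos).ne'
    have htr : ContDiff ℝ ∞ fun q : ℝ × ℂ => (g q.1 q.2).trace := by
      simp only [Matrix.trace_fin_two]
      exact (hg.smooth 0 0).add (hg.smooth 1 1)
    have hF : ContDiff ℝ ∞ F := contDiff_const.mul
      ((hK.mul (htr.mul hdet')).add ((hK.pow 2).mul (hdet'.add hdet)))
    have hper : ∀ t, ∀ l ∈ L.lattice, ∀ z, F (t, z + l) = F (t, z) := fun t l hl z => by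
      simp only [F, hg.periodic t l hl z, conformalFactor_periodic L l hl z]
    obtain ⟨C, hC⟩ := exists_bound_fderiv_of_periodic L hF hper
    have hd : ∀ t z, HasDerivAt (fun s => F (s, z)) (fderiv ℝ F (t, z) (1, 0)) t := fun t z =>
      (hF.differentiable (by simp) _).hasFDerivAt.comp_hasDerivAt t
        ((hasDerivAt_id t).prodMk (hasDerivAt_const t z))
    have hc : Continuous fun q => fderiv ℝ F q (1, 0) :=
      (hF.continuous_fderiv (by simp)).clm_apply continuous_const
    have h := hasDerivAt_integral_of_bounded (μ := volume.restrict (cell L))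
      (f := fun t z => F (t, z)) (f' := fun t z => fderiv ℝ F (t, z) (1, 0))
      (fun t => (hF.continuous.comp (by fun_prop)).aestronglyMeasurable)
      (integrableOn_cell_of_continuous (hF.continuous.comp (by fun_prop)))
      (hc.comp (g := fun q => fderiv ℝ F q (1, 0)) (by fun_prop)).aestronglyMeasurable hC hd
    have h0 : ∀ z, fderiv ℝ F (0, z) (1, 0) = 0 := fun z => by
      have hz : ∀ i j, HasDerivAt (fun t => g t z i j)
          ((Matrix.of fun i j => deriv (fun t => g t z i j) 0) i j) 0 := fun i j =>
        (((hg.smooth i j).comp (f := fun t : ℝ => (t, z)) (by fun_prop)).differentiable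
          (by simp) 0).hasDerivAt
      have h1 := hasDerivAt_metricDensity (conformalFactor L z) (conformalFactor L z ^ 2) hz
        (hg.posDef 0 z).det_pos
      rw [hg.at_zero, metricDensityVariation_one] at h1
      exact (hd 0 z).unique h1
    simp only [h0, integral_zero] at h
    have he : (fun t => energy (weierstrassPotential L.g₂ L.g₃) (weierstrassField L) (g t)) =
        fun t => ∫ z in cell L, F (t, z) := by
      ext t
      exact energy_weierstrassField L
        (fun i j => (hg.smooth i j).continuous.comp (f := fun z => (t, z)) (by fun_prop))
        (hg.posDef t)
    rw [he]
    simpa [formInner] using h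

lemma isHessian_weierstrassField : IsHessian (weierstrassPotential L.g₂ L.g₃) (weierstrassField L)
    (metricHessian (∫ z in cell L, conformalFactor L z)
      (∫ z in cell L, conformalFactor L z ^ 2)) := by
  refine ⟨fun ε' ε => by rw [metricHessian_apply, metricHessian_apply]; ring,
    fun g ε' ε hg hs ht => ?_⟩
  -- The direction `∂g/∂t` at `(s, 0)`. The inner derivative of the energy is the first variation at
  -- `g s 0` in this direction.
  let e : ℝ → Matrix (Fin 2) (Fin 2) ℝ := fun s =>
    Matrix.of fun i j => fderiv ℝ (fun q : ℝ × ℝ => g q.1 q.2 i j) (s, 0) (0, 1)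
  have hd : ∀ s i j, HasDerivAt (fun t => g s t i j) (e s i j) 0 := fun s i j =>
    ((hg.smooth i j).differentiable (by simp) (s, 0)).hasFDerivAt.comp_hasDerivAt (0 : ℝ)
      ((hasDerivAt_const (0 : ℝ) s).prodMk (hasDerivAt_id (0 : ℝ)))
  have he : ∀ i j, ContDiff ℝ ∞ fun s => e s i j := fun i j =>
    (((hg.smooth i j).fderiv_right (m := ∞) (by simp)).comp
      (f := fun s : ℝ => (s, (0 : ℝ))) (by fun_prop)).clm_apply contDiff_const
  refine ⟨fun s => metricDensityVariation _ _ (g s 0) (e s), fun s => ?_,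
    hasDerivAt_metricDensityVariation _ _ hg.at_zero ?_ hs
      (η := Matrix.of fun i j => deriv (fun s => e s i j) 0)
      fun i j => ((he i j).differentiable (by simp) 0).hasDerivAt⟩
  · simp only [energy_weierstrassField_const L (hg.posDef s _)]
    exact hasDerivAt_metricDensity _ _ (hd s) (hg.posDef s 0).det_pos
  · ext i j
    exact (hd 0 i j).unique (ht i j)

lemma setIntegral_conformalFactor : ∫ z in cell L, conformalFactor L z = 8 * Real.pi := by
  have := (weierstrassField L).setIntegral_pullbackKahler
  simp only [pullbackKahler_weierstrassField, degree_weierstrassField] at this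
  rw [this]
  ring

/-- If the integral vanished, the conformal factor would be zero almost everywhere, contradicting
its integral `8π`. -/
lemma setIntegral_conformalFactor_sq_pos : 0 < ∫ z in cell L, conformalFactor L z ^ 2 := by
  have hK := (contDiff_conformalFactor L).continuous
  refine lt_of_le_of_ne (integral_nonneg fun z => sq_nonneg _) fun h => ?_
  have h1 := (integral_eq_zero_iff_of_nonneg (fun z => sq_nonneg _)
    (integrableOn_cell_of_continuous (L := L) (hK.pow 2))).1 h.symm
  have h2 : ∫ z in cell L, conformalFactor L z = 0 := by
    refine integral_eq_zero_of_ae ?_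
    filter_upwards [h1] with z hz
    simpa using hz
  rw [setIntegral_conformalFactor] at h2
  exact (by positivity : (8 * Real.pi) ≠ 0) h2

lemma energy2_weierstrassField :
    (weierstrassField L).energy2 1 = 4 * Real.pi * (weierstrassField L).degree := by
  rw [energy2_one, ← setIntegral_pullbackKahler, ← integral_const_mul]
  congr 1 with z
  simp only [inner_weierstrassField_diff, pullbackKahler_weierstrassField, if_true]
  ring

lemma energy0_add_energy4_weierstrassField :
    energy0 (weierstrassPotential L.g₂ L.g₃) (weierstrassField L) 1 +
        (weierstrassField L).energy4 1 =
      4 * Real.pi * sphereAverage (weierstrassPotential L.g₂ L.g₃) *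
        (weierstrassField L).degree := by
  rw [← (weierstrassField L).setIntegral_comp_mul_pullbackKahler
    (continuous_weierstrassPotential L.g₂ L.g₃), energy0_one, energy4_one]
  simp only [show ∀ z, (weierstrassField L).toFun z = weierstrassMap L z from fun _ => rfl,
    weierstrassPotential_weierstrassMap, pullbackKahler_weierstrassField, ← sq]
  ring

/-- The two lower bounds depend on a field only through its degree, and the Weierstrass field
attains both. -/
lemma isMinimizer_weierstrassField :
    IsMinimizer (weierstrassPotential L.g₂ L.g₃) (weierstrassField L) := by
  intro Ψ hΨ
  have h1 := Ψ.le_energy2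
  have h2 := Ψ.le_energy0_add_energy4 (continuous_weierstrassPotential L.g₂ L.g₃)
  rw [hΨ] at h1 h2
  rw [energy, energy]
  linarith [energy2_weierstrassField L, energy0_add_energy4_weierstrassField L]

lemma isSolitonLattice_weierstrassField :
    IsSolitonLattice (weierstrassPotential L.g₂ L.g₃) (weierstrassField L) :=
  ⟨isMinimizer_weierstrassField L, _, isStressTensor_weierstrassField L,
    fun _ _ => by simp [formInner]⟩

lemma isSolitonCrystal_weierstrassField :
    IsSolitonCrystal (weierstrassPotential L.g₂ L.g₃) (weierstrassField L) := by
  refine ⟨isSolitonLattice_weierstrassField L, _, isHessian_weierstrassField L, fun ε hε =>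
    metricHessian_pos ?_ (setIntegral_conformalFactor_sq_pos L) hε⟩
  rw [setIntegral_conformalFactor]
  positivity

end SkyrmeField

end BabySkyrme

end

theorem mainTheorem4 (L : PeriodPair) :
    (∀ z, z ∉ L.lattice → deriv L.weierstrassP z ^ 2 =
      4 * L.weierstrassP z ^ 3 - L.g₂ * L.weierstrassP z - L.g₃) ∧
    IsHolomorphicMap (weierstrassMap L) ∧
    ∃ Φ : SkyrmeField L,
      Φ.toFun = weierstrassMap L ∧
      Φ.diff = (fun z => fderiv ℝ (fun w => (weierstrassMap L w : E3)) z) ∧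
      Φ.degree = 2 ∧
      (∀ Ψ : SkyrmeField L, 4 * Real.pi * Ψ.degree ≤ Ψ.energy2 1) ∧
      (∀ Ψ : SkyrmeField L,
        4 * Real.pi * sphereAverage (weierstrassPotential L.g₂ L.g₃) * Ψ.degree ≤
          energy0 (weierstrassPotential L.g₂ L.g₃) Ψ 1 + Ψ.energy4 1) ∧
      Φ.energy2 1 = 4 * Real.pi * Φ.degree ∧
      energy0 (weierstrassPotential L.g₂ L.g₃) Φ 1 + Φ.energy4 1 =
        4 * Real.pi * sphereAverage (weierstrassPotential L.g₂ L.g₃) * Φ.degree ∧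
      IsMinimizer (weierstrassPotential L.g₂ L.g₃) Φ ∧
      IsSolitonLattice (weierstrassPotential L.g₂ L.g₃) Φ ∧
      IsSolitonCrystal (weierstrassPotential L.g₂ L.g₃) Φ :=
  ⟨fun z hz => by rw [L.deriv_weierstrassP, L.derivWeierstrassP_sq z hz],
    isHolomorphicMap_weierstrassMap L, weierstrassField L, rfl, rfl, degree_weierstrassField L,
    fun Ψ => Ψ.le_energy2,
    fun Ψ => Ψ.le_energy0_add_energy4 (continuous_weierstrassPotential L.g₂ L.g₃),
    energy2_weierstrassField L, energy0_add_energy4_weierstrassField L,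
    isMinimizer_weierstrassField L, isSolitonLattice_weierstrassField L,
    isSolitonCrystal_weierstrassField L⟩
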